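/- **Setting.** Let $C^2_{31}=1=-C^2_{13}$, $C^3_{12}=1=-C^3_{21}$ be the only non-vanishing structure constants of Bianchi type VII$_0$ in a left-invariant frame. A smooth solution on $[t_0,\infty)$ of the Einstein–Vlasov system with Bianchi VII$_0$ symmetry (massive particles, spacetime metric $-dt^2+g_{ab}(t)\,\xi^a\otimes\xi^b$) consists of a $C^\infty$ family of positive definite matrices $g_{ab}(t)$, a $C^\infty$ family $k_{ab}(t)$ and a $C^\infty$ function $f(t,p_1,p_2,p_3)\ge 0$ with $$\dot g_{ab}=2k_{ab},\qquad \dot k_{ab}=-R_{ab}+2k^i_ak_{bi}-k\,k_{ab}+S_{ab}+\tfrac12(\rho-S)g_{ab},$$ $$R-k_{ij}k^{ij}+k^2=2\rho,\qquad \nabla^jk_{ji}=-J_i,\qquad p^0\,\partial_tf+C^d_{ba}p^bp_d\,\frac{\partial f}{\partial p_a}=0,$$ where $R_{ab}$, $R$, $\nabla$ belong to the left-invariant metric $g_{ab}(t)$, $k=g^{ab}k_{ab}$, $p^0=\sqrt{1+g^{ab}p_ap_b}$, and $$\rho=(\det g)^{-1/2}\!\int\! f\,p^0\,dp,\quad J_i=(\det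 g)^{-1/2}\!\int\! f\,p_i\,dp,\quad S_{ij}=(\det g)^{-1/2}\!\int\! f\,\frac{p_ip_j}{p^0}\,dp,\quad S=g^{ab}S_{ab}.$$ It is reflection symmetric if $g_{ab}(t)$ and $k_{ab}(t)$ are diagonal and $f(t,p_1,p_2,p_3)=f(t,-p_1,-p_2,p_3)=f(t,p_1,-p_2,-p_3)$. Put $H=k/3$, $\Sigma^a_b=(k^a_b-H\delta^a_b)/H$, and let the dimensionless time $\tau$ satisfy $d\tau/dt=H$, with $\tau_0=\tau(t_0)$. Put $$\Sigma_+=\tfrac12(\Sigma^2_2+\Sigma^3_3),\quad \Sigma_-=\tfrac1{2\sqrt3}(\Sigma^2_2-\Sigma^3_3),\quad n_2=\sqrt{\tfrac{g_{22}}{g_{33}g_{11}}},\quad n_3=\sqrt{\tfrac{g_{33}}{g_{11}g_{22}}},$$ $$N_+=\frac{n_2+n_3}{2H},\quad N_-=\frac{n_2-n_3}{2\sqrt3\,H},\quad M=\frac1{N_+},\quad \Sigma_-=X\cos\psi,\quad N_-=X\sin\psi,\quad X=\sqrt{\Sigma_-^2+N_-^2},$$ $P=\sup\{g^{ab}p_ap_b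 : f\neq0\}\in[0,\infty]$, and define the Weyl parameter $\mathcal W\ge0$ by $\mathcal W^2=\mathcal E_+^2+\mathcal E_-^2+\mathcal H_+^2+\mathcal H_-^2$ with $$\mathcal E_+=\Sigma_+(1+\Sigma_+)+\tfrac12X^2(1-3\cos2\psi),\qquad \mathcal E_-=\tfrac{2X}{M}\big(\sin\psi+\tfrac12M(1-2\Sigma_+)\cos\psi\big),$$ $$\mathcal H_+=-\tfrac32X^2\sin2\psi,\qquad \mathcal H_-=\tfrac{2X}{M}\big(-\cos\psi-\tfrac32M\Sigma_+\sin\psi\big).$$ **Theorem.** There is a constant $\varepsilon>0$ such that the following holds for every smooth reflection-symmetric Bianchi VII$_0$ solution of the Einstein–Vlasov system on $[t_0,\infty)$ with $t_0=\tfrac23H^{-1}(t_0)>0$ and $$P(\tau_0)<\varepsilon,\qquad |\Sigma_+(\tau_0)|<\varepsilon,\qquad X(\tau_0)<\varepsilon,\qquad M(\tau_0)<\varepsilon .$$ For all $t\ge t_0$ one has $H>0$ and $\rho>0$. There are constant matrices $\mathcal G_{ab}$ and $\mathcal G^{ab}$ such that, as $t\to\infty$, $$g_{ab}(t)=t^{4/3}\big(\mathcal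 G_{ab}+O(t^{-1/3})\big),\qquad g^{ab}(t)=t^{-4/3}\big(\mathcal G^{ab}+O(t^{-1/3})\big),$$ $$\Sigma_+=O(e^{-\tau}),\quad X=O(e^{-\tau/2}),\quad M=O(e^{-\tau/2}),\quad \frac S\rho=O(e^{-2\tau}),\quad H=\tfrac23t^{-1}\big(1+O(t^{-2/3})\big).$$ Moreover there is a constant $C\ge0$ with $$\mathcal W=C+O(e^{-\tau/2}),$$ and if $X(\tau_0)>0$ and $P(\tau_0)$ is also small compared with $X(\tau_0)$, namely $P(\tau_0)\le\varepsilon X(\tau_0)$, then $C>0$, that is, $\mathcal W=C\,[1+O(e^{-\tau/2})]$ with $C\ne0$. The implied constants may depend on the solution. -/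

import Mathlib

open Set Filter Topology MeasureTheory
open scoped ContDiff Matrix ENNReal

noncomputable section

namespace BianchiVlasov

/-! Spatially homogeneous Einstein-Vlasov system in a left-invariant frame `e_0, e_1, e_2`
of a three-dimensional Lie group (indices are shifted by one: `Fin 3` is `{0, 1, 2}`).
`C c a b` is the structure constant `C^c_{ab}`, that is `[e_a, e_b] = C^c_{ab} e_c`.
The spacetime metric is `-dt^2 + g_{ab}(t) ξ^a ξ^b`, and `k_{ab}(t)` is the second fundamental
form.  The distribution function `f(t, p)` depends on the covariant components `p_a`. -/

/-- The structure constants of Bianchi type VII_0: in one-based indices the nonzero ones are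
`C^2_{31} = 1 = -C^2_{13}` and `C^3_{12} = 1 = -C^3_{21}`. -/
def structVII0 (c a b : Fin 3) : ℝ :=
  if c = 1 ∧ a = 2 ∧ b = 0 then 1
  else if c = 1 ∧ a = 0 ∧ b = 2 then -1
  else if c = 2 ∧ a = 0 ∧ b = 1 then 1
  else if c = 2 ∧ a = 1 ∧ b = 0 then -1
  else 0

section Geometry

/-- Structure constants with the upper index lowered: `C_{cab} = g_{cd} C^d_{ab}`. -/
def lowStruct (C : Fin 3 → Fin 3 → Fin 3 → ℝ) (g : Matrix (Fin 3) (Fin 3) ℝ)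
    (c a b : Fin 3) : ℝ :=
  ∑ d, g c d * C d a b

/-- Levi-Civita connection of a left-invariant metric (Koszul formula):
`∇_{e_a} e_b = Γ^d_{ab} e_d`, `Γ^d_{ab} = (1/2) g^{dc} (C_{cab} - C_{abc} + C_{bca})`. -/
def connection (C : Fin 3 → Fin 3 → Fin 3 → ℝ) (g : Matrix (Fin 3) (Fin 3) ℝ)
    (d a b : Fin 3) : ℝ :=
  (1 / 2) * ∑ c, g⁻¹ d c * (lowStruct C g c a b - lowStruct C g a b c + lowStruct C g b c a)

/-- Ricci tensor `R_{ab}`, the trace over `e_c` of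
`R(e_c, e_a) e_b = ∇_c ∇_a e_b - ∇_a ∇_c e_b - ∇_{[e_c, e_a]} e_b`. -/
def ricci (C : Fin 3 → Fin 3 → Fin 3 → ℝ) (g : Matrix (Fin 3) (Fin 3) ℝ) :
    Matrix (Fin 3) (Fin 3) ℝ :=
  Matrix.of fun a b => ∑ c, ∑ d,
    (connection C g c c d * connection C g d a b - connection C g c a d * connection C g d c b
      - C d c a * connection C g c d b)

/-- Scalar curvature `R = g^{ab} R_{ab}`. -/
def scalarCurv (C : Fin 3 → Fin 3 → Fin 3 → ℝ) (g : Matrix (Fin 3) (Fin 3) ℝ) : ℝ :=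
  (g⁻¹ * ricci C g).trace

/-- Divergence `∇^j k_{ji} = g^{jl} ∇_l k_{ji}` of a left-invariant symmetric two-tensor. -/
def divergence (C : Fin 3 → Fin 3 → Fin 3 → ℝ) (g k : Matrix (Fin 3) (Fin 3) ℝ)
    (i : Fin 3) : ℝ :=
  ∑ j, ∑ l, g⁻¹ j l *
    ∑ m, (-(connection C g m l j * k m i) - connection C g m l i * k j m)

end Geometry

section Matter

/-- `g^{ab} p_a p_b`. -/
def momentumSq (g : Matrix (Fin 3) (Fin 3) ℝ) (p : Fin 3 → ℝ) : ℝ :=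
  ∑ a, ∑ b, g⁻¹ a b * p a * p b

/-- `p^0` on the mass shell of particles of unit mass. -/
def energy (g : Matrix (Fin 3) (Fin 3) ℝ) (p : Fin 3 → ℝ) : ℝ :=
  Real.sqrt (1 + momentumSq g p)

/-- Energy density `ρ`. -/
def rho (g : Matrix (Fin 3) (Fin 3) ℝ) (f : (Fin 3 → ℝ) → ℝ) : ℝ :=
  (Real.sqrt g.det)⁻¹ * ∫ p : Fin 3 → ℝ, f p * energy g p

/-- Matter current `J_i`. -/
def current (g : Matrix (Fin 3) (Fin 3) ℝ) (f : (Fin 3 → ℝ) → ℝ) (i : Fin 3) : ℝ :=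
  (Real.sqrt g.det)⁻¹ * ∫ p : Fin 3 → ℝ, f p * p i

/-- Spatial stress tensor `S_{ij}`. -/
def stress (g : Matrix (Fin 3) (Fin 3) ℝ) (f : (Fin 3 → ℝ) → ℝ) :
    Matrix (Fin 3) (Fin 3) ℝ :=
  Matrix.of fun i j =>
    (Real.sqrt g.det)⁻¹ * ∫ p : Fin 3 → ℝ, f p * (p i * p j / energy g p)

/-- `S = g^{ab} S_{ab}`. -/
def stressTrace (g : Matrix (Fin 3) (Fin 3) ℝ) (f : (Fin 3 → ℝ) → ℝ) : ℝ :=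
  (g⁻¹ * stress g f).trace

/-- `P = sup { g^{ab} p_a p_b | f(p) ≠ 0 }`, as an element of `[0, ∞]`
(so that `P = ∞` when the support in momentum space is unbounded). -/
def momentumSup (g : Matrix (Fin 3) (Fin 3) ℝ) (f : (Fin 3 → ℝ) → ℝ) : ℝ≥0∞ :=
  ⨆ (p : Fin 3 → ℝ) (_ : f p ≠ 0), ENNReal.ofReal (momentumSq g p)

end Matter

/-- `(g, k, f)` is a smooth solution on `[t0, ∞)` of the Einstein-Vlasov system with Bianchi
symmetry with structure constants `C`.  At `t0` time derivatives are one-sided. -/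
structure IsSolution (C : Fin 3 → Fin 3 → Fin 3 → ℝ) (t0 : ℝ)
    (g k : ℝ → Matrix (Fin 3) (Fin 3) ℝ) (f : ℝ → (Fin 3 → ℝ) → ℝ) : Prop where
  smooth_metric : ∀ a b, ContDiffOn ℝ ∞ (fun t => g t a b) (Ici t0)
  smooth_secondForm : ∀ a b, ContDiffOn ℝ ∞ (fun t => k t a b) (Ici t0)
  smooth_distribution :
    ContDiffOn ℝ ∞ (fun x : ℝ × (Fin 3 → ℝ) => f x.1 x.2) (Ici t0 ×ˢ univ)
  metric_posDef : ∀ t, t0 ≤ t → (g t).PosDef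
  distribution_nonneg : ∀ t, t0 ≤ t → ∀ p, 0 ≤ f t p
  /-- `∂_t g_{ab} = 2 k_{ab}`. -/
  metric_evolution : ∀ t, t0 ≤ t → ∀ a b,
    HasDerivWithinAt (fun s => g s a b) (2 * k t a b) (Ici t0) t
  /-- `∂_t k_{ab} = -R_{ab} + 2 k^i_a k_{bi} - k k_{ab} + S_{ab} + (1/2) (ρ - S) g_{ab}`. -/
  secondForm_evolution : ∀ t, t0 ≤ t → ∀ a b,
    HasDerivWithinAt (fun s => k s a b)
      (-ricci C (g t) a b + 2 * (k t * (g t)⁻¹ * k t) a b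
        - ((g t)⁻¹ * k t).trace * k t a b + stress (g t) (f t) a b
        + (1 / 2) * (rho (g t) (f t) - stressTrace (g t) (f t)) * g t a b) (Ici t0) t
  /-- `R - k_{ij} k^{ij} + k^2 = 2 ρ`. -/
  hamiltonian_constraint : ∀ t, t0 ≤ t →
    scalarCurv C (g t) - ((g t)⁻¹ * k t * ((g t)⁻¹ * k t)).trace
      + ((g t)⁻¹ * k t).trace ^ 2 = 2 * rho (g t) (f t)
  /-- `∇^j k_{ji} = -J_i`. -/
  momentum_constraint : ∀ t, t0 ≤ t → ∀ i,
    divergence C (g t) (k t) i = -current (g t) (f t) i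
  /-- `p^0 ∂f/∂t + C^d_{ba} p^b p_d ∂f/∂p_a = 0`. -/
  vlasov : ∀ t, t0 ≤ t → ∀ p : Fin 3 → ℝ,
    energy (g t) p * derivWithin (fun s => f s p) (Ici t0) t
      + ∑ a, ∑ b, ∑ d, C d b a * ((g t)⁻¹ *ᵥ p) b * p d
          * fderiv ℝ (f t) p (Pi.single a 1) = 0

/-- Reflection symmetry on `[t0, ∞)`: `f` is invariant under
`(p_1, p_2, p_3) ↦ (-p_1, -p_2, p_3)` and `(p_1, p_2, p_3) ↦ (p_1, -p_2, -p_3)`, and the metric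
and the second fundamental form are diagonal in the left-invariant frame. -/
structure IsReflectionSymmetric (t0 : ℝ)
    (g k : ℝ → Matrix (Fin 3) (Fin 3) ℝ) (f : ℝ → (Fin 3 → ℝ) → ℝ) : Prop where
  metric_diag : ∀ t, t0 ≤ t → (g t).IsDiag
  secondForm_diag : ∀ t, t0 ≤ t → (k t).IsDiag
  flip12 : ∀ t, t0 ≤ t → ∀ p : Fin 3 → ℝ, f t ![-p 0, -p 1, p 2] = f t p
  flip23 : ∀ t, t0 ≤ t → ∀ p : Fin 3 → ℝ, f t ![p 0, -p 1, -p 2] = f t p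

section Variables

/-! Dimensionless variables at a fixed time, for a diagonal metric of Bianchi type VII_0. -/

/-- Hubble parameter `H = k / 3`, with `k = g^{ab} k_{ab}`. -/
def hubble (g k : Matrix (Fin 3) (Fin 3) ℝ) : ℝ :=
  (1 / 3) * (g⁻¹ * k).trace

/-- `Σ^a_b = σ^a_b / H`, where `σ^a_b = k^a_b - H δ^a_b`. -/
def shear (g k : Matrix (Fin 3) (Fin 3) ℝ) : Matrix (Fin 3) (Fin 3) ℝ :=
  (hubble g k)⁻¹ • (g⁻¹ * k - hubble g k • (1 : Matrix (Fin 3) (Fin 3) ℝ))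

/-- `Σ_+ = (Σ^2_2 + Σ^3_3) / 2`. -/
def sigmaPlus (g k : Matrix (Fin 3) (Fin 3) ℝ) : ℝ :=
  (1 / 2) * (shear g k 1 1 + shear g k 2 2)

/-- `Σ_- = (Σ^2_2 - Σ^3_3) / (2 √3)`. -/
def sigmaMinus (g k : Matrix (Fin 3) (Fin 3) ℝ) : ℝ :=
  (shear g k 1 1 - shear g k 2 2) / (2 * Real.sqrt 3)

/-- `N_22 = n_2 / H` with `n_2 = √(g_22 / (g_33 g_11))` (one-based indices). -/
def curvN22 (g k : Matrix (Fin 3) (Fin 3) ℝ) : ℝ :=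
  Real.sqrt (g 1 1 / (g 2 2 * g 0 0)) / hubble g k

/-- `N_33 = n_3 / H` with `n_3 = √(g_33 / (g_11 g_22))` (one-based indices). -/
def curvN33 (g k : Matrix (Fin 3) (Fin 3) ℝ) : ℝ :=
  Real.sqrt (g 2 2 / (g 0 0 * g 1 1)) / hubble g k

/-- `N_+ = (N_22 + N_33) / 2`. -/
def nPlus (g k : Matrix (Fin 3) (Fin 3) ℝ) : ℝ :=
  (curvN22 g k + curvN33 g k) / 2

/-- `N_- = (N_22 - N_33) / (2 √3)`. -/
def nMinus (g k : Matrix (Fin 3) (Fin 3) ℝ) : ℝ :=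
  (curvN22 g k - curvN33 g k) / (2 * Real.sqrt 3)

/-- `M = 1 / N_+`. -/
def varM (g k : Matrix (Fin 3) (Fin 3) ℝ) : ℝ :=
  1 / nPlus g k

/-- The radius `X` in `Σ_- = X cos ψ`, `N_- = X sin ψ`. -/
def varX (g k : Matrix (Fin 3) (Fin 3) ℝ) : ℝ :=
  Real.sqrt (sigmaMinus g k ^ 2 + nMinus g k ^ 2)

/-- An angle `ψ` with `Σ_- = X cos ψ`, `N_- = X sin ψ`. -/
def varPsi (g k : Matrix (Fin 3) (Fin 3) ℝ) : ℝ :=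
  Complex.arg ⟨sigmaMinus g k, nMinus g k⟩

theorem varX_mul_cos (g k : Matrix (Fin 3) (Fin 3) ℝ) :
    varX g k * Real.cos (varPsi g k) = sigmaMinus g k := by
  have h := Complex.norm_mul_cos_arg ⟨sigmaMinus g k, nMinus g k⟩
  rwa [Complex.norm_eq_sqrt_sq_add_sq] at h

theorem varX_mul_sin (g k : Matrix (Fin 3) (Fin 3) ℝ) :
    varX g k * Real.sin (varPsi g k) = nMinus g k := by
  have h := Complex.norm_mul_sin_arg ⟨sigmaMinus g k, nMinus g k⟩
  rwa [Complex.norm_eq_sqrt_sq_add_sq] at h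

/-- Electric part `ℰ_+` of the normalised Weyl tensor. -/
def weylEPlus (g k : Matrix (Fin 3) (Fin 3) ℝ) : ℝ :=
  sigmaPlus g k * (1 + sigmaPlus g k)
    + (1 / 2) * varX g k ^ 2 * (1 - 3 * Real.cos (2 * varPsi g k))

/-- Electric part `ℰ_-` of the normalised Weyl tensor. -/
def weylEMinus (g k : Matrix (Fin 3) (Fin 3) ℝ) : ℝ :=
  2 * varX g k / varM g k * (Real.sin (varPsi g k)
    + (1 / 2) * varM g k * (1 - 2 * sigmaPlus g k) * Real.cos (varPsi g k))

/-- Magnetic part `ℋ_+` of the normalised Weyl tensor. -/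
def weylHPlus (g k : Matrix (Fin 3) (Fin 3) ℝ) : ℝ :=
  -(3 / 2) * varX g k ^ 2 * Real.sin (2 * varPsi g k)

/-- Magnetic part `ℋ_-` of the normalised Weyl tensor. -/
def weylHMinus (g k : Matrix (Fin 3) (Fin 3) ℝ) : ℝ :=
  2 * varX g k / varM g k * (-Real.cos (varPsi g k)
    - (3 / 2) * varM g k * sigmaPlus g k * Real.sin (varPsi g k))

/-- The Weyl parameter: `𝒲^2 = ℰ_+^2 + ℰ_-^2 + ℋ_+^2 + ℋ_-^2`. -/
def weylParam (g k : Matrix (Fin 3) (Fin 3) ℝ) : ℝ :=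
  Real.sqrt (weylEPlus g k ^ 2 + weylEMinus g k ^ 2 + weylHPlus g k ^ 2 + weylHMinus g k ^ 2)

end Variables

end BianchiVlasov

end

open BianchiVlasov

open BianchiVlasov

namespace BianchiVlasov

/-! With diagonal metric and second fundamental form, the geometry reduces to the expansion rates `k
t i i / g t i i` and the functions n_2, n_3. The Hamiltonian constraint expresses ρ as 3H²(1 - Σ_+²
- X²), and in the time τ there remains a system for σ = Σ_+, x = Σ_-, y = N_-, m = M driven by the
normalised stresses (`IsReduced`, `isReduced`).

Near the origin the deceleration parameter q is close to the dust value 1/2, and m decays like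
e^{-τ/2}. The pair (x, y) rotates with the large frequency 2/m, since x' ≈ -3x/2 - 2y/m and y' ≈ y/2
+ 2x/m. Thus (x² + y²)' ≈ -3x² + y², which has no sign, although its mean over a rotation is -(x² +
y²). Adding the correction mxy performs this averaging algebraically: `oscEnergy` has derivative
minus itself plus a higher-order remainder (`IsReduced.deriv_oscEnergy`). Hence X = O(e^{-τ/2}), and
σ, which is damped at rate 3/2 but driven by y², is O(e^{-τ}).

The matter is controlled through characteristics: f is constant along them and the squared momentum
decays like e^{-2τ} up to the shear (`exists_characteristic`, `momentumSq_le_exp_neg_two`). The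
stresses are at most this bound times ρ (`normStress_bounds`). A continuity argument
(`isSmallReduced_of_small_data`) keeps small data small for all time with rates slightly worse than
the true ones. All errors are then integrable in τ, which gives the sharp rates, and 1/H ~ 3t/2
converts them to powers of t.

For the Weyl parameter, 𝒲² equals 4 `oscEnergy` / m² up to O(e^{-τ}). Numerator and denominator both
decay like e^{-τ}, so the derivative of the quotient is integrable and the quotient has a limit
(`exists_limit_sqrt_weylSq`). Geometric errors change the quotient only by a bounded factor. The
matter contributes an additive error of order (P/M)² at the initial time, against an initial value
of order (X/M)², whence C > 0 when P is small compared with X (`weylLead_pos_bound`). -/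

/-! ### Curvature of diagonal metrics of type VII_0. -/

theorem inv_diagonal_fin3 (d : Fin 3 → ℝ) (hd : ∀ i, d i ≠ 0) :
    (Matrix.diagonal d)⁻¹ = Matrix.diagonal fun i => (d i)⁻¹ := by
  refine Matrix.inv_eq_right_inv ?_
  rw [Matrix.diagonal_mul_diagonal, ← Matrix.diagonal_one]
  congr 1
  funext i
  exact mul_inv_cancel₀ (hd i)

theorem ricci_diagonal_zero (d : Fin 3 → ℝ) (hd : ∀ i, 0 < d i) :
    ricci structVII0 (Matrix.diagonal d) 0 0 = -(d 1 - d 2) ^ 2 / (2 * d 1 * d 2) := by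
  have h0 := (hd 0).ne'
  have h1 := (hd 1).ne'
  have h2 := (hd 2).ne'
  simp [ricci, connection, lowStruct, structVII0, Fin.sum_univ_three,
    inv_diagonal_fin3 d fun i => (hd i).ne', Matrix.diagonal_apply]
  field_simp
  ring

theorem ricci_diagonal_one (d : Fin 3 → ℝ) (hd : ∀ i, 0 < d i) :
    ricci structVII0 (Matrix.diagonal d) 1 1 =
      (d 1 ^ 2 - d 2 ^ 2) / (2 * d 0 * d 2) := by
  have h0 := (hd 0).ne'
  have h1 := (hd 1).ne'
  have h2 := (hd 2).ne'
  simp [ricci, connection, lowStruct, structVII0, Fin.sum_univ_three,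
    inv_diagonal_fin3 d fun i => (hd i).ne', Matrix.diagonal_apply]
  field_simp
  ring

theorem ricci_diagonal_two (d : Fin 3 → ℝ) (hd : ∀ i, 0 < d i) :
    ricci structVII0 (Matrix.diagonal d) 2 2 =
      (d 2 ^ 2 - d 1 ^ 2) / (2 * d 0 * d 1) := by
  have h0 := (hd 0).ne'
  have h1 := (hd 1).ne'
  have h2 := (hd 2).ne'
  simp [ricci, connection, lowStruct, structVII0, Fin.sum_univ_three,
    inv_diagonal_fin3 d fun i => (hd i).ne', Matrix.diagonal_apply]
  field_simp
  ring

theorem scalarCurv_diagonal (d : Fin 3 → ℝ) (hd : ∀ i, 0 < d i) :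
    scalarCurv structVII0 (Matrix.diagonal d) = -(d 1 - d 2) ^ 2 / (2 * d 0 * d 1 * d 2) := by
  have h0 := (hd 0).ne'
  have h1 := (hd 1).ne'
  have h2 := (hd 2).ne'
  have e : scalarCurv structVII0 (Matrix.diagonal d) =
      (d 0)⁻¹ * ricci structVII0 (Matrix.diagonal d) 0 0
      + (d 1)⁻¹ * ricci structVII0 (Matrix.diagonal d) 1 1
      + (d 2)⁻¹ * ricci structVII0 (Matrix.diagonal d) 2 2 := by
    simp [scalarCurv, inv_diagonal_fin3 d fun i => (hd i).ne', Matrix.trace, Fin.sum_univ_three]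
  rw [e, ricci_diagonal_zero d hd, ricci_diagonal_one d hd, ricci_diagonal_two d hd]
  field_simp
  ring

/-! ### Characteristics of the Vlasov equation. -/

theorem le_of_hasDerivWithinAt_nonneg {u u' : ℝ → ℝ} {a b : ℝ} (hab : a ≤ b)
    (h : ∀ t ∈ Icc a b, HasDerivWithinAt u (u' t) (Icc a b) t)
    (h' : ∀ t ∈ Icc a b, 0 ≤ u' t) : u a ≤ u b := by
  refine monotoneOn_of_deriv_nonneg (convex_Icc a b) (fun t ht => (h t ht).continuousWithinAt)
    (fun t ht => ?_) (fun t ht => ?_) (left_mem_Icc.2 hab) (right_mem_Icc.2 hab) hab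
  · exact (h t (interior_subset ht)).differentiableWithinAt.mono interior_subset
  · rw [((h t (interior_subset ht)).hasDerivAt (mem_interior_iff_mem_nhds.1 ht)).deriv]
    exact h' t (interior_subset ht)

/-- The vector field of the characteristics of the Vlasov equation of type VII_0 for the metric
with diagonal entries `b_i⁻²`. -/
noncomputable def charField (x : (Fin 3 → ℝ) × (Fin 3 → ℝ)) : Fin 3 → ℝ :=
  (Real.sqrt (1 + ∑ i, x.1 i ^ 2 * x.2 i ^ 2))⁻¹ •
    ![(x.1 2 ^ 2 - x.1 1 ^ 2) * x.2 1 * x.2 2, x.1 0 ^ 2 * x.2 0 * x.2 2,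
      -(x.1 0 ^ 2 * x.2 0 * x.2 1)]

theorem contDiff_charField : ContDiff ℝ 1 charField := by
  unfold charField
  refine ContDiff.smul (ContDiff.inv (ContDiff.sqrt (by fun_prop) ?_) ?_) ?_
  · intro x
    positivity
  · intro x
    positivity
  · rw [contDiff_pi]
    intro i
    fin_cases i <;> simp <;> fun_prop

/-- For a frozen metric the characteristic flow is geodesic motion, which conserves the squared
momentum. Only the expansion can change it. -/
theorem sum_mul_charField (b p : Fin 3 → ℝ) :
    ∑ i, b i ^ 2 * p i * charField (b, p) i = 0 := by
  simp [charField, Fin.sum_univ_three]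
  ring

/-- The field is only locally Lipschitz, so it is cut off, solved by Picard-Lindelöf on the whole
interval, and the cut-off is shown to be invisible. The a priori bound is that of the squared
momentum, whose logarithmic derivative is at least -2K by `sum_mul_charField`. -/
theorem exists_curve_charField {t0 t1 : ℝ} (h01 : t0 ≤ t1) {b θ : ℝ → Fin 3 → ℝ}
    (hpos : ∀ t ∈ Icc t0 t1, ∀ i, 0 < b t i)
    (hb : ∀ t ∈ Icc t0 t1, ∀ i,
      HasDerivWithinAt (fun s => b s i) (-(θ t i * b t i)) (Icc t0 t1) t)
    (hθ : ∀ i, ContinuousOn (fun s => θ s i) (Icc t0 t1)) (p : Fin 3 → ℝ) :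
    ∃ α : ℝ → Fin 3 → ℝ, α t1 = p ∧
      ∀ t ∈ Icc t0 t1, HasDerivWithinAt α (charField (b t, α t)) (Icc t0 t1) t := by
  have hbc : ∀ i, ContinuousOn (fun s => b s i) (Icc t0 t1) := fun i t ht =>
    (hb t ht i).continuousWithinAt
  have hbc' : ContinuousOn b (Icc t0 t1) := continuousOn_pi.2 hbc
  -- bounds on the compact interval
  obtain ⟨K, hK⟩ : ∃ K, ∀ t ∈ Icc t0 t1, ‖θ t‖ ≤ K :=
    isCompact_Icc.exists_bound_of_continuousOn (continuousOn_pi.2 hθ)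
  obtain ⟨B, hB⟩ : ∃ B, ∀ t ∈ Icc t0 t1, ‖b t‖ ≤ B :=
    isCompact_Icc.exists_bound_of_continuousOn hbc'
  obtain ⟨A, hA⟩ : ∃ A, ∀ t ∈ Icc t0 t1, ‖fun i => (b t i)⁻¹‖ ≤ A :=
    isCompact_Icc.exists_bound_of_continuousOn
      (continuousOn_pi.2 fun i => (hbc i).inv₀ fun t ht => (hpos t ht i).ne')
  have hK0 : 0 ≤ K := (norm_nonneg _).trans (hK t0 ⟨le_rfl, h01⟩)
  have hA0 : 0 ≤ A := (norm_nonneg _).trans (hA t0 ⟨le_rfl, h01⟩)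
  set V1 : ℝ := ∑ i, b t1 i ^ 2 * p i ^ 2 with hV1
  have hV10 : 0 ≤ V1 := Finset.sum_nonneg fun i _ => by positivity
  -- Q bounds the curve: backwards in time the squared momentum grows by at most exp(2K(t1 - t0)),
  -- and A converts `b t i * |α t i|` into `|α t i|`.
  set Q : ℝ := A * Real.sqrt (V1 * Real.exp (2 * K * (t1 - t0))) with hQ
  have hQ0 : 0 ≤ Q := by positivity
  set R : ℝ := |B| + Q + 1 with hR
  have hR0 : 0 < R := by positivity
  let χ : ContDiffBump (0 : (Fin 3 → ℝ) × (Fin 3 → ℝ)) := ⟨R, R + 1, hR0, by linarith⟩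
  let F : (Fin 3 → ℝ) × (Fin 3 → ℝ) → Fin 3 → ℝ := fun x => χ x • charField x
  have hFs : HasCompactSupport F := χ.hasCompactSupport.smul_right
  have hFd : ContDiff ℝ 1 F := χ.contDiff.smul contDiff_charField
  obtain ⟨C, hC⟩ := hFd.lipschitzWith_of_hasCompactSupport hFs one_ne_zero
  obtain ⟨L, hL⟩ := hFs.exists_bound_of_continuous hFd.continuous
  have hL0 : 0 ≤ L := (norm_nonneg _).trans (hL 0)
  -- The prescribed time is the right endpoint t1: the curve is followed backwards from p. Since F
  -- is bounded by L, a ball of radius L(t1 - t0) suffices.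
  have hPL : IsPicardLindelof (fun t q => F (b t, q)) (⟨t1, h01, le_rfl⟩ : Icc t0 t1) p
      (⟨L * (t1 - t0), mul_nonneg hL0 (sub_nonneg.2 h01)⟩) 0 ⟨L, hL0⟩ C := by
    refine ⟨fun t _ => ?_, fun q _ => ?_, fun t _ q _ => hL _, ?_⟩
    · refine LipschitzWith.lipschitzOnWith ?_
      refine LipschitzWith.of_dist_le_mul fun q r => (hC.dist_le_mul _ _).trans ?_
      simp [Prod.dist_eq]
    · exact hFd.continuous.comp_continuousOn (hbc'.prodMk continuousOn_const)
    · simp only [sub_self, sub_nonneg.2 h01, max_eq_right, NNReal.coe_zero, sub_zero]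
      exact le_rfl
  obtain ⟨α, hα1, hα⟩ := hPL.exists_eq_forall_mem_Icc_hasDerivWithinAt₀
  refine ⟨α, hα1, fun t ht => ?_⟩
  have hone : χ (b t, α t) = 1 := by
    have hV : ∑ i, b t i ^ 2 * α t i ^ 2 ≤ V1 * Real.exp (2 * K * (t1 - t0)) := by
      have hm := le_of_hasDerivWithinAt_nonneg (a := t) (b := t1) ht.2
        (u := fun s => (∑ i, b s i ^ 2 * α s i ^ 2) * Real.exp (2 * K * (s - t0)))
        (u' := fun s => (2 * ∑ i, (K - θ s i) * (b s i ^ 2 * α s i ^ 2)) *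
          Real.exp (2 * K * (s - t0))) ?_ ?_
      · have e1 : Real.exp (2 * K * (t1 - t0)) * V1 ≥
            Real.exp (2 * K * (t - t0)) * ∑ i, b t i ^ 2 * α t i ^ 2 := by
          simp only [hα1] at hm
          linarith
        have e2 : 1 ≤ Real.exp (2 * K * (t - t0)) :=
          Real.one_le_exp (by have := ht.1; have : 0 ≤ t - t0 := by linarith
                              positivity)
        have e3 : 0 ≤ ∑ i, b t i ^ 2 * α t i ^ 2 := Finset.sum_nonneg fun i _ => by positivity
        nlinarith
      · intro s hs
        have hs' : s ∈ Icc t0 t1 := ⟨ht.1.trans hs.1, hs.2⟩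
        have hsub : Icc t t1 ⊆ Icc t0 t1 := Icc_subset_Icc_left ht.1
        have hαi : ∀ i, HasDerivWithinAt (fun s => α s i) (F (b s, α s) i) (Icc t t1) s :=
          hasDerivWithinAt_pi.1 ((hα s hs').mono hsub)
        have hsum : HasDerivWithinAt (fun s => ∑ i, b s i ^ 2 * α s i ^ 2)
            (∑ i, (2 * b s i * (-(θ s i * b s i)) * α s i ^ 2 +
              b s i ^ 2 * (2 * α s i * F (b s, α s) i))) (Icc t t1) s := by
          refine HasDerivWithinAt.fun_sum fun i _ => ?_
          have := (((hb s hs' i).mono hsub).pow 2).mul ((hαi i).pow 2)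
          refine this.congr_deriv ?_
          simp
        have hexp : HasDerivWithinAt (fun s => Real.exp (2 * K * (s - t0)))
            (Real.exp (2 * K * (s - t0)) * (2 * K)) (Icc t t1) s := by
          have := ((((hasDerivWithinAt_id s (Icc t t1)).sub_const t0).const_mul (2 * K))).exp
          simpa using this
        refine (hsum.mul hexp).congr_deriv ?_
        -- The cut-off rescales the field by a scalar, so the conservation law survives it and the
        -- estimate is not circular.
        have hz : ∑ i, b s i ^ 2 * α s i * F (b s, α s) i = 0 := by
          have := sum_mul_charField (b s) (α s)
          calc _ = χ (b s, α s) * ∑ i, b s i ^ 2 * α s i * charField (b s, α s) i := by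
                rw [Finset.mul_sum]
                refine Finset.sum_congr rfl fun i _ => ?_
                simp [F]
                ring
            _ = 0 := by rw [this, mul_zero]
        simp only [Fin.sum_univ_three] at hz ⊢
        linear_combination (2 * Real.exp (2 * K * (s - t0))) * hz
      · intro s hs
        have hs' : s ∈ Icc t0 t1 := ⟨ht.1.trans hs.1, hs.2⟩
        refine mul_nonneg (mul_nonneg zero_le_two (Finset.sum_nonneg fun i _ => ?_))
          (Real.exp_pos _).le
        have := (norm_le_pi_norm (θ s) i).trans (hK s hs')
        have := (le_abs_self _).trans this
        exact mul_nonneg (by linarith) (by positivity)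
    refine χ.one_of_mem_closedBall ?_
    rw [mem_closedBall_zero_iff, Prod.norm_def]
    refine max_le ?_ ?_
    · have := (hB t ht).trans (le_abs_self B)
      change ‖b t‖ ≤ |B| + Q + 1
      linarith
    · have : ‖α t‖ ≤ Q := by
        rw [pi_norm_le_iff_of_nonneg hQ0]
        intro i
        have hi : b t i ^ 2 * α t i ^ 2 ≤ V1 * Real.exp (2 * K * (t1 - t0)) :=
          (Finset.single_le_sum (f := fun i => b t i ^ 2 * α t i ^ 2)
            (fun i _ => by positivity) (Finset.mem_univ i)).trans hV
        have h1 : b t i * |α t i| ≤ Real.sqrt (V1 * Real.exp (2 * K * (t1 - t0))) := by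
          refine Real.le_sqrt_of_sq_le ?_
          rwa [mul_pow, sq_abs]
        have h2 : (b t i)⁻¹ ≤ A :=
          (le_abs_self _).trans ((norm_le_pi_norm (fun i => (b t i)⁻¹) i).trans (hA t ht))
        have hbi := hpos t ht i
        calc ‖α t i‖ = (b t i)⁻¹ * (b t i * |α t i|) := by
              rw [Real.norm_eq_abs]; field_simp
          _ ≤ Q := mul_le_mul h2 h1 (by positivity) hA0
      change ‖α t‖ ≤ |B| + Q + 1
      have := abs_nonneg B
      linarith
  have := hα t ht
  simpa only [F, hone, one_smul] using this

theorem eq_diagonal_of_isDiag {A : Matrix (Fin 3) (Fin 3) ℝ} (h : A.IsDiag) :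
    A = Matrix.diagonal fun i => A i i := by
  ext i j
  by_cases hij : i = j
  · subst hij; simp
  · rw [Matrix.diagonal_apply_ne _ hij]; exact h hij

theorem momentumSq_diagonal (d : Fin 3 → ℝ) (hd : ∀ i, 0 < d i) (p : Fin 3 → ℝ) :
    momentumSq (Matrix.diagonal d) p = ∑ i, p i ^ 2 / d i := by
  simp [momentumSq, inv_diagonal_fin3 d fun i => (hd i).ne', Matrix.diagonal_apply,
    Fin.sum_univ_three]
  ring

section Solution

variable {t0 : ℝ} {g k : ℝ → Matrix (Fin 3) (Fin 3) ℝ} {f : ℝ → (Fin 3 → ℝ) → ℝ}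

theorem IsSolution.metric_pos {C : Fin 3 → Fin 3 → Fin 3 → ℝ} (h : IsSolution C t0 g k f) {t : ℝ}
    (ht : t0 ≤ t) (i : Fin 3) : 0 < g t i i :=
  (h.metric_posDef t ht).diag_pos

theorem momentumSq_eq (h : IsSolution structVII0 t0 g k f) (hr : IsReflectionSymmetric t0 g k f)
    {t : ℝ} (ht : t0 ≤ t) (p : Fin 3 → ℝ) : momentumSq (g t) p = ∑ i, p i ^ 2 / g t i i := by
  conv_lhs => rw [eq_diagonal_of_isDiag (hr.metric_diag t ht)]
  exact momentumSq_diagonal _ (fun i => h.metric_pos ht i) p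

/-- Joint differentiability on the half-space splits the derivative along a curve into the one-sided
time derivative and the momentum derivative, the two terms of the Vlasov equation. -/
theorem hasDerivWithinAt_distribution_comp (h : IsSolution structVII0 t0 g k f)
    {t t1 : ℝ} (ht : t ∈ Icc t0 t1) {α : ℝ → Fin 3 → ℝ} {v : Fin 3 → ℝ}
    (hα : HasDerivWithinAt α v (Icc t0 t1) t) :
    HasDerivWithinAt (fun s => f s (α s))
      (derivWithin (fun s => f s (α t)) (Ici t0) t + fderiv ℝ (f t) (α t) v) (Icc t0 t1) t := by
  have hd : DifferentiableWithinAt ℝ (fun x : ℝ × (Fin 3 → ℝ) => f x.1 x.2)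
      (Ici t0 ×ˢ univ) (t, α t) :=
    h.smooth_distribution.differentiableOn (by simp) (t, α t) ⟨ht.1, mem_univ _⟩
  obtain ⟨D, hD⟩ := hd
  have e1 : HasDerivWithinAt (fun s => f s (α t)) (D (1, 0)) (Ici t0) t := by
    have hc : HasDerivWithinAt (fun s : ℝ => (s, α t)) ((1 : ℝ), (0 : Fin 3 → ℝ)) (Ici t0) t :=
      (hasDerivWithinAt_id t _).prodMk (hasDerivWithinAt_const t _ _)
    exact HasFDerivWithinAt.comp_hasDerivWithinAt (t := Ici t0 ×ˢ univ) t hD hc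
      fun s hs => ⟨hs, mem_univ _⟩
  have e2 : HasFDerivAt (f t) (D.comp (ContinuousLinearMap.inr ℝ ℝ (Fin 3 → ℝ))) (α t) := by
    have hc : HasFDerivAt (fun q : Fin 3 → ℝ => (t, q))
      (ContinuousLinearMap.inr ℝ ℝ (Fin 3 → ℝ)) (α t) := hasFDerivAt_prodMk_right t (α t)
    rw [← hasFDerivWithinAt_univ] at hc ⊢
    exact HasFDerivWithinAt.comp (t := Ici t0 ×ˢ univ) (α t) hD hc
      fun s _ => ⟨ht.1, mem_univ _⟩
  rw [e1.derivWithin (uniqueDiffOn_Ici t0 t ht.1), e2.fderiv]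
  have hc : HasDerivWithinAt (fun s : ℝ => (s, α s)) ((1 : ℝ), v) (Icc t0 t1) t :=
    (hasDerivWithinAt_id t _).prodMk hα
  refine (HasFDerivWithinAt.comp_hasDerivWithinAt (t := Ici t0 ×ˢ univ) t hD hc
    fun s hs => ⟨hs.1, mem_univ _⟩).congr_deriv ?_
  rw [show ((1 : ℝ), v) = (1, 0) + (0, v) by simp, map_add]
  simp

theorem hasDerivWithinAt_inv_sqrt_metric (h : IsSolution structVII0 t0 g k f) {t : ℝ}
    (ht : t0 ≤ t) (i : Fin 3) :
    HasDerivWithinAt (fun s => (Real.sqrt (g s i i))⁻¹)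
      (-(k t i i / g t i i * (Real.sqrt (g t i i))⁻¹)) (Ici t0) t := by
  have hp := h.metric_pos ht i
  have hs := Real.sqrt_pos.2 hp
  refine (((h.metric_evolution t ht i i).sqrt hp.ne').inv hs.ne').congr_deriv ?_
  have h2 := Real.sq_sqrt hp.le
  field_simp
  rw [h2]

/-- Transports the support of f back to the initial time, where it is bounded by hypothesis. With `b
t i` the inverse square root of `g t i i`, the field `charField` is that of the Vlasov equation
divided by p^0, so f is constant on its integral curves. -/
theorem exists_characteristic (h : IsSolution structVII0 t0 g k f)
    (hr : IsReflectionSymmetric t0 g k f) {t1 : ℝ} (h01 : t0 ≤ t1) {p : Fin 3 → ℝ}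
    (hp : f t1 p ≠ 0) :
    ∃ α : ℝ → Fin 3 → ℝ, α t1 = p ∧ f t0 (α t0) ≠ 0 ∧
      ∀ t ∈ Icc t0 t1, HasDerivWithinAt (fun s => momentumSq (g s) (α s))
        (-2 * ∑ i, k t i i / g t i i * (α t i ^ 2 / g t i i)) (Icc t0 t1) t := by
  have hsub : Icc t0 t1 ⊆ Ici t0 := Icc_subset_Ici_self
  have hkc : ∀ i j, ContinuousOn (fun s => k s i j) (Icc t0 t1) := fun i j t ht =>
    (h.secondForm_evolution t ht.1 i j).continuousWithinAt.mono hsub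
  have hgc : ∀ i j, ContinuousOn (fun s => g s i j) (Icc t0 t1) := fun i j t ht =>
    (h.metric_evolution t ht.1 i j).continuousWithinAt.mono hsub
  obtain ⟨α, hα1, hα⟩ := exists_curve_charField h01
    (b := fun t i => (Real.sqrt (g t i i))⁻¹) (θ := fun t i => k t i i / g t i i)
    (fun t ht i => inv_pos.2 (Real.sqrt_pos.2 (h.metric_pos ht.1 i)))
    (fun t ht i => (hasDerivWithinAt_inv_sqrt_metric h ht.1 i).mono hsub)
    (fun i => (hkc i i).div (hgc i i) fun t ht => (h.metric_pos ht.1 i).ne') p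
  have hsq : ∀ t ∈ Icc t0 t1, ∀ i, ((Real.sqrt (g t i i))⁻¹) ^ 2 = (g t i i)⁻¹ := fun t ht i => by
    rw [inv_pow, Real.sq_sqrt (h.metric_pos ht.1 i).le]
  refine ⟨α, hα1, ?_, fun t ht => ?_⟩
  · have hder : ∀ t ∈ Icc t0 t1, HasDerivWithinAt (fun s => f s (α s)) 0 (Icc t0 t1) t := by
      intro t ht
      refine (hasDerivWithinAt_distribution_comp h ht (hα t ht)).congr_deriv ?_
      set w := charField (fun i => (Real.sqrt (g t i i))⁻¹, α t) with hw
      have hen : energy (g t) (α t) =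
          Real.sqrt (1 + ∑ i, ((Real.sqrt (g t i i))⁻¹) ^ 2 * α t i ^ 2) := by
        rw [energy, momentumSq_eq h hr ht.1]
        congr 2
        refine Finset.sum_congr rfl fun i _ => ?_
        rw [hsq t ht i]
        ring
      have hpos : 0 < energy (g t) (α t) := by
        rw [hen]; positivity
      have hdec : w = ∑ i, w i • Pi.single i (1 : ℝ) := by
        funext j
        simp [Finset.sum_apply, Pi.single_apply]
      have hv := h.vlasov t ht.1 (α t)
      have hsum : ∑ a, ∑ b, ∑ d, structVII0 d b a * ((g t)⁻¹ *ᵥ α t) b * α t d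
          * fderiv ℝ (f t) (α t) (Pi.single a 1) =
          energy (g t) (α t) * fderiv ℝ (f t) (α t) w := by
        conv_rhs => rw [hdec, map_sum]
        have hwe : ∀ i, energy (g t) (α t) * w i =
            ![((g t 2 2)⁻¹ - (g t 1 1)⁻¹) * α t 1 * α t 2, (g t 0 0)⁻¹ * α t 0 * α t 2,
              -((g t 0 0)⁻¹ * α t 0 * α t 1)] i := by
          intro i
          have e0 : w i = (energy (g t) (α t))⁻¹ *
            ![((g t 2 2)⁻¹ - (g t 1 1)⁻¹) * α t 1 * α t 2, (g t 0 0)⁻¹ * α t 0 * α t 2,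
              -((g t 0 0)⁻¹ * α t 0 * α t 1)] i := by
            rw [hw, charField, hen]
            simp only [Pi.smul_apply, smul_eq_mul, hsq t ht]
          rw [e0, mul_inv_cancel_left₀ hpos.ne']
        rw [Finset.mul_sum]
        simp only [map_smul, smul_eq_mul, ← mul_assoc, hwe]
        rw [eq_diagonal_of_isDiag (hr.metric_diag t ht.1),
          inv_diagonal_fin3 _ fun i => (h.metric_pos ht.1 i).ne']
        simp [Fin.sum_univ_three, structVII0, Matrix.mulVec_diagonal]
        ring
      rw [hsum, ← mul_add] at hv
      exact (mul_eq_zero.1 hv).resolve_left hpos.ne'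
    have h1 := le_of_hasDerivWithinAt_nonneg h01 hder fun _ _ => le_rfl
    have h2 := le_of_hasDerivWithinAt_nonneg h01 (fun t ht => (hder t ht).neg) fun _ _ => by simp
    simp only [hα1, Pi.neg_apply] at h1 h2
    rwa [le_antisymm h1 (by linarith)]
  · have hm : ∀ s ∈ Icc t0 t1, momentumSq (g s) (α s) =
        ∑ i, ((Real.sqrt (g s i i))⁻¹) ^ 2 * α s i ^ 2 := fun s hs => by
      rw [momentumSq_eq h hr hs.1]
      refine Finset.sum_congr rfl fun i _ => ?_
      rw [hsq s hs i]
      ring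
    have hαi := hasDerivWithinAt_pi.1 (hα t ht)
    have hsum : HasDerivWithinAt (fun s => ∑ i, ((Real.sqrt (g s i i))⁻¹) ^ 2 * α s i ^ 2)
        (∑ i, (2 * (Real.sqrt (g t i i))⁻¹ *
            (-(k t i i / g t i i * (Real.sqrt (g t i i))⁻¹)) * α t i ^ 2 +
          ((Real.sqrt (g t i i))⁻¹) ^ 2 *
            (2 * α t i * charField (fun i => (Real.sqrt (g t i i))⁻¹, α t) i)))
        (Icc t0 t1) t := by
      refine HasDerivWithinAt.fun_sum fun i _ => ?_
      have := (((hasDerivWithinAt_inv_sqrt_metric h ht.1 i).mono hsub).pow 2).mul ((hαi i).pow 2)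
      refine this.congr_deriv ?_
      simp
    refine (hsum.congr hm (hm t ht)).congr_deriv ?_
    have hz := sum_mul_charField (fun i => (Real.sqrt (g t i i))⁻¹) (α t)
    have hq := hsq t ht
    simp only [Fin.sum_univ_three] at hz ⊢
    have h0 := hq 0
    have h1 := hq 1
    have h2 := hq 2
    simp only [div_eq_mul_inv]
    linear_combination 2 * hz - 2 * (k t 0 0 * (g t 0 0)⁻¹ * α t 0 ^ 2) * h0
      - 2 * (k t 1 1 * (g t 1 1)⁻¹ * α t 1 ^ 2) * h1
      - 2 * (k t 2 2 * (g t 2 2)⁻¹ * α t 2 ^ 2) * h2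

end Solution

/-! ### Bounds on the stresses by the energy density. -/

section Matter

variable {d : Fin 3 → ℝ} {f : (Fin 3 → ℝ) → ℝ} {P : ℝ}

theorem hasCompactSupport_of_momentumSq_le (hd : ∀ i, 0 < d i)
    (hP : ∀ p, f p ≠ 0 → momentumSq (Matrix.diagonal d) p ≤ P) : HasCompactSupport f := by
  refine HasCompactSupport.intro (isCompact_univ_pi fun i =>
    isCompact_Icc (a := -(Real.sqrt (P * d i))) (b := Real.sqrt (P * d i))) fun p hp => ?_
  by_contra hf
  refine hp fun i _ => ?_
  have h1 := hP p hf
  rw [momentumSq_diagonal d hd] at h1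
  have h2 : p i ^ 2 / d i ≤ P := (Finset.single_le_sum (f := fun i => p i ^ 2 / d i)
    (fun i _ => div_nonneg (sq_nonneg _) (hd i).le) (Finset.mem_univ i)).trans h1
  rw [div_le_iff₀ (hd i)] at h2
  exact abs_le.1 (Real.abs_le_sqrt h2)

theorem momentumSq_diagonal_nonneg (hd : ∀ i, 0 < d i) (p : Fin 3 → ℝ) :
    0 ≤ momentumSq (Matrix.diagonal d) p := by
  rw [momentumSq_diagonal d hd]
  exact Finset.sum_nonneg fun i _ => div_nonneg (sq_nonneg _) (hd i).le

theorem continuous_energy (g : Matrix (Fin 3) (Fin 3) ℝ) : Continuous (energy g) := by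
  unfold energy momentumSq
  fun_prop

theorem one_le_energy (hd : ∀ i, 0 < d i) (p : Fin 3 → ℝ) : 1 ≤ energy (Matrix.diagonal d) p := by
  rw [energy, Real.one_le_sqrt]
  linarith [momentumSq_diagonal_nonneg hd p]

theorem stress_diagonal_nonneg (hd : ∀ i, 0 < d i) (hf : ∀ p, 0 ≤ f p) (i : Fin 3) :
    0 ≤ stress (Matrix.diagonal d) f i i := by
  refine mul_nonneg (inv_nonneg.2 (Real.sqrt_nonneg _)) (integral_nonneg fun p => ?_)
  exact mul_nonneg (hf p) (div_nonneg (mul_self_nonneg _)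
    (zero_le_one.trans (one_le_energy hd p)))

/-- On the support p_i² ≤ P d_i, and since p^0 ≥ 1 this gives p_i²/p^0 ≤ P d_i p^0 under the
integral. Compact support makes the dominating integrand integrable. -/
theorem stress_diagonal_le (hd : ∀ i, 0 < d i) (hf : ∀ p, 0 ≤ f p) (hc : Continuous f)
    (hP : ∀ p, f p ≠ 0 → momentumSq (Matrix.diagonal d) p ≤ P) (i : Fin 3) :
    stress (Matrix.diagonal d) f i i ≤ P * d i * rho (Matrix.diagonal d) f := by
  have hcomp := hasCompactSupport_of_momentumSq_le hd hP
  have hint : Integrable fun p => f p * energy (Matrix.diagonal d) p :=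
    (hc.mul (continuous_energy _)).integrable_of_hasCompactSupport hcomp.mul_right
  have hle : ∫ p : Fin 3 → ℝ, f p * (p i * p i / energy (Matrix.diagonal d) p) ≤
      ∫ p : Fin 3 → ℝ, P * d i * (f p * energy (Matrix.diagonal d) p) := by
    refine integral_mono_of_nonneg (Eventually.of_forall fun p => ?_) (hint.const_mul _)
      (Eventually.of_forall fun p => ?_)
    · exact mul_nonneg (hf p) (div_nonneg (mul_self_nonneg _)
        (zero_le_one.trans (one_le_energy hd p)))
    · by_cases h0 : f p = 0
      · simp [h0]
      · have h1 := hP p h0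
        rw [momentumSq_diagonal d hd] at h1
        have h2 : p i ^ 2 / d i ≤ P := (Finset.single_le_sum (f := fun i => p i ^ 2 / d i)
          (fun i _ => div_nonneg (sq_nonneg _) (hd i).le) (Finset.mem_univ i)).trans h1
        rw [div_le_iff₀ (hd i)] at h2
        have h3 := one_le_energy hd p
        have h4 : p i * p i / energy (Matrix.diagonal d) p ≤
            P * d i * energy (Matrix.diagonal d) p := by
          rw [div_le_iff₀ (by linarith)]
          have h5 : 0 ≤ P * d i := (sq_nonneg (p i)).trans h2
          nlinarith [mul_le_mul h3 h3 zero_le_one (by linarith)]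
        calc f p * (p i * p i / energy (Matrix.diagonal d) p)
            ≤ f p * (P * d i * energy (Matrix.diagonal d) p) :=
              mul_le_mul_of_nonneg_left h4 (hf p)
          _ = P * d i * (f p * energy (Matrix.diagonal d) p) := by ring
  rw [integral_const_mul] at hle
  have := mul_le_mul_of_nonneg_left hle
    (inv_nonneg.2 (Real.sqrt_nonneg (Matrix.diagonal d).det))
  simp only [stress, rho, Matrix.of_apply]
  linarith

theorem momentumSq_le_toReal_momentumSup {g : Matrix (Fin 3) (Fin 3) ℝ} (h : momentumSup g f ≠ ⊤)
    {p : Fin 3 → ℝ} (hp : f p ≠ 0) : momentumSq g p ≤ (momentumSup g f).toReal :=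
  (ENNReal.ofReal_le_iff_le_toReal h).1
    (le_iSup₂ (f := fun p (_ : f p ≠ 0) => ENNReal.ofReal (momentumSq g p)) p hp)

end Matter

theorem stressTrace_diagonal (d : Fin 3 → ℝ) (hd : ∀ i, 0 < d i) (f : (Fin 3 → ℝ) → ℝ) :
    stressTrace (Matrix.diagonal d) f = ∑ i, stress (Matrix.diagonal d) f i i / d i := by
  simp [stressTrace, inv_diagonal_fin3 d fun i => (hd i).ne', Matrix.trace, Fin.sum_univ_three]
  ring

/-! ### Evolution and constraint equations in diagonal form. -/

section Solution

variable {t0 : ℝ} {g k : ℝ → Matrix (Fin 3) (Fin 3) ℝ} {f : ℝ → (Fin 3 → ℝ) → ℝ}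

theorem continuous_distribution (h : IsSolution structVII0 t0 g k f) {t : ℝ} (ht : t0 ≤ t) :
    Continuous (f t) :=
  continuousOn_univ.1 (h.smooth_distribution.continuousOn.comp (f := fun p : Fin 3 → ℝ => (t, p))
    (by fun_prop) fun _ _ => ⟨ht, mem_univ _⟩)

theorem trace_inv_mul_eq (h : IsSolution structVII0 t0 g k f) (hr : IsReflectionSymmetric t0 g k f)
    {t : ℝ} (ht : t0 ≤ t) : ((g t)⁻¹ * k t).trace = ∑ i, k t i i / g t i i := by
  rw [eq_diagonal_of_isDiag (hr.metric_diag t ht),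
    inv_diagonal_fin3 _ fun i => (h.metric_pos ht i).ne']
  simp [Matrix.trace, Fin.sum_univ_three]
  ring

/-- For the mixed components k^i_i, differentiating 1/g_{ii} cancels the term quadratic in k on the
right-hand side. -/
theorem hasDerivWithinAt_expansion (h : IsSolution structVII0 t0 g k f)
    (hr : IsReflectionSymmetric t0 g k f) {t : ℝ} (ht : t0 ≤ t) (i : Fin 3) :
    HasDerivWithinAt (fun s => k s i i / g s i i)
      (-(ricci structVII0 (g t) i i / g t i i) - (∑ j, k t j j / g t j j) * (k t i i / g t i i)
        + stress (g t) (f t) i i / g t i i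
        + (1 / 2) * (rho (g t) (f t) - stressTrace (g t) (f t))) (Ici t0) t := by
  have hp := h.metric_pos ht i
  refine ((h.secondForm_evolution t ht i i).div (h.metric_evolution t ht i i) hp.ne').congr_deriv ?_
  have hk : (k t * (g t)⁻¹ * k t) i i = k t i i ^ 2 / g t i i := by
    rw [eq_diagonal_of_isDiag (hr.metric_diag t ht),
      eq_diagonal_of_isDiag (hr.secondForm_diag t ht),
      inv_diagonal_fin3 _ fun i => (h.metric_pos ht i).ne', Matrix.diagonal_mul_diagonal,
      Matrix.diagonal_mul_diagonal]
    simp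
    ring
  rw [hk, trace_inv_mul_eq h hr ht]
  field_simp
  ring

theorem hamiltonian_constraint_diagonal (h : IsSolution structVII0 t0 g k f)
    (hr : IsReflectionSymmetric t0 g k f) {t : ℝ} (ht : t0 ≤ t) :
    -(g t 1 1 - g t 2 2) ^ 2 / (2 * g t 0 0 * g t 1 1 * g t 2 2)
      - ∑ i, (k t i i / g t i i) ^ 2 + (∑ i, k t i i / g t i i) ^ 2 = 2 * rho (g t) (f t) := by
  have hc := h.hamiltonian_constraint t ht
  rw [trace_inv_mul_eq h hr ht] at hc
  rw [← hc]
  have e1 : scalarCurv structVII0 (g t) =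
      -(g t 1 1 - g t 2 2) ^ 2 / (2 * g t 0 0 * g t 1 1 * g t 2 2) := by
    conv_lhs => rw [eq_diagonal_of_isDiag (hr.metric_diag t ht)]
    exact scalarCurv_diagonal _ (h.metric_pos ht)
  have e2 : ((g t)⁻¹ * k t * ((g t)⁻¹ * k t)).trace = ∑ i, (k t i i / g t i i) ^ 2 := by
    rw [eq_diagonal_of_isDiag (hr.metric_diag t ht),
      eq_diagonal_of_isDiag (hr.secondForm_diag t ht),
      inv_diagonal_fin3 _ fun i => (h.metric_pos ht i).ne', Matrix.diagonal_mul_diagonal,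
      Matrix.diagonal_mul_diagonal]
    simp [Fin.sum_univ_three]
    ring
  rw [e1, e2]

theorem hasDerivWithinAt_sqrt_div_mul {a b c a' b' c' : ℝ → ℝ} {s : Set ℝ} {t : ℝ}
    (ha : HasDerivWithinAt a (2 * a' t * a t) s t) (hb : HasDerivWithinAt b (2 * b' t * b t) s t)
    (hc : HasDerivWithinAt c (2 * c' t * c t) s t) (ha0 : 0 < a t) (hb0 : 0 < b t)
    (hc0 : 0 < c t) :
    HasDerivWithinAt (fun r => Real.sqrt (a r / (b r * c r)))
      (Real.sqrt (a t / (b t * c t)) * (a' t - b' t - c' t)) s t := by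
  have hq : 0 < a t / (b t * c t) := by positivity
  have hs := Real.sqrt_pos.2 hq
  have h2 := Real.sq_sqrt hq.le
  refine ((ha.div (hb.mul hc) (mul_pos hb0 hc0).ne').sqrt hq.ne').congr_deriv ?_
  simp only [Pi.mul_apply, Pi.div_apply] at *
  rw [div_eq_iff (by positivity)]
  set r := Real.sqrt (a t / (b t * c t)) with hr
  have : r * (a' t - b' t - c' t) * (2 * r) = 2 * (a' t - b' t - c' t) * r ^ 2 := by ring
  rw [this, h2]
  field_simp
  ring

end Solution

/-! ### The Hubble-normalised system. -/

/-- The deceleration parameter `q` as a function of `Σ_+`, `Σ_-`, `N_-` and the normalised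
stresses. -/
noncomputable def decel (σ x y : ℝ) (s : Fin 3 → ℝ) : ℝ :=
  1 / 2 + 3 / 2 * σ ^ 2 + 3 / 2 * x ^ 2 - 1 / 2 * y ^ 2 + (s 0 + s 1 + s 2) / 2

/-- The evolution equations, on a time set `J`, of the Hubble-normalised variables `Σ_+ = σ`,
`Σ_- = x`, `N_- = y`, `M = m` with the normalised stresses `s i = S^i_i / (3 H²)`. -/
structure IsReduced (J : Set ℝ) (H τ σ x y m : ℝ → ℝ) (s : ℝ → Fin 3 → ℝ) : Prop where
  hubble_pos : ∀ t ∈ J, 0 < H t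
  m_pos : ∀ t ∈ J, 0 < m t
  deriv_time : ∀ t ∈ J, HasDerivWithinAt τ (H t) J t
  deriv_hubble : ∀ t ∈ J,
    HasDerivWithinAt H (H t * (-(1 + decel (σ t) (x t) (y t) (s t)) * H t)) J t
  deriv_sigma : ∀ t ∈ J, HasDerivWithinAt σ
    (H t * ((decel (σ t) (x t) (y t) (s t) - 2) * σ t - 2 * y t ^ 2
      + (s t 1 + s t 2 - 2 * s t 0) / 2)) J t
  deriv_x : ∀ t ∈ J, HasDerivWithinAt x
    (H t * ((decel (σ t) (x t) (y t) (s t) - 2) * x t - 2 * y t / m t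
      + Real.sqrt 3 / 2 * (s t 1 - s t 2))) J t
  deriv_y : ∀ t ∈ J, HasDerivWithinAt y
    (H t * ((decel (σ t) (x t) (y t) (s t) + 2 * σ t) * y t + 2 * x t / m t)) J t
  deriv_m : ∀ t ∈ J, HasDerivWithinAt m
    (H t * (-(m t * (decel (σ t) (x t) (y t) (s t) + 2 * σ t)) - 6 * m t ^ 2 * x t * y t)) J t

theorem IsReduced.congr {J : Set ℝ} {H τ σ x y m : ℝ → ℝ} {s : ℝ → Fin 3 → ℝ}
    (h : IsReduced J H τ σ x y m s) {H' σ' x' y' m' : ℝ → ℝ} {s' : ℝ → Fin 3 → ℝ}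
    (eH : EqOn H' H J) (eσ : EqOn σ' σ J)
    (ex : EqOn x' x J) (ey : EqOn y' y J) (em : EqOn m' m J)
    (es : EqOn s' s J) : IsReduced J H' τ σ' x' y' m' s' where
  hubble_pos t ht := by rw [eH ht]; exact h.hubble_pos t ht
  m_pos t ht := by rw [em ht]; exact h.m_pos t ht
  deriv_time t ht := by rw [eH ht]; exact h.deriv_time t ht
  deriv_hubble t ht := by
    rw [eH ht, eσ ht, ex ht, ey ht, es ht]; exact (h.deriv_hubble t ht).congr eH (eH ht)
  deriv_sigma t ht := by
    rw [eH ht, eσ ht, ex ht, ey ht, es ht]; exact (h.deriv_sigma t ht).congr eσ (eσ ht)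
  deriv_x t ht := by
    rw [eH ht, eσ ht, ex ht, ey ht, em ht, es ht]; exact (h.deriv_x t ht).congr ex (ex ht)
  deriv_y t ht := by
    rw [eH ht, eσ ht, ex ht, ey ht, em ht, es ht]; exact (h.deriv_y t ht).congr ey (ey ht)
  deriv_m t ht := by
    rw [eH ht, eσ ht, ex ht, ey ht, em ht, es ht]; exact (h.deriv_m t ht).congr em (em ht)

theorem IsReduced.mono {J J' : Set ℝ} {H τ σ x y m : ℝ → ℝ} {s : ℝ → Fin 3 → ℝ}
    (h : IsReduced J H τ σ x y m s) (hJ : J' ⊆ J) : IsReduced J' H τ σ x y m s where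
  hubble_pos t ht := h.hubble_pos t (hJ ht)
  m_pos t ht := h.m_pos t (hJ ht)
  deriv_time t ht := (h.deriv_time t (hJ ht)).mono hJ
  deriv_hubble t ht := (h.deriv_hubble t (hJ ht)).mono hJ
  deriv_sigma t ht := (h.deriv_sigma t (hJ ht)).mono hJ
  deriv_x t ht := (h.deriv_x t (hJ ht)).mono hJ
  deriv_y t ht := (h.deriv_y t (hJ ht)).mono hJ
  deriv_m t ht := (h.deriv_m t (hJ ht)).mono hJ

/-- Here a, b, c stand for the expansion rates and u, v for n_2, n_3. The curvature of type VII_0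
enters only through (u - v)²/2 and (u² - v²)/2. -/
theorem isReduced_of_expansion {J : Set ℝ} {a b c u v τ ρ : ℝ → ℝ} {S : ℝ → Fin 3 → ℝ}
    (hH : ∀ t ∈ J, 0 < (a t + b t + c t) / 3) (hu : ∀ t ∈ J, 0 < u t) (hv : ∀ t ∈ J, 0 < v t)
    (hτ : ∀ t ∈ J, HasDerivWithinAt τ ((a t + b t + c t) / 3) J t)
    (ha : ∀ t ∈ J, HasDerivWithinAt a ((u t - v t) ^ 2 / 2 - (a t + b t + c t) * a t + S t 0
      + (1 / 2) * (ρ t - (S t 0 + S t 1 + S t 2))) J t)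
    (hb : ∀ t ∈ J, HasDerivWithinAt b (-(u t ^ 2 - v t ^ 2) / 2 - (a t + b t + c t) * b t + S t 1
      + (1 / 2) * (ρ t - (S t 0 + S t 1 + S t 2))) J t)
    (hc : ∀ t ∈ J, HasDerivWithinAt c ((u t ^ 2 - v t ^ 2) / 2 - (a t + b t + c t) * c t + S t 2
      + (1 / 2) * (ρ t - (S t 0 + S t 1 + S t 2))) J t)
    (hdu : ∀ t ∈ J, HasDerivWithinAt u (u t * (b t - c t - a t)) J t)
    (hdv : ∀ t ∈ J, HasDerivWithinAt v (v t * (c t - a t - b t)) J t)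
    (hcon : ∀ t ∈ J, -(u t - v t) ^ 2 / 2 - (a t ^ 2 + b t ^ 2 + c t ^ 2)
      + (a t + b t + c t) ^ 2 = 2 * ρ t) :
    IsReduced J (fun t => (a t + b t + c t) / 3) τ
      (fun t => (b t + c t) / (2 * ((a t + b t + c t) / 3)) - 1)
      (fun t => (b t - c t) / (2 * Real.sqrt 3 * ((a t + b t + c t) / 3)))
      (fun t => (u t - v t) / (2 * Real.sqrt 3 * ((a t + b t + c t) / 3)))
      (fun t => 2 * ((a t + b t + c t) / 3) / (u t + v t))
      (fun t i => S t i / (3 * ((a t + b t + c t) / 3) ^ 2)) := by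
  have hr0 : 0 < Real.sqrt 3 := by positivity
  have hr2 : Real.sqrt 3 ^ 2 = 3 := Real.sq_sqrt (by norm_num)
  have hdH : ∀ t ∈ J, HasDerivWithinAt (fun t => (a t + b t + c t) / 3) _ J t := fun t ht =>
    (((ha t ht).add (hb t ht)).add (hc t ht)).div_const 3
  -- the original variables in terms of the normalised ones
  have key : ∀ t ∈ J, ∃ H σ x y n : ℝ, H ≠ 0 ∧ n ≠ 0 ∧ a t = H * (1 - 2 * σ) ∧
      b t = H * (1 + σ + Real.sqrt 3 * x) ∧ c t = H * (1 + σ - Real.sqrt 3 * x) ∧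
      u t = H * (n + Real.sqrt 3 * y) ∧ v t = H * (n - Real.sqrt 3 * y) := by
    intro t ht
    have h1 := (hH t ht).ne'
    have h2 : u t + v t ≠ 0 := (add_pos (hu t ht) (hv t ht)).ne'
    set H := (a t + b t + c t) / 3 with hHd
    refine ⟨H, (b t + c t) / (2 * H) - 1, (b t - c t) / (2 * Real.sqrt 3 * H),
      (u t - v t) / (2 * Real.sqrt 3 * H), (u t + v t) / (2 * H), h1,
      div_ne_zero h2 (mul_ne_zero two_ne_zero h1), ?_, ?_, ?_, ?_, ?_⟩
    · field_simp
      rw [hHd]; ring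
    all_goals
      field_simp
      ring
  refine ⟨hH, fun t ht => ?_, hτ, fun t ht => ?_, fun t ht => ?_, fun t ht => ?_, fun t ht => ?_,
    fun t ht => ?_⟩
  · exact div_pos (mul_pos two_pos (hH t ht)) (add_pos (hu t ht) (hv t ht))
  all_goals
    obtain ⟨H, σ, x, y, n, hH0, hn0, ea, eb, ec, eu, ev⟩ := key t ht
    have eH : (a t + b t + c t) / 3 = H := by rw [ea, eb, ec]; ring
    have eσ : (b t + c t) / (2 * H) - 1 = σ := by rw [eb, ec]; field_simp; ring
    have ex : (b t - c t) / (2 * Real.sqrt 3 * H) = x := by rw [eb, ec]; field_simp; ring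
    have ey : (u t - v t) / (2 * Real.sqrt 3 * H) = y := by rw [eu, ev]; field_simp; ring
    have em : 2 * H / (u t + v t) = 1 / n := by
      rw [show u t + v t = 2 * H * n by rw [eu, ev]; ring]
      field_simp
    -- With ρ eliminated by the constraint, each evolution equation becomes a rational identity in
    -- H, σ, x, y, n and the stresses, modulo the relation √3² = 3.
    have eρ : ρ t = 3 * H ^ 2 * (1 - σ ^ 2 - x ^ 2 - y ^ 2) := by
      have := hcon t ht
      rw [ea, eb, ec, eu, ev] at this
      linear_combination (-1 / 2) * this - H ^ 2 * (x ^ 2 + y ^ 2) * hr2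
    have hden : 2 * Real.sqrt 3 * ((a t + b t + c t) / 3) ≠ 0 := by rw [eH]; positivity
  · refine (hdH t ht).congr_deriv ?_
    simp only [eH, eσ, ex, ey, decel]
    simp only [ea, eb, ec, eu, ev, eρ]
    field_simp
    linear_combination (4 * y ^ 2 * H ^ 2) * hr2
  · refine ((((hb t ht).add (hc t ht)).div ((hdH t ht).const_mul 2)
      (by rw [eH]; positivity)).sub_const 1).congr_deriv ?_
    simp only [Pi.add_apply, eH, eσ, ex, ey, decel]
    simp only [ea, eb, ec, eu, ev, eρ]
    field_simp
    linear_combination (-8 * H ^ 2 * y ^ 2 * (1 + σ)) * hr2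
  · refine (((hb t ht).sub (hc t ht)).div ((hdH t ht).const_mul (2 * Real.sqrt 3))
      hden).congr_deriv ?_
    simp only [Pi.sub_apply, eH, eσ, ex, ey, em, decel]
    simp only [ea, eb, ec, eu, ev, eρ]
    field_simp
    linear_combination (-8 * H ^ 2 * Real.sqrt 3 * y ^ 2 * x - 2 * (S t 1 - S t 2)) * hr2
  · refine (((hdu t ht).sub (hdv t ht)).div ((hdH t ht).const_mul (2 * Real.sqrt 3))
      hden).congr_deriv ?_
    simp only [Pi.sub_apply, eH, eσ, ex, ey, em, decel]
    simp only [ea, eb, ec, eu, ev, eρ]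
    field_simp
    linear_combination (-8 * H ^ 2 * Real.sqrt 3 * y ^ 3) * hr2
  · refine (((hdH t ht).const_mul 2).div ((hdu t ht).add (hdv t ht))
      (add_pos (hu t ht) (hv t ht)).ne').congr_deriv ?_
    simp only [Pi.add_apply, eH, eσ, ex, ey, em, decel]
    rw [show u t + v t = 2 * H * n by rw [eu, ev]; ring]
    simp only [ea, eb, ec, eu, ev, eρ]
    field_simp
    linear_combination (4 * n * H ^ 2 * y ^ 2 - 12 * H ^ 2 * y * x) * hr2

/-! ### The normalised geometric quantities satisfy the system. -/

section

variable {t0 : ℝ} {g k : ℝ → Matrix (Fin 3) (Fin 3) ℝ} {f : ℝ → (Fin 3 → ℝ) → ℝ}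

theorem hubble_eq (h : IsSolution structVII0 t0 g k f) (hr : IsReflectionSymmetric t0 g k f)
    {t : ℝ} (ht : t0 ≤ t) : hubble (g t) (k t) =
      (k t 0 0 / g t 0 0 + k t 1 1 / g t 1 1 + k t 2 2 / g t 2 2) / 3 := by
  rw [hubble, trace_inv_mul_eq h hr ht, Fin.sum_univ_three]
  ring

theorem shear_apply_self (h : IsSolution structVII0 t0 g k f) (hr : IsReflectionSymmetric t0 g k f)
    {t : ℝ} (ht : t0 ≤ t) (i : Fin 3) : shear (g t) (k t) i i =
      (hubble (g t) (k t))⁻¹ * (k t i i / g t i i - hubble (g t) (k t)) := by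
  have : ((g t)⁻¹ * k t) i i = k t i i / g t i i := by
    conv_lhs => rw [eq_diagonal_of_isDiag (hr.metric_diag t ht),
      inv_diagonal_fin3 _ fun i => (h.metric_pos ht i).ne', Matrix.diagonal_mul]
    ring
  simp [shear, this]

theorem sigmaPlus_eq (h : IsSolution structVII0 t0 g k f) (hr : IsReflectionSymmetric t0 g k f)
    {t : ℝ} (ht : t0 ≤ t) (hH : hubble (g t) (k t) ≠ 0) : sigmaPlus (g t) (k t) =
      (k t 1 1 / g t 1 1 + k t 2 2 / g t 2 2) / (2 * hubble (g t) (k t)) - 1 := by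
  rw [sigmaPlus, shear_apply_self h hr ht, shear_apply_self h hr ht]
  field_simp
  ring

theorem sigmaMinus_eq (h : IsSolution structVII0 t0 g k f) (hr : IsReflectionSymmetric t0 g k f)
    {t : ℝ} (ht : t0 ≤ t) (hH : hubble (g t) (k t) ≠ 0) : sigmaMinus (g t) (k t) =
      (k t 1 1 / g t 1 1 - k t 2 2 / g t 2 2) / (2 * Real.sqrt 3 * hubble (g t) (k t)) := by
  rw [sigmaMinus, shear_apply_self h hr ht, shear_apply_self h hr ht]
  field_simp
  ring

/-- The structure function `n_2 = √(g_22 / (g_33 g_11))` in one-based indices. -/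
noncomputable def struct22 (g : Matrix (Fin 3) (Fin 3) ℝ) : ℝ :=
  Real.sqrt (g 1 1 / (g 2 2 * g 0 0))

/-- The structure function `n_3 = √(g_33 / (g_11 g_22))` in one-based indices. -/
noncomputable def struct33 (g : Matrix (Fin 3) (Fin 3) ℝ) : ℝ :=
  Real.sqrt (g 2 2 / (g 0 0 * g 1 1))

theorem nMinus_eq (g k : Matrix (Fin 3) (Fin 3) ℝ) : nMinus g k =
    (struct22 g - struct33 g) / (2 * Real.sqrt 3 * hubble g k) := by
  rw [nMinus, curvN22, curvN33, ← sub_div, div_div, mul_comm (hubble g k)]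
  rfl

theorem varM_eq (g k : Matrix (Fin 3) (Fin 3) ℝ) : varM g k =
    2 * hubble g k / (struct22 g + struct33 g) := by
  rw [varM, nPlus, curvN22, curvN33, ← add_div, div_div, one_div_div, mul_comm (hubble g k)]
  rfl

theorem struct22_pos (h : IsSolution structVII0 t0 g k f) {t : ℝ} (ht : t0 ≤ t) :
    0 < struct22 (g t) := by
  have := h.metric_pos ht
  exact Real.sqrt_pos.2 (div_pos (this 1) (mul_pos (this 2) (this 0)))

theorem struct33_pos (h : IsSolution structVII0 t0 g k f) {t : ℝ} (ht : t0 ≤ t) :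
    0 < struct33 (g t) := by
  have := h.metric_pos ht
  exact Real.sqrt_pos.2 (div_pos (this 2) (mul_pos (this 0) (this 1)))

theorem struct22_mul_struct33 (h : IsSolution structVII0 t0 g k f) {t : ℝ} (ht : t0 ≤ t) :
    struct22 (g t) * struct33 (g t) = 1 / g t 0 0 := by
  have h0 := h.metric_pos ht 0
  have h1 := h.metric_pos ht 1
  have h2 := h.metric_pos ht 2
  rw [struct22, struct33, ← Real.sqrt_mul (by positivity),
    show g t 1 1 / (g t 2 2 * g t 0 0) * (g t 2 2 / (g t 0 0 * g t 1 1)) = (1 / g t 0 0) ^ 2 by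
      field_simp]
  exact Real.sqrt_sq (by positivity)

theorem struct22_sq (h : IsSolution structVII0 t0 g k f) {t : ℝ} (ht : t0 ≤ t) :
    struct22 (g t) ^ 2 = g t 1 1 / (g t 2 2 * g t 0 0) := by
  have := h.metric_pos ht
  exact Real.sq_sqrt (div_pos (this 1) (mul_pos (this 2) (this 0))).le

theorem struct33_sq (h : IsSolution structVII0 t0 g k f) {t : ℝ} (ht : t0 ≤ t) :
    struct33 (g t) ^ 2 = g t 2 2 / (g t 0 0 * g t 1 1) := by
  have := h.metric_pos ht
  exact Real.sq_sqrt (div_pos (this 2) (mul_pos (this 0) (this 1))).le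

theorem struct22_sub_struct33_sq (h : IsSolution structVII0 t0 g k f) {t : ℝ} (ht : t0 ≤ t) :
    (struct22 (g t) - struct33 (g t)) ^ 2 =
      (g t 1 1 - g t 2 2) ^ 2 / (g t 0 0 * g t 1 1 * g t 2 2) := by
  have h0 := h.metric_pos ht 0
  have h1 := h.metric_pos ht 1
  have h2 := h.metric_pos ht 2
  rw [sub_sq, mul_assoc, struct22_mul_struct33 h ht, struct22_sq h ht, struct33_sq h ht]
  field_simp
  ring

theorem constraint_struct (h : IsSolution structVII0 t0 g k f)
    (hr : IsReflectionSymmetric t0 g k f) {t : ℝ} (ht : t0 ≤ t) :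
    -(struct22 (g t) - struct33 (g t)) ^ 2 / 2
      - ((k t 0 0 / g t 0 0) ^ 2 + (k t 1 1 / g t 1 1) ^ 2 + (k t 2 2 / g t 2 2) ^ 2)
      + (k t 0 0 / g t 0 0 + k t 1 1 / g t 1 1 + k t 2 2 / g t 2 2) ^ 2
      = 2 * rho (g t) (f t) := by
  have hc := hamiltonian_constraint_diagonal h hr ht
  simp only [Fin.sum_univ_three] at hc
  rw [← hc]
  have h0 := h.metric_pos ht 0
  have h1 := h.metric_pos ht 1
  have h2 := h.metric_pos ht 2
  rw [struct22_sub_struct33_sq h ht]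
  field_simp

/-- The normalised stresses `S^i_i / (3 H²)`. -/
noncomputable def normStress (g k : Matrix (Fin 3) (Fin 3) ℝ) (f : (Fin 3 → ℝ) → ℝ) (i : Fin 3) :
    ℝ :=
  stress g f i i / g i i / (3 * hubble g k ^ 2)

theorem rho_eq (h : IsSolution structVII0 t0 g k f) (hr : IsReflectionSymmetric t0 g k f)
    {t : ℝ} (ht : t0 ≤ t) (hH : hubble (g t) (k t) ≠ 0) :
    rho (g t) (f t) = 3 * hubble (g t) (k t) ^ 2 * (1 - sigmaPlus (g t) (k t) ^ 2
      - sigmaMinus (g t) (k t) ^ 2 - nMinus (g t) (k t) ^ 2) := by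
  have hc := constraint_struct h hr ht
  rw [sigmaPlus_eq h hr ht hH, sigmaMinus_eq h hr ht hH, nMinus_eq]
  have hr2 : Real.sqrt 3 ^ 2 = 3 := Real.sq_sqrt (by norm_num)
  have hH3 := hubble_eq h hr ht
  set a := k t 0 0 / g t 0 0
  set b := k t 1 1 / g t 1 1
  set c := k t 2 2 / g t 2 2
  set H := hubble (g t) (k t)
  have ha : a = 3 * H - b - c := by rw [hH3]; ring
  simp only [mul_pow, div_pow, hr2]
  rw [ha] at hc
  field_simp
  linear_combination (-2) * hc

theorem isReduced (h : IsSolution structVII0 t0 g k f) (hr : IsReflectionSymmetric t0 g k f)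
    {J : Set ℝ} (hJ : J ⊆ Ici t0) {τ : ℝ → ℝ}
    (hτ : ∀ t, t0 ≤ t → HasDerivWithinAt τ (hubble (g t) (k t)) (Ici t0) t)
    (hH : ∀ t ∈ J, 0 < hubble (g t) (k t)) :
    IsReduced J (fun t => hubble (g t) (k t)) τ (fun t => sigmaPlus (g t) (k t))
      (fun t => sigmaMinus (g t) (k t)) (fun t => nMinus (g t) (k t)) (fun t => varM (g t) (k t))
      (fun t => normStress (g t) (k t) (f t)) := by
  have key := isReduced_of_expansion (J := J) (a := fun t => k t 0 0 / g t 0 0)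
    (b := fun t => k t 1 1 / g t 1 1) (c := fun t => k t 2 2 / g t 2 2)
    (u := fun t => struct22 (g t)) (v := fun t => struct33 (g t)) (τ := τ)
    (ρ := fun t => rho (g t) (f t)) (S := fun t i => stress (g t) (f t) i i / g t i i)
    (fun t ht => by rw [← hubble_eq h hr (hJ ht)]; exact hH t ht)
    (fun t ht => struct22_pos h (hJ ht)) (fun t ht => struct33_pos h (hJ ht))
    (fun t ht => by rw [← hubble_eq h hr (hJ ht)]; exact (hτ t (hJ ht)).mono hJ)
    ?_ ?_ ?_ ?_ ?_ (fun t ht => constraint_struct h hr (hJ ht))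
  · have hs : EqOn (fun t => normStress (g t) (k t) (f t)) (fun t i => stress (g t) (f t) i i /
        g t i i / (3 * ((k t 0 0 / g t 0 0 + k t 1 1 / g t 1 1 + k t 2 2 / g t 2 2) / 3) ^ 2))
        J := by
      intro t ht
      funext i
      simp only [normStress, hubble_eq h hr (hJ ht)]
    exact key.congr (H' := fun t => hubble (g t) (k t))
      (σ' := fun t => sigmaPlus (g t) (k t)) (x' := fun t => sigmaMinus (g t) (k t))
      (y' := fun t => nMinus (g t) (k t)) (m' := fun t => varM (g t) (k t))
      (fun t ht => hubble_eq h hr (hJ ht))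
      (fun t ht => by
        simp only [← hubble_eq h hr (hJ ht), sigmaPlus_eq h hr (hJ ht) (hH t ht).ne'])
      (fun t ht => by
        simp only [← hubble_eq h hr (hJ ht), sigmaMinus_eq h hr (hJ ht) (hH t ht).ne'])
      (fun t ht => by simp only [← hubble_eq h hr (hJ ht), nMinus_eq])
      (fun t ht => by simp only [← hubble_eq h hr (hJ ht), varM_eq]) hs
  all_goals
    intro t ht
    have h0 := h.metric_pos (hJ ht) 0
    have h1 := h.metric_pos (hJ ht) 1
    have h2 := h.metric_pos (hJ ht) 2
  · refine ((hasDerivWithinAt_expansion h hr (hJ ht) 0).mono hJ).congr_deriv ?_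
    have eR := ricci_diagonal_zero (fun i => g t i i) (h.metric_pos (hJ ht))
    rw [← eq_diagonal_of_isDiag (hr.metric_diag t (hJ ht))] at eR
    have eS : stressTrace (g t) (f t) = ∑ i, stress (g t) (f t) i i / g t i i := by
      conv_lhs => rw [eq_diagonal_of_isDiag (hr.metric_diag t (hJ ht))]
      rw [stressTrace_diagonal _ (h.metric_pos (hJ ht)),
        ← eq_diagonal_of_isDiag (hr.metric_diag t (hJ ht))]
    rw [eR, eS, struct22_sub_struct33_sq h (hJ ht)]
    simp only [Fin.sum_univ_three]
    field_simp
  · refine ((hasDerivWithinAt_expansion h hr (hJ ht) 1).mono hJ).congr_deriv ?_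
    have eR := ricci_diagonal_one (fun i => g t i i) (h.metric_pos (hJ ht))
    rw [← eq_diagonal_of_isDiag (hr.metric_diag t (hJ ht))] at eR
    have eS : stressTrace (g t) (f t) = ∑ i, stress (g t) (f t) i i / g t i i := by
      conv_lhs => rw [eq_diagonal_of_isDiag (hr.metric_diag t (hJ ht))]
      rw [stressTrace_diagonal _ (h.metric_pos (hJ ht)),
        ← eq_diagonal_of_isDiag (hr.metric_diag t (hJ ht))]
    rw [eR, eS, struct22_sq h (hJ ht), struct33_sq h (hJ ht)]
    simp only [Fin.sum_univ_three]
    field_simp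
  · refine ((hasDerivWithinAt_expansion h hr (hJ ht) 2).mono hJ).congr_deriv ?_
    have eR := ricci_diagonal_two (fun i => g t i i) (h.metric_pos (hJ ht))
    rw [← eq_diagonal_of_isDiag (hr.metric_diag t (hJ ht))] at eR
    have eS : stressTrace (g t) (f t) = ∑ i, stress (g t) (f t) i i / g t i i := by
      conv_lhs => rw [eq_diagonal_of_isDiag (hr.metric_diag t (hJ ht))]
      rw [stressTrace_diagonal _ (h.metric_pos (hJ ht)),
        ← eq_diagonal_of_isDiag (hr.metric_diag t (hJ ht))]
    rw [eR, eS, struct22_sq h (hJ ht), struct33_sq h (hJ ht)]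
    simp only [Fin.sum_univ_three]
    field_simp
    ring
  · have hd : ∀ i, HasDerivWithinAt (fun s => g s i i) (2 * (k t i i / g t i i) * g t i i) J t :=
      fun i => ((h.metric_evolution t (hJ ht) i i).mono hJ).congr_deriv (by
        have := (h.metric_pos (hJ ht) i).ne'
        field_simp)
    exact hasDerivWithinAt_sqrt_div_mul (a' := fun t => k t 1 1 / g t 1 1)
      (b' := fun t => k t 2 2 / g t 2 2) (c' := fun t => k t 0 0 / g t 0 0) (hd 1) (hd 2) (hd 0)
      h1 h2 h0
  · have hd : ∀ i, HasDerivWithinAt (fun s => g s i i) (2 * (k t i i / g t i i) * g t i i) J t :=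
      fun i => ((h.metric_evolution t (hJ ht) i i).mono hJ).congr_deriv (by
        have := (h.metric_pos (hJ ht) i).ne'
        field_simp)
    exact hasDerivWithinAt_sqrt_div_mul (a' := fun t => k t 2 2 / g t 2 2)
      (b' := fun t => k t 0 0 / g t 0 0) (c' := fun t => k t 1 1 / g t 1 1) (hd 2) (hd 0) (hd 1)
      h2 h0 h1

end

/-! ### Decay of the normalised variables for small data -/

/-- Gronwall's inequality in the time τ. The explicit term is a particular solution of the
comparison equation, so only a ≠ c is needed; with c > a the forcing does not spoil the rate a. -/
theorem decay_of_deriv_le {t0 t1 : ℝ} (h01 : t0 ≤ t1) {H τ u u' : ℝ → ℝ} {a b c : ℝ}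
    (hac : a ≠ c) (hτ : ∀ t ∈ Icc t0 t1, HasDerivWithinAt τ (H t) (Icc t0 t1) t)
    (hu : ∀ t ∈ Icc t0 t1, HasDerivWithinAt u (H t * u' t) (Icc t0 t1) t)
    (hH : ∀ t ∈ Icc t0 t1, 0 < H t)
    (hle : ∀ t ∈ Icc t0 t1, u' t ≤ -a * u t + b * Real.exp (-c * (τ t - τ t0))) :
    u t1 ≤ (u t0 - b / (a - c)) * Real.exp (-a * (τ t1 - τ t0))
      + b / (a - c) * Real.exp (-c * (τ t1 - τ t0)) := by
  have hac' : a - c ≠ 0 := sub_ne_zero.2 hac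
  have hE : ∀ r : ℝ, ∀ t ∈ Icc t0 t1, HasDerivWithinAt (fun t => Real.exp (r * (τ t - τ t0)))
      (Real.exp (r * (τ t - τ t0)) * (r * H t)) (Icc t0 t1) t := fun r t ht =>
    (((hτ t ht).sub_const (τ t0)).const_mul r).exp
  -- Particular solution minus u, times the integrating factor e^{aτ}, is nondecreasing.
  have hw := le_of_hasDerivWithinAt_nonneg h01
    (u := fun t => (b / (a - c) * Real.exp (-c * (τ t - τ t0)) - u t) * Real.exp (a * (τ t - τ t0)))
    (fun t ht => (((hE (-c) t ht).const_mul (b / (a - c))).sub (hu t ht)).mul (hE a t ht)) ?_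
  · simp only [sub_self, mul_zero, Real.exp_zero, mul_one] at hw
    have h1 : Real.exp (a * (τ t1 - τ t0)) * Real.exp (-a * (τ t1 - τ t0)) = 1 := by
      rw [← Real.exp_add]; simp
    have h2 := Real.exp_pos (-a * (τ t1 - τ t0))
    have h3 := mul_le_mul_of_nonneg_right hw h2.le
    rw [mul_assoc, h1] at h3
    linarith
  · intro t ht
    have h1 := hle t ht
    have h2 := mul_pos (hH t ht) (Real.exp_pos (a * (τ t - τ t0)))
    have h3 : (b / (a - c) * (Real.exp (-c * (τ t - τ t0)) * (-c * H t)) - H t * u' t) *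
        Real.exp (a * (τ t - τ t0)) +
        (b / (a - c) * Real.exp (-c * (τ t - τ t0)) - u t) *
          (Real.exp (a * (τ t - τ t0)) * (a * H t)) =
        (H t * Real.exp (a * (τ t - τ t0))) *
          (-a * u t + b * Real.exp (-c * (τ t - τ t0)) - u' t) := by
      field_simp
      ring
    simp only [Pi.sub_apply]
    rw [h3]
    exact mul_nonneg h2.le (by linarith)

/-- The energy of the oscillating variables `x = Σ_-` and `y = N_-`, corrected so that the
oscillating terms drop out of its derivative. -/
noncomputable def oscEnergy (x y m : ℝ) : ℝ := x ^ 2 + y ^ 2 + m * x * y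

/-- The derivative of `oscEnergy` up to the leading term `-oscEnergy`. -/
noncomputable def oscRemainder (σ x y m : ℝ) (s : Fin 3 → ℝ) : ℝ :=
  2 * (decel σ x y s - 1 / 2) * (x ^ 2 + y ^ 2) + m * (decel σ x y s - 1) * x * y
    - 6 * m ^ 2 * x ^ 2 * y ^ 2 + 4 * σ * y ^ 2
    + (2 * x + m * y) * (Real.sqrt 3 / 2 * (s 1 - s 2))

section Pointwise

variable {σ x y m p : ℝ} {s : Fin 3 → ℝ}

theorem abs_decel_sub_half_le (hs : ∀ i, 0 ≤ s i ∧ s i ≤ p) :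
    |decel σ x y s - 1 / 2| ≤ 3 / 2 * σ ^ 2 + 3 / 2 * (x ^ 2 + y ^ 2) + 3 / 2 * p := by
  have h0 := hs 0
  have h1 := hs 1
  have h2 := hs 2
  rw [decel, abs_le]
  constructor <;> nlinarith [sq_nonneg σ, sq_nonneg x, sq_nonneg y]

theorem abs_stress_diff_le (hs : ∀ i, 0 ≤ s i ∧ s i ≤ p) :
    |Real.sqrt 3 / 2 * (s 1 - s 2)| ≤ p := by
  have h1 := hs 1
  have h2 := hs 2
  have h3 : Real.sqrt 3 ≤ 2 := Real.sqrt_le_iff.2 ⟨by norm_num, by norm_num⟩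
  rw [abs_mul, abs_of_nonneg (by positivity)]
  have h4 : |s 1 - s 2| ≤ p := abs_le.2 ⟨by linarith, by linarith⟩
  calc Real.sqrt 3 / 2 * |s 1 - s 2| ≤ 1 * |s 1 - s 2| :=
        mul_le_mul_of_nonneg_right (by linarith) (abs_nonneg _)
    _ ≤ p := by rwa [one_mul]

theorem abs_stress_plus_le (hs : ∀ i, 0 ≤ s i ∧ s i ≤ p) :
    |(s 1 + s 2 - 2 * s 0) / 2| ≤ p := by
  have h0 := hs 0
  have h1 := hs 1
  have h2 := hs 2
  rw [abs_le]
  constructor <;> linarith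

theorem abs_mul_le_half_sq (x y : ℝ) : |x * y| ≤ (x ^ 2 + y ^ 2) / 2 := by
  rw [abs_le]
  constructor <;> nlinarith [sq_nonneg (x + y), sq_nonneg (x - y)]

theorem abs_oscEnergy_sub_le (hm : 0 ≤ m) :
    |oscEnergy x y m - (x ^ 2 + y ^ 2)| ≤ m / 2 * (x ^ 2 + y ^ 2) := by
  rw [oscEnergy, show x ^ 2 + y ^ 2 + m * x * y - (x ^ 2 + y ^ 2) = m * (x * y) by ring, abs_mul,
    abs_of_nonneg hm]
  nlinarith [abs_mul_le_half_sq x y]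

/-- The remainder is of higher order, apart from the matter term. -/
theorem abs_oscRemainder_sub_le (hm : 0 ≤ m) (hm1 : m ≤ 1)
    (hx : x ^ 2 + y ^ 2 ≤ 1) :
    |oscRemainder σ x y m s - (2 * x + m * y) * (Real.sqrt 3 / 2 * (s 1 - s 2))| ≤
      (3 * |decel σ x y s - 1 / 2| + 2 * m + 4 * |σ|) * (x ^ 2 + y ^ 2) := by
  set e := decel σ x y s - 1 / 2 with he
  have hA : 0 ≤ x ^ 2 + y ^ 2 := by positivity
  have hxy := abs_mul_le_half_sq x y
  have e1 : oscRemainder σ x y m s - (2 * x + m * y) * (Real.sqrt 3 / 2 * (s 1 - s 2)) =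
      2 * e * (x ^ 2 + y ^ 2) + m * (e - 1 / 2) * (x * y) - 6 * m ^ 2 * (x * y) ^ 2
        + 4 * σ * y ^ 2 := by
    rw [oscRemainder, he]; ring
  rw [e1]
  have b1 : |2 * e * (x ^ 2 + y ^ 2)| = 2 * |e| * (x ^ 2 + y ^ 2) := by
    rw [abs_mul, abs_mul, abs_two, abs_of_nonneg hA]
  have b2 : |m * (e - 1 / 2) * (x * y)| ≤ (|e| + m / 2) * (x ^ 2 + y ^ 2) / 2 := by
    rw [abs_mul, abs_mul, abs_of_nonneg hm]
    have c1 : m * |e - 1 / 2| ≤ |e| + m / 2 := by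
      have := abs_sub e (1 / 2)
      rw [abs_of_pos (by norm_num : (0 : ℝ) < 1 / 2)] at this
      nlinarith [abs_nonneg e]
    calc m * |e - 1 / 2| * |x * y| ≤ (|e| + m / 2) * ((x ^ 2 + y ^ 2) / 2) :=
          mul_le_mul c1 hxy (abs_nonneg _) (by positivity)
      _ = _ := by ring
  have b3 : |6 * m ^ 2 * (x * y) ^ 2| ≤ 3 / 2 * m * (x ^ 2 + y ^ 2) := by
    rw [abs_of_nonneg (by positivity)]
    have c1 : (x * y) ^ 2 ≤ (x ^ 2 + y ^ 2) / 4 := by nlinarith [sq_nonneg (x ^ 2 - y ^ 2)]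
    have c2 : m ^ 2 ≤ m := by nlinarith
    calc 6 * m ^ 2 * (x * y) ^ 2 ≤ 6 * m * ((x ^ 2 + y ^ 2) / 4) :=
          mul_le_mul (by linarith) c1 (sq_nonneg _) (by linarith)
      _ = _ := by ring
  have b4 : |4 * σ * y ^ 2| ≤ 4 * |σ| * (x ^ 2 + y ^ 2) := by
    rw [abs_mul, abs_mul, abs_of_pos (by norm_num : (0 : ℝ) < 4), abs_of_nonneg (sq_nonneg y)]
    exact mul_le_mul_of_nonneg_left (by nlinarith [sq_nonneg x]) (by positivity)
  have c1 := abs_add_le (2 * e * (x ^ 2 + y ^ 2) + m * (e - 1 / 2) * (x * y)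
    - 6 * m ^ 2 * (x * y) ^ 2) (4 * σ * y ^ 2)
  have c2 := abs_sub (2 * e * (x ^ 2 + y ^ 2) + m * (e - 1 / 2) * (x * y))
    (6 * m ^ 2 * (x * y) ^ 2)
  have c3 := abs_add_le (2 * e * (x ^ 2 + y ^ 2)) (m * (e - 1 / 2) * (x * y))
  nlinarith [mul_nonneg (abs_nonneg e) hA, mul_nonneg hm hA]

theorem sq_two_mul_add_le (hm : 0 ≤ m) (hm1 : m ≤ 1) :
    (2 * x + m * y) ^ 2 ≤ 5 * (x ^ 2 + y ^ 2) := by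
  nlinarith [sq_nonneg (m * x - 2 * y), mul_nonneg (sub_nonneg.2 hm1) (by positivity :
    0 ≤ (1 + m) * (x ^ 2 + y ^ 2))]

/-- The exact rate 1 is lowered to 4/5. The geometric errors cost 63/1000 and the matter term 1/10
of x² + y², which together fit into the gap 1/5. -/
theorem neg_oscEnergy_add_oscRemainder_le (hm : 0 ≤ m) (hm1 : m ≤ 1 / 100) (hσ : |σ| ≤ 1 / 100)
    (hx : x ^ 2 + y ^ 2 ≤ 1 / 10000) (hp : p ≤ 1 / 10000) (hs : ∀ i, 0 ≤ s i ∧ s i ≤ p) :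
    -oscEnergy x y m + oscRemainder σ x y m s ≤ -(4 / 5) * oscEnergy x y m + 25 / 2 * p ^ 2 := by
  have hA : 0 ≤ x ^ 2 + y ^ 2 := by positivity
  have h1 := abs_oscRemainder_sub_le (σ := σ) (s := s) hm (by linarith)
    (hx.trans (by norm_num))
  have h2 := abs_decel_sub_half_le (σ := σ) (x := x) (y := y) hs
  have h3 := abs_le.1 (abs_oscEnergy_sub_le (x := x) (y := y) hm)
  have hσ2 : σ ^ 2 ≤ 1 / 10000 := by nlinarith [abs_nonneg σ, sq_abs σ]
  have h4 : |decel σ x y s - 1 / 2| ≤ 1 / 1000 := by linarith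
  have h5 := (abs_le.1 h1).2
  have h6 : (3 * |decel σ x y s - 1 / 2| + 2 * m + 4 * |σ|) * (x ^ 2 + y ^ 2) ≤
      63 / 1000 * (x ^ 2 + y ^ 2) := mul_le_mul_of_nonneg_right (by linarith) hA
  have h7 := abs_stress_diff_le hs
  have h8 := sq_two_mul_add_le (x := x) (y := y) hm (by linarith)
  set z := Real.sqrt 3 / 2 * (s 1 - s 2)
  have h9 : z ^ 2 ≤ p ^ 2 := sq_le_sq' (by linarith [abs_le.1 h7]) (abs_le.1 h7).2
  -- Young's inequality with weight 25, combined with (2x + my)² ≤ 5(x² + y²).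
  have h10 : (2 * x + m * y) * z ≤ 1 / 10 * (x ^ 2 + y ^ 2) + 25 / 2 * p ^ 2 := by
    nlinarith [sq_nonneg ((2 * x + m * y) - 25 * z)]
  nlinarith

end Pointwise

section Reduced

variable {J : Set ℝ} {H τ σ x y m : ℝ → ℝ} {s : ℝ → Fin 3 → ℝ}

/-- The terms ±4xy/m cancel in (x² + y²)', while in (mxy)' the factors m and 1/m leave 2x² - 2y². At
q = 1/2 this turns -3x² + y² into -(x² + y²). -/
theorem IsReduced.deriv_oscEnergy (h : IsReduced J H τ σ x y m s) {t : ℝ} (ht : t ∈ J) :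
    HasDerivWithinAt (fun t => oscEnergy (x t) (y t) (m t))
      (H t * (-oscEnergy (x t) (y t) (m t) + oscRemainder (σ t) (x t) (y t) (m t) (s t))) J t := by
  have hm := (h.m_pos t ht).ne'
  refine ((((h.deriv_x t ht).pow 2).add ((h.deriv_y t ht).pow 2)).add
    (((h.deriv_m t ht).mul (h.deriv_x t ht)).mul (h.deriv_y t ht))).congr_deriv ?_
  simp only [oscEnergy, oscRemainder, Pi.mul_apply]
  field_simp
  ring

theorem IsReduced.deriv_inv_m (h : IsReduced J H τ σ x y m s) {t : ℝ} (ht : t ∈ J) :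
    HasDerivWithinAt (fun t => (m t)⁻¹)
      (H t * ((decel (σ t) (x t) (y t) (s t) + 2 * σ t + 6 * m t * x t * y t) * (m t)⁻¹)) J t := by
  have hm := (h.m_pos t ht).ne'
  refine ((h.deriv_m t ht).inv hm).congr_deriv ?_
  field_simp
  ring

end Reduced

/-! ### Decay while the variables remain in a small neighbourhood. -/

section

/-- Normalised variables on `[t0, t1]` that stay in a fixed small neighbourhood of the origin,
with stresses bounded by the decaying function `P0 e^{-9/5 (τ - τ(t0))}`. -/
structure IsSmallReduced (t0 t1 P0 : ℝ) (H τ σ x y m : ℝ → ℝ) (s : ℝ → Fin 3 → ℝ) : Prop where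
  reduced : IsReduced (Icc t0 t1) H τ σ x y m s
  le_time : t0 ≤ t1
  stress_nonneg : ∀ t ∈ Icc t0 t1, ∀ i, 0 ≤ s t i
  stress_le : ∀ t ∈ Icc t0 t1, ∀ i, s t i ≤ P0 * Real.exp (-(9 / 5) * (τ t - τ t0))
  momentum_nonneg : 0 ≤ P0
  momentum_le : P0 ≤ 1 / 10000
  sigma_le : ∀ t ∈ Icc t0 t1, |σ t| ≤ 1 / 100
  xy_le : ∀ t ∈ Icc t0 t1, x t ^ 2 + y t ^ 2 ≤ 1 / 10000
  m_le : ∀ t ∈ Icc t0 t1, m t ≤ 1 / 100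

variable {t0 t1 P0 : ℝ} {H τ σ x y m : ℝ → ℝ} {s : ℝ → Fin 3 → ℝ}

theorem IsSmallReduced.mono (h : IsSmallReduced t0 t1 P0 H τ σ x y m s) {t : ℝ}
    (ht : t ∈ Icc t0 t1) : IsSmallReduced t0 t P0 H τ σ x y m s :=
  have hsub : Icc t0 t ⊆ Icc t0 t1 := Icc_subset_Icc_right ht.2
  { reduced := h.reduced.mono hsub
    le_time := ht.1
    stress_nonneg := fun r hr => h.stress_nonneg r (hsub hr)
    stress_le := fun r hr => h.stress_le r (hsub hr)
    momentum_nonneg := h.momentum_nonneg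
    momentum_le := h.momentum_le
    sigma_le := fun r hr => h.sigma_le r (hsub hr)
    xy_le := fun r hr => h.xy_le r (hsub hr)
    m_le := fun r hr => h.m_le r (hsub hr) }

theorem IsSmallReduced.time_le (h : IsSmallReduced t0 t1 P0 H τ σ x y m s) {t : ℝ}
    (ht : t ∈ Icc t0 t1) : τ t0 ≤ τ t :=
  le_of_hasDerivWithinAt_nonneg ht.1 (h.mono ht).reduced.deriv_time
    fun r hr => ((h.mono ht).reduced.hubble_pos r hr).le

theorem IsSmallReduced.stress_bounds (h : IsSmallReduced t0 t1 P0 H τ σ x y m s) {t : ℝ}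
    (ht : t ∈ Icc t0 t1) (i : Fin 3) :
    0 ≤ s t i ∧ s t i ≤ P0 * Real.exp (-(9 / 5) * (τ t - τ t0)) :=
  ⟨h.stress_nonneg t ht i, h.stress_le t ht i⟩

theorem IsSmallReduced.stress_bound_le (h : IsSmallReduced t0 t1 P0 H τ σ x y m s) {t : ℝ}
    (ht : t ∈ Icc t0 t1) : P0 * Real.exp (-(9 / 5) * (τ t - τ t0)) ≤ 1 / 10000 := by
  have h1 : Real.exp (-(9 / 5) * (τ t - τ t0)) ≤ 1 :=
    Real.exp_le_one_iff.2 (by linarith [h.time_le ht])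
  have h2 := h.momentum_nonneg
  have h3 := h.momentum_le
  nlinarith

theorem IsSmallReduced.abs_decel_sub_half_le (h : IsSmallReduced t0 t1 P0 H τ σ x y m s) {t : ℝ}
    (ht : t ∈ Icc t0 t1) : |decel (σ t) (x t) (y t) (s t) - 1 / 2| ≤ 1 / 1000 := by
  have h1 := BianchiVlasov.abs_decel_sub_half_le (σ := σ t) (x := x t) (y := y t)
    (h.stress_bounds ht)
  have h2 := h.sigma_le t ht
  have h3 := h.xy_le t ht
  have h4 := h.stress_bound_le ht
  have h5 : σ t ^ 2 ≤ 1 / 10000 := by nlinarith [abs_nonneg (σ t), sq_abs (σ t)]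
  linarith

/-- The forcing is quadratic in the stresses and decays at rate 18/5, far above 4/5. The constant 5
rounds up (25/2)/(14/5). -/
theorem IsSmallReduced.oscEnergy_le (h : IsSmallReduced t0 t1 P0 H τ σ x y m s) :
    oscEnergy (x t1) (y t1) (m t1) ≤ (oscEnergy (x t0) (y t0) (m t0) + 5 * P0 ^ 2) *
      Real.exp (-(4 / 5) * (τ t1 - τ t0)) := by
  have h1 := decay_of_deriv_le h.le_time (a := 4 / 5) (b := 25 / 2 * P0 ^ 2) (c := 18 / 5)
    (by norm_num) h.reduced.deriv_time (fun t ht => h.reduced.deriv_oscEnergy ht)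
    h.reduced.hubble_pos fun t ht => ?_
  · have e1 := Real.exp_pos (-(4 / 5) * (τ t1 - τ t0))
    have e2 := Real.exp_pos (-(18 / 5) * (τ t1 - τ t0))
    have e3 : 0 ≤ P0 ^ 2 := sq_nonneg _
    rw [show (4 / 5 : ℝ) - 18 / 5 = -(14 / 5) by norm_num] at h1
    nlinarith [mul_nonneg e3 e1.le, mul_nonneg e3 e2.le]
  · have := neg_oscEnergy_add_oscRemainder_le (h.reduced.m_pos t ht).le (h.m_le t ht)
      (h.sigma_le t ht) (h.xy_le t ht) (h.stress_bound_le ht) (h.stress_bounds ht)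
    have e : Real.exp (-(9 / 5) * (τ t - τ t0)) ^ 2 = Real.exp (-(18 / 5) * (τ t - τ t0)) := by
      rw [← Real.exp_nat_mul]; congr 1; push_cast; ring
    rw [mul_pow, e] at this
    linarith

theorem IsSmallReduced.xy_decay (h : IsSmallReduced t0 t1 P0 H τ σ x y m s) :
    x t1 ^ 2 + y t1 ^ 2 ≤ (2 * (x t0 ^ 2 + y t0 ^ 2) + 6 * P0 ^ 2) *
      Real.exp (-(4 / 5) * (τ t1 - τ t0)) := by
  have h1 := h.oscEnergy_le
  have m0 : t0 ∈ Icc t0 t1 := left_mem_Icc.2 h.le_time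
  have m1 : t1 ∈ Icc t0 t1 := right_mem_Icc.2 h.le_time
  have h2 := (abs_le.1 (abs_oscEnergy_sub_le (x := x t1) (y := y t1)
    (h.reduced.m_pos t1 m1).le)).1
  have h3 := (abs_le.1 (abs_oscEnergy_sub_le (x := x t0) (y := y t0)
    (h.reduced.m_pos t0 m0).le)).2
  have h4 := mul_le_mul_of_nonneg_right (h.m_le t0 m0) (by positivity : 0 ≤ x t0 ^ 2 + y t0 ^ 2)
  have h5 := mul_le_mul_of_nonneg_right (h.m_le t1 m1) (by positivity : 0 ≤ x t1 ^ 2 + y t1 ^ 2)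
  have e1 := Real.exp_pos (-(4 / 5) * (τ t1 - τ t0))
  have h6 : oscEnergy (x t0) (y t0) (m t0) + 5 * P0 ^ 2 ≤
      101 / 100 * (x t0 ^ 2 + y t0 ^ 2) + 5 * P0 ^ 2 := by nlinarith
  have h7 := h1.trans (mul_le_mul_of_nonneg_right h6 e1.le)
  have h8 : 0 ≤ (x t0 ^ 2 + y t0 ^ 2) * Real.exp (-(4 / 5) * (τ t1 - τ t0)) := by positivity
  have h9 : 0 ≤ P0 ^ 2 * Real.exp (-(4 / 5) * (τ t1 - τ t0)) := by positivity
  nlinarith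

/-- The logarithmic derivative of m is -(q + 2σ) - 6mxy, close to -1/2. The rate 2/5 leaves room for
the errors. -/
theorem IsSmallReduced.m_decay (h : IsSmallReduced t0 t1 P0 H τ σ x y m s) :
    m t1 ≤ m t0 * Real.exp (-(2 / 5) * (τ t1 - τ t0)) := by
  have h1 := decay_of_deriv_le h.le_time (a := 2 / 5) (b := 0) (c := 0)
    (by norm_num) h.reduced.deriv_time h.reduced.deriv_m
    h.reduced.hubble_pos fun t ht => ?_
  · simpa using h1
  · have h2 := (abs_le.1 (h.abs_decel_sub_half_le ht)).1
    have h3 := (abs_le.1 (h.sigma_le t ht)).1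
    have h4 := (abs_le.1 (abs_mul_le_half_sq (x t) (y t))).1
    have h5 := h.xy_le t ht
    have h6 := h.m_le t ht
    have h7 := h.reduced.m_pos t ht
    have h8 : -(m t) ≤ 6 * m t * (x t * y t) * m t := by nlinarith [mul_pos h7 h7]
    have h9 : -(6 * m t * (x t * y t)) ≤ 1 / 1000 := by nlinarith
    nlinarith

/-- Working with σ² avoids distinguishing signs. The damping is 2(q - 2) ≈ -3, and Young's
inequality spends 1 of it on the forcing w, leaving at least 9/5; w² decays at rate 8/5. The
resulting constant 20ε² + ε² lies below (5ε)². -/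
theorem IsSmallReduced.sigma_sq_decay (h : IsSmallReduced t0 t1 P0 H τ σ x y m s) {ε : ℝ}
    (hε : 0 ≤ ε) (hε1 : ε ≤ 1 / 10000) (hP : P0 ≤ ε) (hx : x t0 ^ 2 + y t0 ^ 2 ≤ ε ^ 2)
    (hσ : |σ t0| ≤ ε) :
    σ t1 ^ 2 ≤ (5 * ε * Real.exp (-(4 / 5) * (τ t1 - τ t0))) ^ 2 := by
  have hP0 := h.momentum_nonneg
  have hexp : ∀ t, Real.exp (-(4 / 5) * (τ t - τ t0)) ^ 2 =
      Real.exp (-(8 / 5) * (τ t - τ t0)) := fun t => by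
    rw [← Real.exp_nat_mul]; congr 1; push_cast; ring
  have h1 := decay_of_deriv_le h.le_time (a := 9 / 5) (b := 4 * ε ^ 2) (c := 8 / 5)
    (by norm_num) h.reduced.deriv_time (u := fun t => σ t ^ 2)
    (u' := fun t => 2 * σ t * ((decel (σ t) (x t) (y t) (s t) - 2) * σ t - 2 * y t ^ 2
      + (s t 1 + s t 2 - 2 * s t 0) / 2))
    (fun t ht => ((h.reduced.deriv_sigma t ht).pow 2).congr_deriv (by simp; ring))
    h.reduced.hubble_pos fun t ht => ?_
  · have e1 : Real.exp (-(9 / 5) * (τ t1 - τ t0)) ≤ Real.exp (-(8 / 5) * (τ t1 - τ t0)) :=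
      Real.exp_le_exp.2 (by linarith [h.time_le (right_mem_Icc.2 h.le_time)])
    have e2 := Real.exp_pos (-(9 / 5) * (τ t1 - τ t0))
    have e3 : σ t0 ^ 2 ≤ ε ^ 2 := by rw [← sq_abs]; gcongr
    rw [mul_pow, hexp]
    rw [show (9 / 5 : ℝ) - 8 / 5 = 1 / 5 by norm_num] at h1
    nlinarith [sq_nonneg ε, sq_nonneg (σ t0), mul_nonneg (sq_nonneg ε) e2.le,
      mul_nonneg (sq_nonneg (σ t0)) (sub_nonneg.2 e1),
      mul_nonneg (sub_nonneg.2 e3) (e2.le.trans e1)]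
  · have h2 := (abs_le.1 (h.abs_decel_sub_half_le ht)).2
    have h3 := (h.mono ht).xy_decay
    have h4 := abs_le.1 (abs_stress_plus_le (h.stress_bounds ht))
    set E := Real.exp (-(4 / 5) * (τ t - τ t0)) with hE
    have hE0 : 0 < E := Real.exp_pos _
    have h5 : P0 * Real.exp (-(9 / 5) * (τ t - τ t0)) ≤ ε * E :=
      mul_le_mul hP (Real.exp_le_exp.2 (by linarith [h.time_le ht])) (Real.exp_pos _).le hε
    have h6 : x t ^ 2 + y t ^ 2 ≤ 8 * ε ^ 2 * E := by
      refine h3.trans (mul_le_mul_of_nonneg_right ?_ hE0.le)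
      nlinarith
    -- The quadratic forcing costs one factor of ε, which its smallness turns into a bound of the
    -- same form as that of the stresses.
    have h7 : 2 * y t ^ 2 ≤ ε * E := by
      have : 8 * ε ^ 2 * E ≤ 8 * (1 / 10000 * ε) * E :=
        mul_le_mul_of_nonneg_right (by nlinarith) hE0.le
      nlinarith [sq_nonneg (x t), mul_nonneg hε hE0.le]
    set w := -2 * y t ^ 2 + (s t 1 + s t 2 - 2 * s t 0) / 2 with hw
    have h8 : |w| ≤ 2 * (ε * E) := abs_le.2 ⟨by linarith, by nlinarith [sq_nonneg (y t)]⟩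
    have h9 : w ^ 2 ≤ (2 * (ε * E)) ^ 2 := by rw [← sq_abs]; gcongr
    have h10 : (2 * (ε * E)) ^ 2 = 4 * ε ^ 2 * Real.exp (-(8 / 5) * (τ t - τ t0)) := by
      rw [← hexp, ← hE]; ring
    have h11 : 2 * σ t * ((decel (σ t) (x t) (y t) (s t) - 2) * σ t - 2 * y t ^ 2
      + (s t 1 + s t 2 - 2 * s t 0) / 2) =
      2 * (decel (σ t) (x t) (y t) (s t) - 2) * σ t ^ 2 + 2 * σ t * w := by rw [hw]; ring
    rw [h11]
    nlinarith [sq_nonneg (σ t - w), sq_nonneg (σ t)]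

theorem IsSmallReduced.sigma_decay (h : IsSmallReduced t0 t1 P0 H τ σ x y m s) {ε : ℝ}
    (hε : 0 ≤ ε) (hε1 : ε ≤ 1 / 10000) (hP : P0 ≤ ε) (hx : x t0 ^ 2 + y t0 ^ 2 ≤ ε ^ 2)
    (hσ : |σ t0| ≤ ε) : |σ t1| ≤ 5 * ε * Real.exp (-(4 / 5) * (τ t1 - τ t0)) :=
  abs_le_of_sq_le_sq (h.sigma_sq_decay hε hε1 hP hx hσ) (by positivity)

end

/-! ### The continuity argument. -/

section

/-- At the first time where F ≤ 0, F is nonnegative up to and including that time, so the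
improvement hypothesis makes it positive there, a contradiction. -/
theorem pos_of_bootstrap {t0 : ℝ} {F : ℝ → ℝ} (hF : ContinuousOn F (Ici t0)) (h0 : 0 < F t0)
    (h : ∀ t, t0 ≤ t → (∀ r ∈ Icc t0 t, 0 ≤ F r) → 0 < F t) : ∀ t, t0 ≤ t → 0 < F t := by
  by_contra! hcon
  obtain ⟨t, ht, hFt⟩ := hcon
  set A : Set ℝ := Ici t0 ∩ F ⁻¹' Iic 0 with hA
  have hcl : IsClosed A := hF.preimage_isClosed_of_isClosed isClosed_Ici isClosed_Iic
  have hne : A.Nonempty := ⟨t, ht, hFt⟩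
  have hbdd : BddBelow A := ⟨t0, fun r hr => hr.1⟩
  have hmem := hcl.csInf_mem hne hbdd
  set t1 := sInf A with ht1
  have hlt : ∀ r, t0 ≤ r → r < t1 → 0 < F r := fun r hr hr1 => by
    by_contra hn
    exact absurd (csInf_le hbdd (show r ∈ A from ⟨hr, not_lt.1 hn⟩)) (not_le.2 hr1)
  have h01 : t0 < t1 := lt_of_le_of_ne hmem.1 fun e => by
    have : F t1 ≤ 0 := hmem.2
    rw [← e] at this
    exact absurd h0 (not_lt.2 this)
  have hge : 0 ≤ F t1 := by
    have hc : Tendsto F (𝓝[Ico t0 t1] t1) (𝓝 (F t1)) :=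
      (hF t1 hmem.1).mono_left (nhdsWithin_mono _ Ico_subset_Ici_self)
    have : (𝓝[Ico t0 t1] t1).NeBot := by
      rw [← mem_closure_iff_nhdsWithin_neBot, closure_Ico h01.ne]
      exact right_mem_Icc.2 h01.le
    exact ge_of_tendsto hc (eventually_nhdsWithin_of_forall fun r hr => (hlt r hr.1 hr.2).le)
  have := h t1 hmem.1 fun r hr => (lt_or_eq_of_le hr.2).elim (fun h => (hlt r hr.1 h).le)
    fun h => h ▸ hge
  exact absurd this (not_lt.2 hmem.2)

variable {t0 : ℝ} {g k : ℝ → Matrix (Fin 3) (Fin 3) ℝ} {f : ℝ → (Fin 3 → ℝ) → ℝ}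

theorem abs_expansion_sub_le (h : IsSolution structVII0 t0 g k f)
    (hr : IsReflectionSymmetric t0 g k f) {t : ℝ} (ht : t0 ≤ t) (hH : 0 < hubble (g t) (k t))
    (i : Fin 3) : |k t i i / g t i i - hubble (g t) (k t)| ≤
      hubble (g t) (k t) * (2 * |sigmaPlus (g t) (k t)| + 2 * |sigmaMinus (g t) (k t)|) := by
  have e0 := hubble_eq h hr ht
  have e1 := sigmaPlus_eq h hr ht hH.ne'
  have e2 := sigmaMinus_eq h hr ht hH.ne'
  set H := hubble (g t) (k t)
  set σ := sigmaPlus (g t) (k t)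
  set x := sigmaMinus (g t) (k t)
  have hr3 : Real.sqrt 3 ≤ 2 := Real.sqrt_le_iff.2 ⟨by norm_num, by norm_num⟩
  have hr0 : 0 < Real.sqrt 3 := by positivity
  have c0 : k t 1 1 / g t 1 1 + k t 2 2 / g t 2 2 = 2 * H * (σ + 1) := by
    rw [e1]; field_simp; ring
  have c1 : k t 1 1 / g t 1 1 - k t 2 2 / g t 2 2 = 2 * H * (Real.sqrt 3 * x) := by
    rw [e2]; field_simp
  have bx : |Real.sqrt 3 * x| ≤ 2 * |x| := by
    rw [abs_mul, abs_of_pos hr0]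
    exact mul_le_mul_of_nonneg_right hr3 (abs_nonneg _)
  -- The diagonal entries of the shear are -2σ and σ ± √3 x.
  have key : ∃ z, k t i i / g t i i - H = H * z ∧ |z| ≤ 2 * |σ| + 2 * |x| := by
    have n1 := abs_nonneg σ
    have n2 := abs_nonneg x
    fin_cases i
    · refine ⟨-2 * σ, ?_, ?_⟩
      · simp only [Fin.zero_eta]
        linear_combination -c0 - 3 * e0
      · rw [abs_mul]; norm_num
    · refine ⟨σ + Real.sqrt 3 * x, ?_, (abs_add_le _ _).trans (by linarith)⟩
      simp only [Fin.mk_one]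
      linear_combination c0 / 2 + c1 / 2
    · refine ⟨σ - Real.sqrt 3 * x, ?_, (abs_sub _ _).trans (by linarith)⟩
      simp only [Fin.reduceFinMk]
      linear_combination c0 / 2 - c1 / 2
  obtain ⟨z, hz, hz'⟩ := key
  rw [hz, abs_mul, abs_of_pos hH]
  exact mul_le_mul_of_nonneg_left hz' hH.le

theorem momentumSq_nonneg (h : IsSolution structVII0 t0 g k f)
    (hr : IsReflectionSymmetric t0 g k f) {t : ℝ} (ht : t0 ≤ t) (p : Fin 3 → ℝ) :
    0 ≤ momentumSq (g t) p := by
  rw [momentumSq_eq h hr ht]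
  exact Finset.sum_nonneg fun i _ => div_nonneg (sq_nonneg _) (h.metric_pos ht i).le

/-- Along a characteristic ending in the support of `f`, the momentum decays at the rate given by
the isotropic expansion, up to the shear. -/
theorem exists_characteristic_deriv (h : IsSolution structVII0 t0 g k f)
    (hr : IsReflectionSymmetric t0 g k f) {t1 : ℝ} (h01 : t0 ≤ t1)
    (hH : ∀ t ∈ Icc t0 t1, 0 < hubble (g t) (k t)) {p : Fin 3 → ℝ} (hp : f t1 p ≠ 0) :
    ∃ (V V' : ℝ → ℝ), V t1 = momentumSq (g t1) p ∧ (∃ q, f t0 q ≠ 0 ∧ V t0 = momentumSq (g t0) q) ∧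
      ∀ t ∈ Icc t0 t1, 0 ≤ V t ∧ HasDerivWithinAt V (hubble (g t) (k t) * V' t) (Icc t0 t1) t ∧
        V' t ≤ -2 * V t +
          4 * (|sigmaPlus (g t) (k t)| + |sigmaMinus (g t) (k t)|) * V t := by
  obtain ⟨α, hα1, hα0, hα⟩ := exists_characteristic h hr h01 hp
  refine ⟨fun t => momentumSq (g t) (α t), fun t => (hubble (g t) (k t))⁻¹ *
    (-2 * ∑ i, k t i i / g t i i * (α t i ^ 2 / g t i i)), by simp only [hα1], ⟨α t0, hα0, rfl⟩,
    fun t ht => ⟨momentumSq_nonneg h hr ht.1 _, ?_, ?_⟩⟩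
  · rw [mul_inv_cancel_left₀ (hH t ht).ne']
    exact hα t ht
  · have hHt := hH t ht
    beta_reduce
    rw [inv_mul_le_iff₀ hHt, momentumSq_eq h hr ht.1]
    set δ := 2 * |sigmaPlus (g t) (k t)| + 2 * |sigmaMinus (g t) (k t)| with hδ
    have hle : ∑ i, hubble (g t) (k t) * (1 - δ) * (α t i ^ 2 / g t i i) ≤
        ∑ i, k t i i / g t i i * (α t i ^ 2 / g t i i) := by
      refine Finset.sum_le_sum fun i _ => mul_le_mul_of_nonneg_right ?_
        (div_nonneg (sq_nonneg _) (h.metric_pos ht.1 i).le)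
      have := (abs_le.1 (abs_expansion_sub_le h hr ht.1 hHt i)).1
      linarith
    rw [← Finset.mul_sum] at hle
    set V := ∑ i, α t i ^ 2 / g t i i
    have : hubble (g t) (k t) * (-2 * V + 4 * (|sigmaPlus (g t) (k t)| +
        |sigmaMinus (g t) (k t)|) * V) = -2 * (hubble (g t) (k t) * (1 - δ) * V) := by
      rw [hδ]; ring
    rw [this]
    linarith

/-- The stress is at most Pρ, and ρ/(3H²) = 1 - Σ_+² - Σ_-² - N_-² is at most 1 by the constraint.
-/
theorem normStress_bounds (h : IsSolution structVII0 t0 g k f)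
    (hr : IsReflectionSymmetric t0 g k f) {t : ℝ} (ht : t0 ≤ t) (hH : 0 < hubble (g t) (k t))
    {P : ℝ} (hP0 : 0 ≤ P) (hP : ∀ p, f t p ≠ 0 → momentumSq (g t) p ≤ P) (i : Fin 3) :
    0 ≤ normStress (g t) (k t) (f t) i ∧ normStress (g t) (k t) (f t) i ≤ P := by
  have hg := h.metric_pos ht i
  have h1 := stress_diagonal_nonneg (h.metric_pos ht) (h.distribution_nonneg t ht) i
  have h2 := stress_diagonal_le (P := P) (h.metric_pos ht) (h.distribution_nonneg t ht)
    (continuous_distribution h ht)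
    (by rw [← eq_diagonal_of_isDiag (hr.metric_diag t ht)]; exact hP) i
  rw [← eq_diagonal_of_isDiag (hr.metric_diag t ht)] at h1 h2
  refine ⟨div_nonneg (div_nonneg h1 hg.le) (by positivity), ?_⟩
  rw [normStress, div_div, div_le_iff₀ (by positivity)]
  refine h2.trans ?_
  rw [rho_eq h hr ht hH.ne']
  have h3 : 0 ≤ P * g t i i * (3 * hubble (g t) (k t) ^ 2) := by positivity
  nlinarith [mul_nonneg h3 (by positivity : 0 ≤ sigmaPlus (g t) (k t) ^ 2 +
    sigmaMinus (g t) (k t) ^ 2 + nMinus (g t) (k t) ^ 2)]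

/-- The shear terms |σ|, |x| ≤ 1/100 lower the rate 2 by at most 4 · 2/100, which stays above 9/5.
-/
theorem momentumSq_le_of_small (h : IsSolution structVII0 t0 g k f)
    (hr : IsReflectionSymmetric t0 g k f) {τ : ℝ → ℝ}
    (hτ : ∀ t, t0 ≤ t → HasDerivWithinAt τ (hubble (g t) (k t)) (Ici t0) t)
    {P0 : ℝ} (hP : ∀ p, f t0 p ≠ 0 → momentumSq (g t0) p ≤ P0) {t1 : ℝ} (h01 : t0 ≤ t1)
    (hH : ∀ t ∈ Icc t0 t1, 0 < hubble (g t) (k t))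
    (hσ : ∀ t ∈ Icc t0 t1, |sigmaPlus (g t) (k t)| ≤ 1 / 100)
    (hx : ∀ t ∈ Icc t0 t1, sigmaMinus (g t) (k t) ^ 2 + nMinus (g t) (k t) ^ 2 ≤ 1 / 10000)
    {p : Fin 3 → ℝ} (hp : f t1 p ≠ 0) :
    momentumSq (g t1) p ≤ P0 * Real.exp (-(9 / 5) * (τ t1 - τ t0)) := by
  obtain ⟨V, V', hV1, ⟨q, hq, hV0⟩, hV⟩ := exists_characteristic_deriv h hr h01 hH hp
  have h1 := decay_of_deriv_le h01 (a := 9 / 5) (b := 0) (c := 0) (by norm_num)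
    (fun t ht => (hτ t ht.1).mono Icc_subset_Ici_self) (fun t ht => (hV t ht).2.1) hH
    (fun t ht => ?_)
  · rw [← hV1]
    have h1' : V t1 ≤ V t0 * Real.exp (-(9 / 5) * (τ t1 - τ t0)) := by simpa using h1
    refine h1'.trans (mul_le_mul_of_nonneg_right ?_ (Real.exp_pos _).le)
    rw [hV0]
    exact hP q hq
  · refine (hV t ht).2.2.trans ?_
    have h2 : |sigmaMinus (g t) (k t)| ≤ 1 / 100 := by
      refine abs_le_of_sq_le_sq ?_ (by norm_num)
      have := hx t ht
      nlinarith [sq_nonneg (nMinus (g t) (k t))]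
    have h3 := hσ t ht
    have h4 := (hV t ht).1
    nlinarith

theorem isSmallReduced_of_bounds (h : IsSolution structVII0 t0 g k f)
    (hr : IsReflectionSymmetric t0 g k f) {τ : ℝ → ℝ}
    (hτ : ∀ t, t0 ≤ t → HasDerivWithinAt τ (hubble (g t) (k t)) (Ici t0) t)
    {P0 : ℝ} (hP0 : 0 ≤ P0) (hP1 : P0 ≤ 1 / 10000)
    (hP : ∀ p, f t0 p ≠ 0 → momentumSq (g t0) p ≤ P0) {t1 : ℝ} (h01 : t0 ≤ t1)
    (hH : ∀ t ∈ Icc t0 t1, 0 < hubble (g t) (k t))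
    (hσ : ∀ t ∈ Icc t0 t1, |sigmaPlus (g t) (k t)| ≤ 1 / 100)
    (hx : ∀ t ∈ Icc t0 t1, sigmaMinus (g t) (k t) ^ 2 + nMinus (g t) (k t) ^ 2 ≤ 1 / 10000)
    (hm : ∀ t ∈ Icc t0 t1, varM (g t) (k t) ≤ 1 / 100) :
    IsSmallReduced t0 t1 P0 (fun t => hubble (g t) (k t)) τ (fun t => sigmaPlus (g t) (k t))
      (fun t => sigmaMinus (g t) (k t)) (fun t => nMinus (g t) (k t)) (fun t => varM (g t) (k t))
      (fun t => normStress (g t) (k t) (f t)) := by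
  have hs : ∀ t ∈ Icc t0 t1, ∀ i, 0 ≤ normStress (g t) (k t) (f t) i ∧
      normStress (g t) (k t) (f t) i ≤ P0 * Real.exp (-(9 / 5) * (τ t - τ t0)) := by
    intro t ht
    have hsub : Icc t0 t ⊆ Icc t0 t1 := Icc_subset_Icc_right ht.2
    exact normStress_bounds h hr ht.1 (hH t ht) (by positivity) fun p hp =>
      momentumSq_le_of_small h hr hτ hP ht.1 (fun r hr => hH r (hsub hr))
        (fun r hr => hσ r (hsub hr)) (fun r hr => hx r (hsub hr)) hp
  exact ⟨isReduced h hr Icc_subset_Ici_self hτ hH, h01, fun t ht i => (hs t ht i).1,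
    fun t ht i => (hs t ht i).2, hP0, hP1, hσ, hx, hm⟩

end

section

variable {t0 P0 : ℝ} {g k : ℝ → Matrix (Fin 3) (Fin 3) ℝ} {f : ℝ → (Fin 3 → ℝ) → ℝ}

/-- The derivative of 1/H in t is 1 + q < 2, so H cannot reach zero in finite time. This keeps the
normalised variables defined throughout the continuity argument. -/
theorem IsSmallReduced.inv_hubble_le {t1 : ℝ} {H τ σ x y m : ℝ → ℝ} {s : ℝ → Fin 3 → ℝ}
    (h : IsSmallReduced t0 t1 P0 H τ σ x y m s) : (H t1)⁻¹ ≤ (H t0)⁻¹ + 2 * (t1 - t0) := by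
  have h1 := le_of_hasDerivWithinAt_nonneg h.le_time (u := fun t => 2 * (t - t0) - (H t)⁻¹)
    (u' := fun t => 2 - (1 + decel (σ t) (x t) (y t) (s t))) (fun t ht => ?_) (fun t ht => ?_)
  · simp only [sub_self, mul_zero] at h1
    linarith
  · have hH := (h.reduced.hubble_pos t ht).ne'
    refine ((((hasDerivWithinAt_id t _).sub_const t0).const_mul 2).sub
      ((h.reduced.deriv_hubble t ht).inv hH)).congr_deriv ?_
    field_simp
  · have := abs_le.1 (h.abs_decel_sub_half_le ht)
    linarith

theorem isSmallReduced_of_small_data (h : IsSolution structVII0 t0 g k f)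
    (hr : IsReflectionSymmetric t0 g k f) {τ : ℝ → ℝ}
    (hτ : ∀ t, t0 ≤ t → HasDerivWithinAt τ (hubble (g t) (k t)) (Ici t0) t)
    (hP0 : 0 ≤ P0) (hP1 : P0 ≤ 1 / 10000)
    (hP : ∀ p, f t0 p ≠ 0 → momentumSq (g t0) p ≤ P0) (hH0 : 0 < hubble (g t0) (k t0))
    (hσ0 : |sigmaPlus (g t0) (k t0)| ≤ 1 / 10000) (hx0 : varX (g t0) (k t0) ≤ 1 / 10000)
    (hm0 : varM (g t0) (k t0) ≤ 1 / 10000) (t : ℝ) (ht : t0 ≤ t) :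
    IsSmallReduced t0 t P0 (fun t => hubble (g t) (k t)) τ (fun t => sigmaPlus (g t) (k t))
      (fun t => sigmaMinus (g t) (k t)) (fun t => nMinus (g t) (k t)) (fun t => varM (g t) (k t))
      (fun t => normStress (g t) (k t) (f t)) := by
  set H0 := hubble (g t0) (k t0) with hH0d
  have hx0' : sigmaMinus (g t0) (k t0) ^ 2 + nMinus (g t0) (k t0) ^ 2 ≤ (1 / 10000) ^ 2 :=
    (Real.sqrt_le_left (by norm_num)).1 hx0
  -- The four conditions are multiplied out so that no H stands in a denominator: they are
  -- continuous on the whole half-line before H > 0 is known there. F1 keeps H above an explicit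
  -- positive barrier; F2, F3, F4 encode the bounds on σ, x² + y² and m.
  set F1 : ℝ → ℝ := fun t => hubble (g t) (k t) - (2 / H0 + 3 * (t - t0))⁻¹ with hF1
  set F2 : ℝ → ℝ := fun t => (1 / 100 * hubble (g t) (k t)) ^ 2 -
    ((k t 1 1 / g t 1 1 + k t 2 2 / g t 2 2) / 2 - hubble (g t) (k t)) ^ 2 with hF2
  set F3 : ℝ → ℝ := fun t => hubble (g t) (k t) ^ 2 / 10000 -
    ((k t 1 1 / g t 1 1 - k t 2 2 / g t 2 2) ^ 2 + (struct22 (g t) - struct33 (g t)) ^ 2) / 12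
    with hF3
  set F4 : ℝ → ℝ := fun t => (struct22 (g t) + struct33 (g t)) / 200 - hubble (g t) (k t) with hF4
  have hden : ∀ t, t0 ≤ t → 0 < 2 / H0 + 3 * (t - t0) := fun t ht => by
    have : 0 < 2 / H0 := by positivity
    linarith
  -- the undivided quantities in terms of the normalised variables
  have e2 : ∀ t, t0 ≤ t → 0 < hubble (g t) (k t) → F2 t = hubble (g t) (k t) ^ 2 *
      ((1 / 100) ^ 2 - sigmaPlus (g t) (k t) ^ 2) := fun t ht hH => by
    rw [sigmaPlus_eq h hr ht hH.ne']
    simp only [hF2]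
    field_simp
  have e3 : ∀ t, t0 ≤ t → 0 < hubble (g t) (k t) → F3 t = hubble (g t) (k t) ^ 2 *
      (1 / 10000 - (sigmaMinus (g t) (k t) ^ 2 + nMinus (g t) (k t) ^ 2)) := fun t ht hH => by
    have hr2 : Real.sqrt 3 ^ 2 = 3 := Real.sq_sqrt (by norm_num)
    rw [sigmaMinus_eq h hr ht hH.ne', nMinus_eq]
    simp only [hF3, div_pow, mul_pow, hr2]
    field_simp
    ring
  have e4 : ∀ t, t0 ≤ t → F4 t = (struct22 (g t) + struct33 (g t)) / 2 *
      (1 / 100 - varM (g t) (k t)) := fun t ht => by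
    have := add_pos (struct22_pos h ht) (struct33_pos h ht)
    rw [varM_eq]
    simp only [hF4]
    field_simp
    ring
  have hpos1 : ∀ t, t0 ≤ t → 0 ≤ F1 t → 0 < hubble (g t) (k t) := fun t ht hF => by
    have := inv_pos.2 (hden t ht)
    simp only [hF1] at hF
    linarith
  have small : ∀ t, t0 ≤ t → (∀ r ∈ Icc t0 t, 0 ≤ F1 r ∧ 0 ≤ F2 r ∧ 0 ≤ F3 r ∧ 0 ≤ F4 r) →
      IsSmallReduced t0 t P0 (fun t => hubble (g t) (k t)) τ (fun t => sigmaPlus (g t) (k t))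
      (fun t => sigmaMinus (g t) (k t)) (fun t => nMinus (g t) (k t)) (fun t => varM (g t) (k t))
      (fun t => normStress (g t) (k t) (f t)) := by
    intro t ht hF
    have hH : ∀ r ∈ Icc t0 t, 0 < hubble (g r) (k r) := fun r hr => hpos1 r hr.1 (hF r hr).1
    refine isSmallReduced_of_bounds h hr hτ hP0 hP1 hP ht hH (fun r hr => ?_) (fun r hr => ?_)
      (fun r hr => ?_)
    · have h2 := (hF r hr).2.1
      rw [e2 r hr.1 (hH r hr)] at h2
      have := nonneg_of_mul_nonneg_right h2 (pow_pos (hH r hr) 2)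
      exact abs_le_of_sq_le_sq (by linarith) (by norm_num)
    · have h2 := (hF r hr).2.2.1
      rw [e3 r hr.1 (hH r hr)] at h2
      have := nonneg_of_mul_nonneg_right h2 (pow_pos (hH r hr) 2)
      linarith
    · have h2 := (hF r hr).2.2.2
      rw [e4 r hr.1] at h2
      have := nonneg_of_mul_nonneg_right h2
        (half_pos (add_pos (struct22_pos h hr.1) (struct33_pos h hr.1)))
      linarith
  -- The decay estimates return strictly better bounds: |σ| ≤ 5/10000, x² + y² ≤ 8/10000² and m ≤
  -- 1/10000.
  have strict : ∀ t, t0 ≤ t → IsSmallReduced t0 t P0 (fun t => hubble (g t) (k t)) τ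
      (fun t => sigmaPlus (g t) (k t)) (fun t => sigmaMinus (g t) (k t))
      (fun t => nMinus (g t) (k t)) (fun t => varM (g t) (k t))
      (fun t => normStress (g t) (k t) (f t)) → 0 < F1 t ∧ 0 < F2 t ∧ 0 < F3 t ∧ 0 < F4 t := by
    intro t ht hs
    have hH := hs.reduced.hubble_pos t (right_mem_Icc.2 ht)
    have hT := hs.time_le (right_mem_Icc.2 ht)
    have hexp : ∀ r : ℝ, 0 ≤ r → Real.exp (-r * (τ t - τ t0)) ≤ 1 := fun r hr =>
      Real.exp_le_one_iff.2 (by nlinarith)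
    have hexp4 := hexp (4 / 5) (by norm_num)
    have hexp2 := hexp (2 / 5) (by norm_num)
    have hexp4' := Real.exp_pos (-(4 / 5) * (τ t - τ t0))
    refine ⟨?_, ?_, ?_, ?_⟩
    · have h1 := hs.inv_hubble_le
      simp only [hF1, sub_pos]
      beta_reduce at h1 hH
      rw [inv_lt_comm₀ (hden t ht) hH]
      have : 0 < H0⁻¹ := inv_pos.2 hH0
      rw [div_eq_mul_inv]
      rw [← hH0d] at h1
      linarith
    · rw [e2 t ht hH]
      have h1 := hs.sigma_sq_decay (ε := 1 / 10000) (by norm_num) le_rfl hP1 hx0' hσ0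
      refine mul_pos (pow_pos hH 2) ?_
      beta_reduce at h1
      have : (5 * (1 / 10000) * Real.exp (-(4 / 5) * (τ t - τ t0))) ^ 2 ≤
          (5 * (1 / 10000)) ^ 2 := by
        refine pow_le_pow_left₀ (by positivity) ?_ 2
        linarith
      linarith
    · rw [e3 t ht hH]
      have h1 := hs.xy_decay
      refine mul_pos (pow_pos hH 2) ?_
      beta_reduce at h1
      have : (2 * (sigmaMinus (g t0) (k t0) ^ 2 + nMinus (g t0) (k t0) ^ 2) + 6 * P0 ^ 2) *
          Real.exp (-(4 / 5) * (τ t - τ t0)) ≤ 8 * (1 / 10000) ^ 2 * 1 :=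
        mul_le_mul (by nlinarith) hexp4 hexp4'.le (by norm_num)
      linarith
    · rw [e4 t ht]
      have h1 := hs.m_decay
      have h0 := hs.reduced.m_pos t0 (left_mem_Icc.2 ht)
      refine mul_pos (half_pos (add_pos (struct22_pos h ht) (struct33_pos h ht))) ?_
      beta_reduce at h1 h0
      nlinarith
  have hc : ∀ i j, ContinuousOn (fun s => k s i j) (Ici t0) := fun i j =>
    (h.smooth_secondForm i j).continuousOn
  have hg : ∀ i j, ContinuousOn (fun s => g s i j) (Ici t0) := fun i j =>
    (h.smooth_metric i j).continuousOn
  have hq : ∀ i, ContinuousOn (fun s => k s i i / g s i i) (Ici t0) := fun i =>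
    (hc i i).div (hg i i) fun t ht => (h.metric_pos ht i).ne'
  have hHc : ContinuousOn (fun t => hubble (g t) (k t)) (Ici t0) :=
    ((((hq 0).add (hq 1)).add (hq 2)).div_const 3).congr fun t ht => hubble_eq h hr ht
  have hs2 : ContinuousOn (fun t => struct22 (g t)) (Ici t0) :=
    ((hg 1 1).div ((hg 2 2).mul (hg 0 0)) fun t ht =>
      (mul_pos (h.metric_pos ht 2) (h.metric_pos ht 0)).ne').sqrt
  have hs3 : ContinuousOn (fun t => struct33 (g t)) (Ici t0) :=
    ((hg 2 2).div ((hg 0 0).mul (hg 1 1)) fun t ht =>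
      (mul_pos (h.metric_pos ht 0) (h.metric_pos ht 1)).ne').sqrt
  have hF1c : ContinuousOn F1 (Ici t0) := hHc.sub (ContinuousOn.inv₀ (by fun_prop)
    fun t ht => (hden t ht).ne')
  have hF2c : ContinuousOn F2 (Ici t0) :=
    ((hHc.const_mul _).pow 2).sub (((((hq 1).add (hq 2)).div_const 2).sub hHc).pow 2)
  have hF3c : ContinuousOn F3 (Ici t0) :=
    ((hHc.pow 2).div_const _).sub (((((hq 1).sub (hq 2)).pow 2).add
      ((hs2.sub hs3).pow 2)).div_const 12)
  have hF4c : ContinuousOn F4 (Ici t0) := ((hs2.add hs3).div_const 200).sub hHc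
  have hF0 : 0 < F1 t0 ∧ 0 < F2 t0 ∧ 0 < F3 t0 ∧ 0 < F4 t0 := by
    refine ⟨?_, ?_, ?_, ?_⟩
    · simp only [hF1, sub_self, mul_zero, add_zero, inv_div, ← hH0d]
      linarith
    · rw [e2 t0 le_rfl hH0]
      refine mul_pos (pow_pos hH0 2) ?_
      nlinarith [abs_nonneg (sigmaPlus (g t0) (k t0)), sq_abs (sigmaPlus (g t0) (k t0))]
    · rw [e3 t0 le_rfl hH0]
      exact mul_pos (pow_pos hH0 2) (by linarith)
    · rw [e4 t0 le_rfl]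
      exact mul_pos (half_pos (add_pos (struct22_pos h le_rfl) (struct33_pos h le_rfl)))
        (by linarith)
  have hall := pos_of_bootstrap (t0 := t0)
    (F := fun t => min (min (F1 t) (F2 t)) (min (F3 t) (F4 t)))
    ((hF1c.inf hF2c).inf (hF3c.inf hF4c)) (by simpa [lt_min_iff, and_assoc] using hF0)
    fun t ht hF => by
      have := strict t ht (small t ht fun r hr => by
        simpa [le_min_iff, and_assoc] using hF r hr)
      simpa [lt_min_iff, and_assoc] using this
  refine small t ht fun r hr => ?_
  have := (hall r hr.1).le
  simpa [le_min_iff, and_assoc] using this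

end

/-! ### Sharp decay rates -/

/-- A solution of the evolution equations on `[t0, ∞)` with decay rates that are not yet sharp. -/
structure HasRoughDecay (t0 : ℝ) (H τ σ x y m : ℝ → ℝ) (s : ℝ → Fin 3 → ℝ) : Prop where
  reduced : IsReduced (Ici t0) H τ σ x y m s
  stress : ∀ t, t0 ≤ t → ∀ i,
    0 ≤ s t i ∧ s t i ≤ 1 / 100 * Real.exp (-(9 / 5) * (τ t - τ t0))
  sigma : ∀ t, t0 ≤ t → |σ t| ≤ 1 / 100 * Real.exp (-(4 / 5) * (τ t - τ t0))
  xy : ∀ t, t0 ≤ t → x t ^ 2 + y t ^ 2 ≤ 1 / 100 * Real.exp (-(4 / 5) * (τ t - τ t0))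
  m_le : ∀ t, t0 ≤ t → m t ≤ 1 / 100 * Real.exp (-(2 / 5) * (τ t - τ t0))

/-- The case a = 0 of `decay_of_deriv_le`, applied to u and to -u: a derivative that is integrable
in τ gives bounded variation. -/
theorem abs_sub_le_of_abs_deriv_le {t0 t1 : ℝ} (h01 : t0 ≤ t1) {H τ u u' : ℝ → ℝ} {b c : ℝ}
    (hc : 0 < c) (hb : 0 ≤ b) (hτ : ∀ t ∈ Icc t0 t1, HasDerivWithinAt τ (H t) (Icc t0 t1) t)
    (hu : ∀ t ∈ Icc t0 t1, HasDerivWithinAt u (H t * u' t) (Icc t0 t1) t)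
    (hH : ∀ t ∈ Icc t0 t1, 0 < H t)
    (hle : ∀ t ∈ Icc t0 t1, |u' t| ≤ b * Real.exp (-c * (τ t - τ t0))) :
    |u t1 - u t0| ≤ b / c := by
  have h1 := decay_of_deriv_le h01 (a := 0) (c := c) (b := b) hc.ne hτ hu hH fun t ht => by
    have := (abs_le.1 (hle t ht)).2
    linarith
  have h2 := decay_of_deriv_le h01 (a := 0) (c := c) (b := b) (u := fun t => -u t)
    (u' := fun t => -u' t) hc.ne hτ
    (fun t ht => (hu t ht).neg.congr_deriv (by ring)) hH fun t ht => by
      have := (abs_le.1 (hle t ht)).1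
      linarith
  have e : b / (0 - c) = -(b / c) := by rw [zero_sub, div_neg]
  have h3 : 0 ≤ b / c * Real.exp (-c * (τ t1 - τ t0)) := by positivity
  rw [e] at h1 h2
  simp only [neg_zero, zero_mul, Real.exp_zero, mul_one] at h1 h2
  rw [abs_le]
  constructor <;> linarith

/-- The function u - φ increases and u + φ decreases, so both are squeezed to a common limit,
obtained as the supremum of u - φ. The tail φ itself is the rate of convergence. -/
theorem exists_limit_of_abs_deriv_le {t0 : ℝ} {u u' φ φ' : ℝ → ℝ}
    (hu : ∀ t, t0 ≤ t → HasDerivWithinAt u (u' t) (Ici t0) t)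
    (hφ : ∀ t, t0 ≤ t → HasDerivWithinAt φ (φ' t) (Ici t0) t)
    (hle : ∀ t, t0 ≤ t → |u' t| ≤ -φ' t) (h0 : Tendsto φ atTop (𝓝 0)) :
    ∃ L, Tendsto u atTop (𝓝 L) ∧ ∀ t, t0 ≤ t → |u t - L| ≤ φ t := by
  have hd : ∀ a b, t0 ≤ a → a ≤ b → u a - φ a ≤ u b - φ b ∧ u b + φ b ≤ u a + φ a := by
    intro a b ha hab
    have hsub : Icc a b ⊆ Ici t0 := fun r hr => ha.trans hr.1
    refine ⟨?_, ?_⟩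
    · exact le_of_hasDerivWithinAt_nonneg hab
        (fun t ht => ((hu t (hsub ht)).sub (hφ t (hsub ht))).mono hsub)
        fun t ht => by linarith [abs_le.1 (hle t (hsub ht))]
    · have := le_of_hasDerivWithinAt_nonneg hab (u := fun t => -(u t + φ t))
        (fun t ht => ((hu t (hsub ht)).add (hφ t (hsub ht))).neg.mono hsub)
        fun t ht => by linarith [abs_le.1 (hle t (hsub ht))]
      linarith
  have hφ0 : ∀ t, t0 ≤ t → 0 ≤ φ t := fun t ht => by
    refine le_of_tendsto h0 ((eventually_ge_atTop t).mono fun r hr => ?_)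
    have := hd t r ht hr
    linarith
  have hmono : MonotoneOn (fun t => u t - φ t) (Ici t0) := fun a ha b _ hab => (hd a b ha hab).1
  have hbdd : BddAbove ((fun t => u t - φ t) '' Ici t0) := by
    refine ⟨u t0 + φ t0, ?_⟩
    rintro _ ⟨t, ht, rfl⟩
    have h1 := (hd t0 t le_rfl ht).2
    have h2 := hφ0 t ht
    linarith
  set L := sSup ((fun t => u t - φ t) '' Ici t0) with hL
  have hlow : ∀ t, t0 ≤ t → u t - φ t ≤ L := fun t ht => le_csSup hbdd ⟨t, ht, rfl⟩
  have hup : ∀ t, t0 ≤ t → L ≤ u t + φ t := fun t ht => by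
    refine csSup_le ⟨_, t0, self_mem_Ici, rfl⟩ ?_
    rintro _ ⟨r, hr, rfl⟩
    rcases le_total t r with htr | hrt
    · have h1 := (hd t r ht htr).2
      have h2 := hφ0 r hr
      linarith
    · have h1 := (hd r t hr hrt).1
      have h2 := hφ0 t ht
      linarith
  have hle' : ∀ t, t0 ≤ t → |u t - L| ≤ φ t := fun t ht =>
    abs_le.2 ⟨by linarith [hup t ht], by linarith [hlow t ht]⟩
  refine ⟨L, ?_, hle'⟩
  rw [tendsto_iff_dist_tendsto_zero]
  refine squeeze_zero' (Eventually.of_forall fun _ => dist_nonneg)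
    ((eventually_ge_atTop t0).mono fun t ht => ?_) h0
  rw [Real.dist_eq]
  exact hle' t ht

namespace HasRoughDecay

variable {t0 : ℝ} {H τ σ x y m : ℝ → ℝ} {s : ℝ → Fin 3 → ℝ}

theorem time_le (h : HasRoughDecay t0 H τ σ x y m s) {t : ℝ} (ht : t0 ≤ t) : τ t0 ≤ τ t :=
  le_of_hasDerivWithinAt_nonneg ht
    (fun r hr => (h.reduced.deriv_time r hr.1).mono Icc_subset_Ici_self)
    fun r hr => (h.reduced.hubble_pos r hr.1).le

theorem exp_neg_le_one (h : HasRoughDecay t0 H τ σ x y m s) {t : ℝ} (ht : t0 ≤ t) {c : ℝ}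
    (hc : 0 ≤ c) : Real.exp (-c * (τ t - τ t0)) ≤ 1 :=
  Real.exp_le_one_iff.2 (by nlinarith [h.time_le ht])

theorem exp_neg_le_exp_neg (h : HasRoughDecay t0 H τ σ x y m s) {t : ℝ} (ht : t0 ≤ t) {c d : ℝ}
    (hc : c ≤ d) : Real.exp (-d * (τ t - τ t0)) ≤ Real.exp (-c * (τ t - τ t0)) :=
  Real.exp_le_exp.2 (by nlinarith [h.time_le ht])

theorem abs_decel_le (h : HasRoughDecay t0 H τ σ x y m s) {t : ℝ} (ht : t0 ≤ t) :
    |decel (σ t) (x t) (y t) (s t) - 1 / 2| ≤ 1 / 20 * Real.exp (-(4 / 5) * (τ t - τ t0)) := by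
  have h1 := BianchiVlasov.abs_decel_sub_half_le (σ := σ t) (x := x t) (y := y t) (h.stress t ht)
  have h2 := h.sigma t ht
  have h3 := h.xy t ht
  have e1 := h.exp_neg_le_one ht (c := 4 / 5) (by norm_num)
  have e2 := h.exp_neg_le_exp_neg ht (c := 4 / 5) (d := 9 / 5) (by norm_num)
  set E := Real.exp (-(4 / 5) * (τ t - τ t0))
  have hE : 0 < E := Real.exp_pos _
  have h4 : σ t ^ 2 ≤ 1 / 100 * E := by
    rw [← sq_abs]
    nlinarith [abs_nonneg (σ t)]
  linarith

theorem abs_six_mul_le (h : HasRoughDecay t0 H τ σ x y m s) {t : ℝ} (ht : t0 ≤ t) :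
    |6 * m t * x t * y t| ≤ 1 / 100 * Real.exp (-(4 / 5) * (τ t - τ t0)) := by
  have h1 := abs_mul_le_half_sq (x t) (y t)
  have h2 := h.m_le t ht
  have h3 := h.reduced.m_pos t ht
  have h4 := h.xy t ht
  have e1 := h.exp_neg_le_one ht (c := 2 / 5) (by norm_num)
  have h5 : m t ≤ 1 / 100 := by linarith
  rw [show 6 * m t * x t * y t = 6 * m t * (x t * y t) by ring, abs_mul,
    abs_of_pos (by positivity : 0 < 6 * m t)]
  nlinarith [abs_nonneg (x t * y t)]

/-- `M` is comparable to `e^{-τ/2}`. -/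
theorem abs_log_m_le (h : HasRoughDecay t0 H τ σ x y m s) {t : ℝ} (ht : t0 ≤ t) :
    |Real.log (m t) + (τ t - τ t0) / 2 - Real.log (m t0)| ≤ 1 := by
  have h1 := abs_sub_le_of_abs_deriv_le ht (H := H) (τ := τ)
    (u := fun t => Real.log (m t) + (τ t - τ t0) / 2)
    (u' := fun t => -(decel (σ t) (x t) (y t) (s t) - 1 / 2) - 2 * σ t - 6 * m t * x t * y t)
    -- The choice b = c is generous and makes the total variation at most 1, so that exponentiating
    -- costs only a factor e.
    (b := 4 / 5) (c := 4 / 5) (by norm_num) (by norm_num)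
    (fun r hr => (h.reduced.deriv_time r hr.1).mono Icc_subset_Ici_self) (fun r hr => ?_)
    (fun r hr => h.reduced.hubble_pos r hr.1) (fun r hr => ?_)
  · simp only [sub_self, zero_div, add_zero] at h1
    linarith [h1]
  · have hm := (h.reduced.m_pos r hr.1).ne'
    refine ((((h.reduced.deriv_m r hr.1).log hm).add
      (((h.reduced.deriv_time r hr.1).sub_const (τ t0)).div_const 2)).mono
      Icc_subset_Ici_self).congr_deriv ?_
    field_simp
    ring
  · have h2 := abs_le.1 (h.abs_decel_le hr.1)
    have h3 := abs_le.1 (h.sigma r hr.1)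
    have h4 := abs_le.1 (h.abs_six_mul_le hr.1)
    have := Real.exp_pos (-(4 / 5) * (τ r - τ t0))
    rw [abs_le]
    constructor <;> linarith

theorem m_le_sharp (h : HasRoughDecay t0 H τ σ x y m s) {t : ℝ} (ht : t0 ≤ t) :
    m t ≤ 1 / 10 * Real.exp (-(1 / 2) * (τ t - τ t0)) := by
  have h1 := (abs_le.1 (h.abs_log_m_le ht)).2
  have h2 := h.reduced.m_pos t ht
  have h3 := h.reduced.m_pos t0 self_mem_Ici
  have h4 := h.m_le t0 le_rfl
  simp only [sub_self, mul_zero, Real.exp_zero, mul_one] at h4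
  have h5 : Real.log (m t) ≤ Real.log (m t0) + 1 + -(1 / 2) * (τ t - τ t0) := by linarith
  rw [← Real.exp_log h2]
  refine (Real.exp_le_exp.2 h5).trans ?_
  rw [Real.exp_add, Real.exp_add, Real.exp_log h3]
  refine mul_le_mul_of_nonneg_right ?_ (Real.exp_pos _).le
  have := Real.exp_one_lt_d9
  nlinarith [Real.exp_pos 1]

theorem inv_m_le (h : HasRoughDecay t0 H τ σ x y m s) {t : ℝ} (ht : t0 ≤ t) :
    (m t)⁻¹ ≤ 3 * (m t0)⁻¹ * Real.exp (1 / 2 * (τ t - τ t0)) := by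
  have h1 := (abs_le.1 (h.abs_log_m_le ht)).1
  have h2 := h.reduced.m_pos t ht
  have h3 := h.reduced.m_pos t0 self_mem_Ici
  have h5 : Real.log (m t)⁻¹ ≤ 1 + Real.log (m t0)⁻¹ + 1 / 2 * (τ t - τ t0) := by
    rw [Real.log_inv, Real.log_inv]; linarith
  rw [← Real.exp_log (inv_pos.2 h2)]
  refine (Real.exp_le_exp.2 h5).trans ?_
  rw [Real.exp_add, Real.exp_add, Real.exp_log (inv_pos.2 h3)]
  refine mul_le_mul_of_nonneg_right (mul_le_mul_of_nonneg_right ?_ (inv_pos.2 h3).le)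
    (Real.exp_pos _).le
  have := Real.exp_one_lt_d9
  linarith

/-- The slowest product is m(x² + y²), of order e^{-(2/5 + 4/5)τ}. The rate 6/5 exceeds 1, so the
remainder no longer affects the leading decay. -/
theorem abs_oscRemainder_le (h : HasRoughDecay t0 H τ σ x y m s) {t : ℝ} (ht : t0 ≤ t) :
    |oscRemainder (σ t) (x t) (y t) (m t) (s t)| ≤
      1 / 20 * Real.exp (-(6 / 5) * (τ t - τ t0)) := by
  have h1 := h.abs_decel_le ht
  have h2 := h.sigma t ht
  have h3 := h.xy t ht
  have h4 := h.m_le t ht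
  have h5 := h.reduced.m_pos t ht
  have e0 := h.exp_neg_le_one ht (c := 2 / 5) (by norm_num)
  have e1 := h.exp_neg_le_one ht (c := 4 / 5) (by norm_num)
  have e2 := h.exp_neg_le_exp_neg ht (c := 2 / 5) (d := 4 / 5) (by norm_num)
  have h6 := abs_oscRemainder_sub_le (σ := σ t) (s := s t) (x := x t) (y := y t) h5.le
    (by linarith) (by linarith)
  have h7 := abs_stress_diff_le (h.stress t ht)
  have h8 := sq_two_mul_add_le (x := x t) (y := y t) h5.le (by linarith)
  set z := Real.sqrt 3 / 2 * (s t 1 - s t 2)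
  have e3 : Real.exp (-(2 / 5) * (τ t - τ t0)) * Real.exp (-(4 / 5) * (τ t - τ t0)) =
      Real.exp (-(6 / 5) * (τ t - τ t0)) := by rw [← Real.exp_add]; ring_nf
  have e4 := h.exp_neg_le_exp_neg ht (c := 6 / 5) (d := 9 / 5) (by norm_num)
  have hE4 := Real.exp_pos (-(4 / 5) * (τ t - τ t0))
  have hE2 := Real.exp_pos (-(2 / 5) * (τ t - τ t0))
  have b1 : (3 * |decel (σ t) (x t) (y t) (s t) - 1 / 2| + 2 * m t + 4 * |σ t|) *
      (x t ^ 2 + y t ^ 2) ≤ 3 / 10 * Real.exp (-(2 / 5) * (τ t - τ t0)) *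
        (1 / 100 * Real.exp (-(4 / 5) * (τ t - τ t0))) :=
    mul_le_mul (by linarith) h3 (by positivity) (by positivity)
  have b2 : |2 * x t + m t * y t| ≤ 1 := by
    refine abs_le_of_sq_le_sq ?_ zero_le_one
    linarith
  have b3 : |(2 * x t + m t * y t) * z| ≤ 1 * (1 / 100 * Real.exp (-(9 / 5) * (τ t - τ t0))) := by
    rw [abs_mul]
    exact mul_le_mul b2 h7 (abs_nonneg _) zero_le_one
  have b4 := abs_add_le (oscRemainder (σ t) (x t) (y t) (m t) (s t) -
    (2 * x t + m t * y t) * z) ((2 * x t + m t * y t) * z)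
  rw [sub_add_cancel] at b4
  have b5 : 3 / 10 * Real.exp (-(2 / 5) * (τ t - τ t0)) *
        (1 / 100 * Real.exp (-(4 / 5) * (τ t - τ t0))) =
        3 / 1000 * Real.exp (-(6 / 5) * (τ t - τ t0)) := by rw [← e3]; ring
  have hE6 := Real.exp_pos (-(6 / 5) * (τ t - τ t0))
  linarith

/-- The forcing decays faster than e^{-τ}, so `oscEnergy` attains the exact rate 1. -/
theorem xy_le_sharp (h : HasRoughDecay t0 H τ σ x y m s) {t : ℝ} (ht : t0 ≤ t) :
    x t ^ 2 + y t ^ 2 ≤ Real.exp (-1 * (τ t - τ t0)) := by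
  have h1 := decay_of_deriv_le ht (a := 1) (b := 1 / 20) (c := 6 / 5) (by norm_num)
    (fun r hr => (h.reduced.deriv_time r hr.1).mono Icc_subset_Ici_self)
    (fun r hr => (h.reduced.deriv_oscEnergy (t := r) hr.1).mono Icc_subset_Ici_self)
    (fun r hr => h.reduced.hubble_pos r hr.1) (fun r hr => by
      have := (abs_le.1 (h.abs_oscRemainder_le hr.1)).2
      linarith)
  rw [show (1 / 20 : ℝ) / (1 - 6 / 5) = -(1 / 4) by norm_num] at h1
  have hm : ∀ r, t0 ≤ r → m r ≤ 1 / 100 := fun r hr => by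
    have := h.m_le r hr
    have := h.exp_neg_le_one hr (c := 2 / 5) (by norm_num)
    linarith
  have h2 := (abs_le.1 (abs_oscEnergy_sub_le (x := x t) (y := y t)
    (h.reduced.m_pos t ht).le)).1
  have h3 := (abs_le.1 (abs_oscEnergy_sub_le (x := x t0) (y := y t0)
    (h.reduced.m_pos t0 self_mem_Ici).le)).2
  have h4 := mul_le_mul_of_nonneg_right (hm t0 le_rfl) (by positivity : 0 ≤ x t0 ^ 2 + y t0 ^ 2)
  have h5 := mul_le_mul_of_nonneg_right (hm t ht) (by positivity : 0 ≤ x t ^ 2 + y t ^ 2)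
  have h6 := h.xy t0 le_rfl
  simp only [sub_self, mul_zero, Real.exp_zero, mul_one] at h6
  have e1 := Real.exp_pos (-1 * (τ t - τ t0))
  have e2 := Real.exp_pos (-(6 / 5) * (τ t - τ t0))
  have h7 : (oscEnergy (x t0) (y t0) (m t0) - -(1 / 4)) * Real.exp (-1 * (τ t - τ t0)) ≤
      1 / 2 * Real.exp (-1 * (τ t - τ t0)) := mul_le_mul_of_nonneg_right (by linarith) e1.le
  linarith

/-- Of the damping 2(q - 2) ≤ -29/10 of σ², Young's inequality uses 2/5 and leaves 5/2, more than
the rate 2 of the squared forcing. The bound (45/2)/(1/2) + 1 = 46 is below 7². -/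
theorem abs_sigma_le_sharp (h : HasRoughDecay t0 H τ σ x y m s) {t : ℝ} (ht : t0 ≤ t) :
    |σ t| ≤ 7 * Real.exp (-1 * (τ t - τ t0)) := by
  have hexp : ∀ r, Real.exp (-1 * (τ r - τ t0)) ^ 2 = Real.exp (-2 * (τ r - τ t0)) := fun r => by
    rw [← Real.exp_nat_mul]; congr 1; push_cast; ring
  have h1 := decay_of_deriv_le ht (a := 5 / 2) (b := 45 / 2) (c := 2) (by norm_num)
    (fun r hr => (h.reduced.deriv_time r hr.1).mono Icc_subset_Ici_self) (u := fun t => σ t ^ 2)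
    (u' := fun t => 2 * σ t * ((decel (σ t) (x t) (y t) (s t) - 2) * σ t - 2 * y t ^ 2
      + (s t 1 + s t 2 - 2 * s t 0) / 2))
    (fun r hr => (((h.reduced.deriv_sigma r hr.1).mono Icc_subset_Ici_self).pow 2).congr_deriv
      (by simp; ring))
    (fun r hr => h.reduced.hubble_pos r hr.1) fun r hr => ?_
  · refine abs_le_of_sq_le_sq ?_ (by positivity)
    rw [mul_pow, hexp]
    rw [show (5 / 2 : ℝ) - 2 = 1 / 2 by norm_num] at h1
    have e1 := Real.exp_pos (-(5 / 2) * (τ t - τ t0))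
    have e2 := h.exp_neg_le_exp_neg ht (c := 2) (d := 5 / 2) (by norm_num)
    have h2 := h.sigma t0 le_rfl
    simp only [sub_self, mul_zero, Real.exp_zero, mul_one] at h2
    have h3 : σ t0 ^ 2 ≤ 1 := by nlinarith [abs_nonneg (σ t0), sq_abs (σ t0)]
    nlinarith
  · have h2 := (abs_le.1 (h.abs_decel_le hr.1)).2
    have e1 := h.exp_neg_le_one hr.1 (c := 4 / 5) (by norm_num)
    have h3 := h.xy_le_sharp hr.1
    have h4 := abs_le.1 (abs_stress_plus_le (h.stress r hr.1))
    have e2 := h.exp_neg_le_exp_neg hr.1 (c := 1) (d := 9 / 5) (by norm_num)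
    set E := Real.exp (-1 * (τ r - τ t0)) with hE
    have hE0 : 0 < E := Real.exp_pos _
    set w := -2 * y r ^ 2 + (s r 1 + s r 2 - 2 * s r 0) / 2 with hw
    have h8 : |w| ≤ 3 * E :=
      abs_le.2 ⟨by nlinarith [sq_nonneg (x r)], by nlinarith [sq_nonneg (y r)]⟩
    have h9 : w ^ 2 ≤ (3 * E) ^ 2 := by rw [← sq_abs]; gcongr
    have h10 : (3 * E) ^ 2 = 9 * Real.exp (-2 * (τ r - τ t0)) := by
      rw [← hexp, ← hE]; ring
    have h11 : 2 * σ r * ((decel (σ r) (x r) (y r) (s r) - 2) * σ r - 2 * y r ^ 2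
      + (s r 1 + s r 2 - 2 * s r 0) / 2) =
      2 * (decel (σ r) (x r) (y r) (s r) - 2) * σ r ^ 2 + 2 * σ r * w := by rw [hw]; ring
    rw [h11]
    -- The square gives 2σw ≤ (2/5)σ² + (5/2)w².
    nlinarith [sq_nonneg (2 * σ r - 5 * w), sq_nonneg (σ r)]

theorem abs_decel_le_sharp (h : HasRoughDecay t0 H τ σ x y m s) {t : ℝ} (ht : t0 ≤ t) :
    |decel (σ t) (x t) (y t) (s t) - 1 / 2| ≤ 2 * Real.exp (-1 * (τ t - τ t0)) := by
  have h1 := BianchiVlasov.abs_decel_sub_half_le (σ := σ t) (x := x t) (y := y t) (h.stress t ht)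
  have h2 := h.abs_sigma_le_sharp ht
  have h3 := h.xy_le_sharp ht
  have h4 := h.sigma t ht
  have e0 := h.exp_neg_le_one ht (c := 4 / 5) (by norm_num)
  have e2 := h.exp_neg_le_exp_neg ht (c := 1) (d := 9 / 5) (by norm_num)
  have h5 : σ t ^ 2 ≤ 1 / 100 * (7 * Real.exp (-1 * (τ t - τ t0))) := by
    rw [← sq_abs]
    nlinarith [abs_nonneg (σ t)]
  have := Real.exp_pos (-1 * (τ t - τ t0))
  linarith

/-- `H` is comparable to `e^{-3τ/2}`. -/
theorem abs_log_hubble_le (h : HasRoughDecay t0 H τ σ x y m s) {t : ℝ} (ht : t0 ≤ t) :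
    |Real.log (H t) + 3 / 2 * (τ t - τ t0) - Real.log (H t0)| ≤ 1 := by
  have h1 := abs_sub_le_of_abs_deriv_le ht (H := H) (τ := τ)
    (u := fun t => Real.log (H t) + 3 / 2 * (τ t - τ t0))
    (u' := fun t => -(decel (σ t) (x t) (y t) (s t) - 1 / 2))
    (b := 4 / 5) (c := 4 / 5) (by norm_num) (by norm_num)
    (fun r hr => (h.reduced.deriv_time r hr.1).mono Icc_subset_Ici_self) (fun r hr => ?_)
    (fun r hr => h.reduced.hubble_pos r hr.1) (fun r hr => ?_)
  · simp only [sub_self, mul_zero, add_zero] at h1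
    linarith [h1]
  · have hm := (h.reduced.hubble_pos r hr.1).ne'
    refine ((((h.reduced.deriv_hubble r hr.1).log hm).add
      (((h.reduced.deriv_time r hr.1).sub_const (τ t0)).const_mul (3 / 2))).mono
      Icc_subset_Ici_self).congr_deriv ?_
    field_simp
    ring
  · rw [abs_neg]
    refine (h.abs_decel_le hr.1).trans (mul_le_mul_of_nonneg_right (by norm_num)
      (Real.exp_pos _).le)

end HasRoughDecay

/-! ### Asymptotics in cosmological time -/

namespace HasRoughDecay

variable {t0 : ℝ} {H τ σ x y m : ℝ → ℝ} {s : ℝ → Fin 3 → ℝ}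

/-- The derivative 1 + q of 1/H stays between 1 and 2, and the normalisation gives 1/H = 3t/2 at t0,
between t0 and 2 t0. -/
theorem inv_hubble_bounds (h : HasRoughDecay t0 H τ σ x y m s) (ht0 : 0 < t0)
    (hn : t0 = 2 / 3 * (H t0)⁻¹) {t : ℝ} (ht : t0 ≤ t) : t ≤ (H t)⁻¹ ∧ (H t)⁻¹ ≤ 2 * t := by
  have hd : ∀ c : ℝ, ∀ r ∈ Icc t0 t, HasDerivWithinAt (fun r => (H r)⁻¹ - c * r)
      (1 + decel (σ r) (x r) (y r) (s r) - c) (Icc t0 t) r := fun c r hr => by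
    have hH := (h.reduced.hubble_pos r hr.1).ne'
    refine ((((h.reduced.deriv_hubble r hr.1).inv hH).sub
      ((hasDerivWithinAt_id r _).const_mul c)).mono Icc_subset_Ici_self).congr_deriv ?_
    field_simp
  have hq : ∀ r ∈ Icc t0 t, |decel (σ r) (x r) (y r) (s r) - 1 / 2| ≤ 1 / 20 := fun r hr => by
    have h1 := h.abs_decel_le hr.1
    have h2 := h.exp_neg_le_one hr.1 (c := 4 / 5) (by norm_num)
    linarith
  have h1 := le_of_hasDerivWithinAt_nonneg ht (hd 1) fun r hr => by
    linarith [abs_le.1 (hq r hr)]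
  have h2 := le_of_hasDerivWithinAt_nonneg ht (fun r hr => (hd 2 r hr).neg) fun r hr => by
    linarith [abs_le.1 (hq r hr)]
  simp only [Pi.neg_apply] at h2
  constructor <;> linarith

/-- Translates rates in τ into powers of t: e^{-3(τ - τ0)/2} is at most e H(t)/H(t0), H(t) ≤ 1/t,
and e · (3/2) ≤ 9/2. -/
theorem exp_neg_le_rpow (h : HasRoughDecay t0 H τ σ x y m s) (ht0 : 0 < t0)
    (hn : t0 = 2 / 3 * (H t0)⁻¹) {r : ℝ} (hr : 0 ≤ r) {t : ℝ} (ht : t0 ≤ t) :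
    Real.exp (-(3 / 2 * r) * (τ t - τ t0)) ≤ (9 / 2 * t0) ^ r * t ^ (-r) := by
  have h1 := (abs_le.1 (h.abs_log_hubble_le ht)).1
  have hH := h.reduced.hubble_pos t ht
  have hH0 := h.reduced.hubble_pos t0 self_mem_Ici
  have htp : 0 < t := ht0.trans_le ht
  have h2 : Real.exp (-(3 / 2) * (τ t - τ t0)) ≤ 9 / 2 * t0 * t⁻¹ := by
    have h3 : -(3 / 2) * (τ t - τ t0) ≤ 1 + Real.log (H t) + Real.log (H t0)⁻¹ := by
      rw [Real.log_inv]; linarith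
    refine (Real.exp_le_exp.2 h3).trans ?_
    rw [Real.exp_add, Real.exp_add, Real.exp_log hH, Real.exp_log (inv_pos.2 hH0)]
    have h4 : H t ≤ t⁻¹ := by
      rw [le_inv_comm₀ hH htp]
      exact (h.inv_hubble_bounds ht0 hn ht).1
    have h5 : (H t0)⁻¹ = 3 / 2 * t0 := by linarith
    rw [h5]
    have h6 : Real.exp 1 ≤ 3 := by linarith [Real.exp_one_lt_d9]
    have := mul_le_mul h6 h4 hH.le (by norm_num)
    nlinarith
  have h3 := Real.rpow_le_rpow (Real.exp_pos _).le h2 hr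
  rw [← Real.exp_mul, Real.mul_rpow (by positivity) (by positivity), Real.inv_rpow htp.le,
    ← Real.rpow_neg htp.le] at h3
  convert h3 using 2
  ring

/-- The derivative q - 1/2 is O(e^{-τ}), that is O(t^{-2/3}), and integrates to t^{1/3}. The
normalisation of t0 makes the difference vanish initially. -/
theorem abs_inv_hubble_sub_le (h : HasRoughDecay t0 H τ σ x y m s) (ht0 : 0 < t0)
    (hn : t0 = 2 / 3 * (H t0)⁻¹) {t : ℝ} (ht : t0 ≤ t) :
    |(H t)⁻¹ - 3 / 2 * t| ≤ 6 * (9 / 2 * t0) ^ (2 / 3 : ℝ) * t ^ (1 / 3 : ℝ) := by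
  set K := (9 / 2 * t0) ^ (2 / 3 : ℝ) with hK
  have hK0 : 0 < K := by positivity
  have hd : ∀ r ∈ Icc t0 t, HasDerivWithinAt (fun r => (H r)⁻¹ - 3 / 2 * r)
      (decel (σ r) (x r) (y r) (s r) - 1 / 2) (Icc t0 t) r := fun r hr => by
    have hH := (h.reduced.hubble_pos r hr.1).ne'
    refine ((((h.reduced.deriv_hubble r hr.1).inv hH).sub
      ((hasDerivWithinAt_id r _).const_mul (3 / 2))).mono Icc_subset_Ici_self).congr_deriv ?_
    field_simp
    ring
  have hφ : ∀ r ∈ Icc t0 t, HasDerivWithinAt (fun r => 6 * K * r ^ (1 / 3 : ℝ))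
      (2 * K * r ^ (-(2 / 3) : ℝ)) (Icc t0 t) r := fun r hr => by
    have hrp : 0 < r := ht0.trans_le hr.1
    refine (((Real.hasDerivAt_rpow_const (p := 1 / 3) (Or.inl hrp.ne')).const_mul
      (6 * K)).hasDerivWithinAt).congr_deriv ?_
    rw [show (1 / 3 : ℝ) - 1 = -(2 / 3) by norm_num]
    ring
  have hle : ∀ r ∈ Icc t0 t, |decel (σ r) (x r) (y r) (s r) - 1 / 2| ≤
      2 * K * r ^ (-(2 / 3) : ℝ) := fun r hr => by
    have h1 := h.abs_decel_le_sharp hr.1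
    have h2 := h.exp_neg_le_rpow ht0 hn (r := 2 / 3) (by norm_num) hr.1
    rw [show -(3 / 2 * (2 / 3) : ℝ) = -1 by norm_num] at h2
    linarith
  have h1 := le_of_hasDerivWithinAt_nonneg ht (fun r hr => (hφ r hr).sub (hd r hr)) fun r hr => by
    linarith [abs_le.1 (hle r hr)]
  have h2 := le_of_hasDerivWithinAt_nonneg ht (fun r hr => (hφ r hr).add (hd r hr)) fun r hr => by
    linarith [abs_le.1 (hle r hr)]
  simp only [Pi.sub_apply, Pi.add_apply] at h1 h2
  have h3 : (H t0)⁻¹ - 3 / 2 * t0 = 0 := by linarith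
  rw [h3] at h1 h2
  have h4 : 0 ≤ 6 * K * t0 ^ (1 / 3 : ℝ) := by positivity
  rw [abs_le]
  constructor <;> linarith

theorem abs_hubble_mul_sub_le (h : HasRoughDecay t0 H τ σ x y m s) (ht0 : 0 < t0)
    (hn : t0 = 2 / 3 * (H t0)⁻¹) {t : ℝ} (ht : t0 ≤ t) :
    |3 / 2 * t * H t - 1| ≤ 6 * (9 / 2 * t0) ^ (2 / 3 : ℝ) * t ^ (-(2 / 3) : ℝ) := by
  have htp : 0 < t := ht0.trans_le ht
  have hH := h.reduced.hubble_pos t ht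
  have h1 := h.abs_inv_hubble_sub_le ht0 hn ht
  have h4 : H t ≤ t⁻¹ := by
    rw [le_inv_comm₀ hH htp]
    exact (h.inv_hubble_bounds ht0 hn ht).1
  have e1 : 3 / 2 * t * H t - 1 = -(H t * ((H t)⁻¹ - 3 / 2 * t)) := by
    field_simp
    ring
  have e2 : t ^ (-(2 / 3) : ℝ) = t⁻¹ * t ^ (1 / 3 : ℝ) := by
    rw [← Real.rpow_neg_one, ← Real.rpow_add htp]; norm_num
  rw [e1, abs_neg, abs_mul, abs_of_pos hH, e2]
  calc H t * |(H t)⁻¹ - 3 / 2 * t| ≤ t⁻¹ * (6 * (9 / 2 * t0) ^ (2 / 3 : ℝ) * t ^ (1 / 3 : ℝ)) :=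
        mul_le_mul h4 h1 (abs_nonneg _) (by positivity)
    _ = _ := by ring

theorem tendsto_time (h : HasRoughDecay t0 H τ σ x y m s) (ht0 : 0 < t0)
    (hn : t0 = 2 / 3 * (H t0)⁻¹) {c : ℝ} (hc : 0 < c) :
    Tendsto (fun t => Real.exp (-c * (τ t - τ t0))) atTop (𝓝 0) := by
  have h1 : Tendsto (fun t : ℝ => (9 / 2 * t0) ^ (2 / 3 * c) * t ^ (-(2 / 3 * c))) atTop
      (𝓝 ((9 / 2 * t0) ^ (2 / 3 * c) * 0)) :=
    (tendsto_rpow_neg_atTop (by positivity)).const_mul _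
  rw [mul_zero] at h1
  refine squeeze_zero' (Eventually.of_forall fun _ => (Real.exp_pos _).le)
    ((eventually_ge_atTop t0).mono fun t ht => ?_) h1
  have := h.exp_neg_le_rpow ht0 hn (r := 2 / 3 * c) (by positivity) ht
  rwa [show -(3 / 2 * (2 / 3 * c)) = -c by ring] at this

/-- Expansion rates that differ from `H` by the shear agree with `2/(3t)` up to `O(t^{-4/3})`. -/
theorem exists_abs_expansion_sub_le (h : HasRoughDecay t0 H τ σ x y m s) (ht0 : 0 < t0)
    (hn : t0 = 2 / 3 * (H t0)⁻¹) {θ : ℝ → ℝ}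
    (hθ : ∀ t, t0 ≤ t → |θ t - H t| ≤ H t * (2 * |σ t| + 2 * |x t|)) :
    ∃ K, 0 ≤ K ∧ ∀ t, t0 ≤ t → |θ t - 2 / 3 * t⁻¹| ≤ K * t ^ (-(4 / 3) : ℝ) := by
  set K1 := (9 / 2 * t0) ^ (1 / 3 : ℝ) with hK1
  set K2 := (9 / 2 * t0) ^ (2 / 3 : ℝ) with hK2
  -- The first term comes from the shear, with 16 = 2 · 7 + 2. The second comes from H - 2/(3t) =
  -- O(t^{-5/3}), weakened to t^{-4/3} by means of t ≥ t0.
  refine ⟨16 * K1 + 4 * K2 * t0 ^ (-(1 / 3) : ℝ), by positivity, fun t ht => ?_⟩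
  have htp : 0 < t := ht0.trans_le ht
  have hH := h.reduced.hubble_pos t ht
  have hHt : H t ≤ t⁻¹ := by
    rw [le_inv_comm₀ hH htp]
    exact (h.inv_hubble_bounds ht0 hn ht).1
  have b1 : 2 * |σ t| + 2 * |x t| ≤ 16 * (K1 * t ^ (-(1 / 3) : ℝ)) := by
    have e0 := h.exp_neg_le_rpow ht0 hn (r := 1 / 3) (by norm_num) ht
    rw [show -(3 / 2 * (1 / 3) : ℝ) = -(1 / 2) by norm_num] at e0
    have e1 := h.exp_neg_le_exp_neg ht (c := 1 / 2) (d := 1) (by norm_num)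
    have h1 := h.abs_sigma_le_sharp ht
    have h2 : |x t| ≤ Real.exp (-(1 / 2) * (τ t - τ t0)) := by
      refine abs_le_of_sq_le_sq ?_ (Real.exp_pos _).le
      rw [← Real.exp_nat_mul, show ((2 : ℕ) : ℝ) * (-(1 / 2) * (τ t - τ t0)) =
        -1 * (τ t - τ t0) by push_cast; ring]
      linarith [h.xy_le_sharp ht, sq_nonneg (y t)]
    linarith
  have b2 : |θ t - H t| ≤ 16 * K1 * t ^ (-(4 / 3) : ℝ) := by
    have e2 : t ^ (-(4 / 3) : ℝ) = t⁻¹ * t ^ (-(1 / 3) : ℝ) := by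
      rw [← Real.rpow_neg_one, ← Real.rpow_add htp]; norm_num
    rw [e2]
    calc |θ t - H t| ≤ H t * (2 * |σ t| + 2 * |x t|) := hθ t ht
      _ ≤ t⁻¹ * (16 * (K1 * t ^ (-(1 / 3) : ℝ))) :=
        mul_le_mul hHt b1 (by positivity) (by positivity)
      _ = _ := by ring
  have b3 : |H t - 2 / 3 * t⁻¹| ≤ 4 * K2 * t0 ^ (-(1 / 3) : ℝ) * t ^ (-(4 / 3) : ℝ) := by
    have h1 := h.abs_hubble_mul_sub_le ht0 hn ht
    have e1 : H t - 2 / 3 * t⁻¹ = 2 / 3 * t⁻¹ * (3 / 2 * t * H t - 1) := by field_simp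
    have e2 : t⁻¹ * t ^ (-(2 / 3) : ℝ) = t ^ (-(1 / 3) : ℝ) * t ^ (-(4 / 3) : ℝ) := by
      rw [← Real.rpow_neg_one, ← Real.rpow_add htp, ← Real.rpow_add htp]; norm_num
    have e3 : t ^ (-(1 / 3) : ℝ) ≤ t0 ^ (-(1 / 3) : ℝ) :=
      Real.rpow_le_rpow_of_nonpos ht0 ht (by norm_num)
    have hinv := inv_pos.2 htp
    rw [e1, abs_mul, abs_of_pos (by positivity : 0 < 2 / 3 * t⁻¹)]
    calc 2 / 3 * t⁻¹ * |3 / 2 * t * H t - 1|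
        ≤ 2 / 3 * t⁻¹ * (6 * K2 * t ^ (-(2 / 3) : ℝ)) :=
          mul_le_mul_of_nonneg_left h1 (by positivity)
      _ = 4 * K2 * (t⁻¹ * t ^ (-(2 / 3) : ℝ)) := by ring
      _ = 4 * K2 * t ^ (-(1 / 3) : ℝ) * t ^ (-(4 / 3) : ℝ) := by rw [e2]; ring
      _ ≤ _ := mul_le_mul_of_nonneg_right (mul_le_mul_of_nonneg_left e3 (by positivity))
          (by positivity)
  have := abs_add_le (θ t - H t) (H t - 2 / 3 * t⁻¹)
  rw [sub_add_sub_cancel] at this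
  linarith

end HasRoughDecay

/-- The logarithm of a minus (4/3) log t has derivative O(t^{-4/3}), so it converges at rate
t^{-1/3}. Exponentiating gives the limits e^L and e^{-L} for a and its inverse. -/
theorem exists_limit_of_expansion {t0 K : ℝ} (ht0 : 0 < t0) {a θ : ℝ → ℝ}
    (hpos : ∀ t, t0 ≤ t → 0 < a t)
    (ha : ∀ t, t0 ≤ t → HasDerivWithinAt a (2 * θ t * a t) (Ici t0) t)
    (hθ : ∀ t, t0 ≤ t → |θ t - 2 / 3 * t⁻¹| ≤ K * t ^ (-(4 / 3) : ℝ)) :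
    ∃ L : ℝ, (fun t => t ^ (-(4 / 3) : ℝ) * a t - Real.exp L)
        =O[atTop] (fun t : ℝ => t ^ (-(1 / 3) : ℝ)) ∧
      (fun t => t ^ (4 / 3 : ℝ) * (a t)⁻¹ - Real.exp (-L))
        =O[atTop] (fun t : ℝ => t ^ (-(1 / 3) : ℝ)) := by
  have hlim := exists_limit_of_abs_deriv_le (t0 := t0)
    (u := fun t => Real.log (a t) - 4 / 3 * Real.log t) (u' := fun t => 2 * (θ t - 2 / 3 * t⁻¹))
    (φ := fun t => 6 * K * t ^ (-(1 / 3) : ℝ)) (φ' := fun t => -(2 * K * t ^ (-(4 / 3) : ℝ)))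
    (fun t ht => ?_) (fun t ht => ?_) (fun t ht => ?_) ?_
  · obtain ⟨L, hL, hle⟩ := hlim
    have hO : (fun t => Real.log (a t) - 4 / 3 * Real.log t - L)
        =O[atTop] (fun t : ℝ => t ^ (-(1 / 3) : ℝ)) := by
      refine Asymptotics.IsBigO.of_bound (6 * K) ((eventually_ge_atTop t0).mono fun t ht => ?_)
      have htp : 0 < t := ht0.trans_le ht
      rw [Real.norm_eq_abs, Real.norm_of_nonneg (by positivity)]
      exact hle t ht
    -- Differentiability of exp at the limit transfers the rate of convergence.
    have hexp : ∀ (c : ℝ) (v : ℝ → ℝ), Tendsto v atTop (𝓝 c) →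
        (fun t => v t - c) =O[atTop] (fun t : ℝ => t ^ (-(1 / 3) : ℝ)) →
        (fun t => Real.exp (v t) - Real.exp c) =O[atTop] (fun t : ℝ => t ^ (-(1 / 3) : ℝ)) :=
      fun c v hv hvO =>
        ((Real.hasDerivAt_exp c).differentiableAt.isBigO_sub.comp_tendsto hv).trans hvO
    refine ⟨L, (hexp L _ hL hO).congr' ?_ EventuallyEq.rfl,
      (hexp (-L) _ hL.neg (hO.neg_left.congr_left fun t => by ring)).congr' ?_
        EventuallyEq.rfl⟩
    all_goals
      refine (eventually_ge_atTop t0).mono fun t ht => ?_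
      have htp : 0 < t := ht0.trans_le ht
      have hap := hpos t ht
      simp only
    · rw [Real.exp_sub, Real.exp_log hap, mul_comm (4 / 3 : ℝ), Real.exp_mul, Real.exp_log htp,
        Real.rpow_neg htp.le]
      ring
    · rw [neg_sub, Real.exp_sub, Real.exp_log hap, mul_comm (4 / 3 : ℝ), Real.exp_mul,
        Real.exp_log htp]
      ring
  · have htp : 0 < t := ht0.trans_le ht
    have hap := (hpos t ht).ne'
    refine (((ha t ht).log hap).sub
      (((Real.hasDerivAt_log htp.ne').const_mul (4 / 3)).hasDerivWithinAt)).congr_deriv ?_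
    field_simp
    ring
  · have htp : 0 < t := ht0.trans_le ht
    refine (((Real.hasDerivAt_rpow_const (p := -(1 / 3)) (Or.inl htp.ne')).const_mul
      (6 * K)).hasDerivWithinAt).congr_deriv ?_
    rw [show -(1 / 3 : ℝ) - 1 = -(4 / 3) by norm_num]
    ring
  · rw [neg_neg, abs_mul, abs_two]
    linarith [hθ t ht]
  · have := (tendsto_rpow_neg_atTop (by norm_num : (0 : ℝ) < 1 / 3)).const_mul (6 * K)
    rwa [mul_zero] at this

/-! ### The Weyl parameter -/

/-- The square of the Weyl parameter in terms of the normalised variables. -/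
noncomputable def weylSq (σ x y m : ℝ) : ℝ :=
  (σ * (1 + σ) + 2 * y ^ 2 - x ^ 2) ^ 2 + 9 * x ^ 2 * y ^ 2
    + 4 * m⁻¹ ^ 2 * ((y + 1 / 2 * m * (1 - 2 * σ) * x) ^ 2 + (x + 3 / 2 * m * σ * y) ^ 2)

/-- The double-angle formulas leave ψ only in the products X cos ψ and X sin ψ, so the fast angle
disappears and the choice of ψ at X = 0 is immaterial. -/
theorem weylParam_eq (g k : Matrix (Fin 3) (Fin 3) ℝ) : weylParam g k =
    Real.sqrt (weylSq (sigmaPlus g k) (sigmaMinus g k) (nMinus g k) (varM g k)) := by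
  rw [weylParam, weylSq, weylEPlus, weylEMinus, weylHPlus, weylHMinus]
  congr 1
  rw [Real.cos_two_mul, Real.sin_two_mul, ← varX_mul_cos, ← varX_mul_sin]
  have h1 := Real.sin_sq_add_cos_sq (varPsi g k)
  have h2 : Real.sin (varPsi g k) ^ 2 = 1 - Real.cos (varPsi g k) ^ 2 := by linarith
  have e1 : sigmaPlus g k * (1 + sigmaPlus g k) + 1 / 2 * varX g k ^ 2 *
      (1 - 3 * (2 * Real.cos (varPsi g k) ^ 2 - 1)) = sigmaPlus g k * (1 + sigmaPlus g k) +
      2 * (varX g k * Real.sin (varPsi g k)) ^ 2 - (varX g k * Real.cos (varPsi g k)) ^ 2 := by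
    rw [mul_pow, h2]
    ring
  rw [e1]
  simp only [div_eq_mul_inv]
  ring

/-- The leading part of a quarter of the squared Weyl parameter. -/
noncomputable def weylLead (x y m : ℝ) : ℝ := oscEnergy x y m * m⁻¹ ^ 2

/-- The derivative of `weylLead`. -/
noncomputable def weylLeadDeriv (σ x y m : ℝ) (s : Fin 3 → ℝ) : ℝ :=
  m⁻¹ ^ 2 * (oscRemainder σ x y m s +
    oscEnergy x y m * (2 * (decel σ x y s - 1 / 2) + 4 * σ + 12 * m * x * y))

/-- The rate -1 of `oscEnergy` cancels the rate 2q ≈ 1 of m⁻², so only higher-order terms remain. -/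
theorem IsReduced.deriv_weylLead {J : Set ℝ} {H τ σ x y m : ℝ → ℝ} {s : ℝ → Fin 3 → ℝ}
    (h : IsReduced J H τ σ x y m s) {t : ℝ} (ht : t ∈ J) :
    HasDerivWithinAt (fun t => weylLead (x t) (y t) (m t))
      (H t * weylLeadDeriv (σ t) (x t) (y t) (m t) (s t)) J t := by
  refine ((h.deriv_oscEnergy ht).mul ((h.deriv_inv_m ht).pow 2)).congr_deriv ?_
  rw [weylLeadDeriv]
  simp only [Pi.pow_apply]
  push_cast
  ring

section Pointwise

variable {σ x y m p : ℝ} {s : Fin 3 → ℝ}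

theorem sq_le_two_mul_oscEnergy (hm : 0 ≤ m) (hm1 : m ≤ 1) :
    x ^ 2 + y ^ 2 ≤ 2 * oscEnergy x y m := by
  have := (abs_le.1 (abs_oscEnergy_sub_le (x := x) (y := y) hm)).1
  nlinarith [mul_le_mul_of_nonneg_right hm1 (by positivity : 0 ≤ x ^ 2 + y ^ 2)]

theorem weylLead_nonneg (hm : 0 ≤ m) (hm1 : m ≤ 1) : 0 ≤ weylLead x y m := by
  have := sq_le_two_mul_oscEnergy (x := x) (y := y) hm hm1
  exact mul_nonneg (by nlinarith [sq_nonneg x, sq_nonneg y]) (sq_nonneg _)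

/-- Geometric errors are multiples of the quantity itself. The matter term is kept as a product
whose first factor is controlled by the square root of `weylLead` (`inv_mul_abs_sq_le`). -/
theorem abs_weylLeadDeriv_le (hm : 0 ≤ m) (hm1 : m ≤ 1) (hx : x ^ 2 + y ^ 2 ≤ 1) :
    |weylLeadDeriv σ x y m s| ≤
      (8 * |decel σ x y s - 1 / 2| + 10 * m + 12 * |σ|) * weylLead x y m
        + m⁻¹ * |2 * x + m * y| * (m⁻¹ * |Real.sqrt 3 / 2 * (s 1 - s 2)|) := by
  have h1 := abs_oscRemainder_sub_le (σ := σ) (s := s) hm hm1 hx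
  have h2 := sq_le_two_mul_oscEnergy (x := x) (y := y) hm hm1
  set z := Real.sqrt 3 / 2 * (s 1 - s 2)
  set e := decel σ x y s - 1 / 2
  set Y := oscEnergy x y m with hY
  have hA : 0 ≤ x ^ 2 + y ^ 2 := by positivity
  have hY0 : 0 ≤ Y := by linarith
  have h3 : |oscRemainder σ x y m s| ≤
      (3 * |e| + 2 * m + 4 * |σ|) * (2 * Y) + |2 * x + m * y| * |z| := by
    have a1 := abs_add_le (oscRemainder σ x y m s - (2 * x + m * y) * z) ((2 * x + m * y) * z)
    rw [sub_add_cancel, abs_mul (2 * x + m * y)] at a1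
    have a2 := mul_le_mul_of_nonneg_left h2 (by positivity : 0 ≤ 3 * |e| + 2 * m + 4 * |σ|)
    linarith
  have h4 : |2 * e + 4 * σ + 12 * m * x * y| ≤ 2 * |e| + 4 * |σ| + 6 * m := by
    have a1 := abs_add_three (2 * e) (4 * σ) (12 * m * x * y)
    have a2 : |12 * m * x * y| ≤ 6 * m := by
      rw [show 12 * m * x * y = 12 * m * (x * y) by ring, abs_mul,
        abs_of_nonneg (by positivity : 0 ≤ 12 * m)]
      have := abs_mul_le_half_sq x y
      nlinarith
    rw [abs_mul, abs_mul, abs_two, abs_of_pos (by norm_num : (0 : ℝ) < 4)] at a1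
    linarith
  have h5 : |oscRemainder σ x y m s + Y * (2 * e + 4 * σ + 12 * m * x * y)| ≤
      (8 * |e| + 10 * m + 12 * |σ|) * Y + |2 * x + m * y| * |z| := by
    have a1 := abs_add_le (oscRemainder σ x y m s) (Y * (2 * e + 4 * σ + 12 * m * x * y))
    rw [abs_mul Y, abs_of_nonneg hY0] at a1
    have a2 := mul_le_mul_of_nonneg_left h4 hY0
    linarith
  rw [weylLeadDeriv, abs_mul, abs_of_nonneg (sq_nonneg m⁻¹)]
  calc m⁻¹ ^ 2 * |oscRemainder σ x y m s + Y * (2 * e + 4 * σ + 12 * m * x * y)|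
      ≤ m⁻¹ ^ 2 * ((8 * |e| + 10 * m + 12 * |σ|) * Y + |2 * x + m * y| * |z|) :=
        mul_le_mul_of_nonneg_left h5 (sq_nonneg _)
    _ = _ := by rw [weylLead, ← hY]; ring

theorem inv_mul_abs_sq_le (hm : 0 ≤ m) (hm1 : m ≤ 1) :
    (m⁻¹ * |2 * x + m * y|) ^ 2 ≤ 10 * weylLead x y m := by
  rw [mul_pow, sq_abs, weylLead]
  have h1 := sq_two_mul_add_le (x := x) (y := y) hm hm1
  have h2 := sq_le_two_mul_oscEnergy (x := x) (y := y) hm hm1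
  nlinarith [mul_le_mul_of_nonneg_left (h1.trans (mul_le_mul_of_nonneg_left h2
    (by norm_num : (0 : ℝ) ≤ 5))) (sq_nonneg m⁻¹)]

/-- The cross term mxy of `oscEnergy` is, up to σ, the one produced by ℰ_-² + ℋ_-². No term in m⁻²
is left and m⁻¹ appears only together with σxy. -/
theorem weylSq_sub_eq (hm : m ≠ 0) : weylSq σ x y m - 4 * weylLead x y m =
    4 * σ * (x * y) * m⁻¹ + (1 - 2 * σ) ^ 2 * x ^ 2 + 9 * σ ^ 2 * y ^ 2
      + (σ * (1 + σ) + 2 * y ^ 2 - x ^ 2) ^ 2 + 9 * x ^ 2 * y ^ 2 := by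
  rw [weylSq, weylLead, oscEnergy]
  field_simp
  ring

end Pointwise

namespace HasRoughDecay

variable {t0 P0 : ℝ} {H τ σ x y m : ℝ → ℝ} {s : ℝ → Fin 3 → ℝ}

theorem m_le_one (h : HasRoughDecay t0 H τ σ x y m s) {t : ℝ} (ht : t0 ≤ t) : m t ≤ 1 := by
  have h1 := h.m_le t ht
  have h2 := h.exp_neg_le_one ht (c := 2 / 5) (by norm_num)
  linarith

theorem xy_le_one (h : HasRoughDecay t0 H τ σ x y m s) {t : ℝ} (ht : t0 ≤ t) :
    x t ^ 2 + y t ^ 2 ≤ 1 := by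
  have h1 := h.xy t ht
  have h2 := h.exp_neg_le_one ht (c := 4 / 5) (by norm_num)
  linarith

/-- A Gronwall argument from below. With E = e^{-2τ/5}, τ counted from the initial time, the
derivative of B = `weylLead` is at least -2EB - Q e^{-2τ}. Hence B e^{-5E} - Q e^{-2τ} is
nondecreasing, and its initial value is positive once P0² is small compared with x² + y². -/
theorem weylLead_pos_bound (h : HasRoughDecay t0 H τ σ x y m s)
    (hs : ∀ t, t0 ≤ t → ∀ i, s t i ≤ P0 * Real.exp (-(9 / 5) * (τ t - τ t0)))
    (hP : P0 ^ 2 ≤ 1 / 100000 * (x t0 ^ 2 + y t0 ^ 2)) (hx : 0 < x t0 ^ 2 + y t0 ^ 2) :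
    ∃ b, 0 < b ∧ ∀ t, t0 ≤ t → b ≤ weylLead (x t) (y t) (m t) := by
  have hm0 := h.reduced.m_pos t0 self_mem_Ici
  have hE : ∀ c : ℝ, ∀ t, t0 ≤ t → HasDerivWithinAt (fun t => Real.exp (-c * (τ t - τ t0)))
      (H t * (-c * Real.exp (-c * (τ t - τ t0)))) (Ici t0) t := fun c t ht =>
    ((((h.reduced.deriv_time t ht).sub_const (τ t0)).const_mul (-c)).exp).congr_deriv (by ring)
  set N := (m t0)⁻¹ with hN
  have hN0 : 0 < N := inv_pos.2 hm0
  -- The constant is 9 · 5/2: the square of the factor 3 in `inv_m_le`, and the weight in Young's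
  -- inequality below.
  set Q := 45 / 2 * (N * P0) ^ 2 with hQ
  have hQ0 : 0 ≤ Q := by positivity
  refine ⟨weylLead (x t0) (y t0) (m t0) * Real.exp (-5) - Q, ?_, fun t ht => ?_⟩
  · have h1 := sq_le_two_mul_oscEnergy (x := x t0) (y := y t0) hm0.le (h.m_le_one le_rfl)
    -- From e < 3. Then 1/486 exceeds (45/2)/100000, which is what positivity requires.
    have h2 : (1 : ℝ) / 243 < Real.exp (-5) := by
      rw [Real.exp_neg, one_div]
      refine inv_strictAnti₀ (Real.exp_pos _) ?_
      have : Real.exp 5 = Real.exp 1 ^ 5 := by rw [← Real.exp_nat_mul]; norm_num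
      rw [this, show (243 : ℝ) = 3 ^ 5 by norm_num]
      exact pow_lt_pow_left₀ (by linarith [Real.exp_one_lt_d9]) (Real.exp_pos _).le (by norm_num)
    have h3 : 1 / 243 * (1 / 2 * (x t0 ^ 2 + y t0 ^ 2)) ≤
        Real.exp (-5) * oscEnergy (x t0) (y t0) (m t0) :=
      mul_le_mul h2.le (by linarith) (by positivity) (Real.exp_pos _).le
    have h4 : weylLead (x t0) (y t0) (m t0) * Real.exp (-5) - Q =
        N ^ 2 * (Real.exp (-5) * oscEnergy (x t0) (y t0) (m t0) - 45 / 2 * P0 ^ 2) := by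
      rw [weylLead, hQ]; ring
    rw [h4]
    exact mul_pos (by positivity) (by linarith)
  · have h1 := le_of_hasDerivWithinAt_nonneg ht
      (u := fun t => weylLead (x t) (y t) (m t) *
        Real.exp (-(5 * Real.exp (-(2 / 5) * (τ t - τ t0)))) - Q * Real.exp (-2 * (τ t - τ t0)))
      (fun r hr => (((h.reduced.deriv_weylLead (t := r) hr.1).mul
        (((hE (2 / 5) r hr.1).const_mul 5).neg.exp)).sub ((hE 2 r hr.1).const_mul Q)).mono
        Icc_subset_Ici_self) fun r hr => ?_
    · simp only [sub_self, mul_zero, Real.exp_zero, mul_one] at h1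
      have h2 : Real.exp (-(5 * Real.exp (-(2 / 5) * (τ t - τ t0)))) ≤ 1 :=
        Real.exp_le_one_iff.2 (by have := Real.exp_pos (-(2 / 5) * (τ t - τ t0)); linarith)
      have h3 := weylLead_nonneg (x := x t) (y := y t) (h.reduced.m_pos t ht).le (h.m_le_one ht)
      have h4 : 0 ≤ Q * Real.exp (-2 * (τ t - τ t0)) := by positivity
      nlinarith
    · have hH := h.reduced.hubble_pos r hr.1
      have hm := h.reduced.m_pos r hr.1
      have d1 := (abs_le.1 (abs_weylLeadDeriv_le (σ := σ r) (s := s r) hm.le (h.m_le_one hr.1)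
        (h.xy_le_one hr.1))).1
      have d2 := inv_mul_abs_sq_le (x := x r) (y := y r) hm.le (h.m_le_one hr.1)
      have d3 := abs_stress_diff_le (p := P0 * Real.exp (-(9 / 5) * (τ r - τ t0)))
        fun i => ⟨(h.stress r hr.1 i).1, hs r hr.1 i⟩
      have d4 := h.inv_m_le hr.1
      have hB := weylLead_nonneg (x := x r) (y := y r) hm.le (h.m_le_one hr.1)
      set B := weylLead (x r) (y r) (m r) with hBd
      set E := Real.exp (-(2 / 5) * (τ r - τ t0)) with hEd
      have hE0 : 0 < E := Real.exp_pos _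
      have k1 : 8 * |decel (σ r) (x r) (y r) (s r) - 1 / 2| + 10 * m r + 12 * |σ r| ≤ E := by
        have a1 := h.abs_decel_le hr.1
        have a2 := h.sigma r hr.1
        have a3 := h.m_le r hr.1
        have a4 := h.exp_neg_le_exp_neg hr.1 (c := 2 / 5) (d := 4 / 5) (by norm_num)
        linarith
      have k2 : (m r)⁻¹ * |Real.sqrt 3 / 2 * (s r 1 - s r 2)| ≤
          3 * (N * P0) * Real.exp (-(13 / 10) * (τ r - τ t0)) := by
        have : Real.exp (-(13 / 10) * (τ r - τ t0)) = Real.exp (1 / 2 * (τ r - τ t0)) *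
            Real.exp (-(9 / 5) * (τ r - τ t0)) := by rw [← Real.exp_add]; ring_nf
        rw [this]
        calc _ ≤ 3 * N * Real.exp (1 / 2 * (τ r - τ t0)) *
              (P0 * Real.exp (-(9 / 5) * (τ r - τ t0))) :=
              mul_le_mul d4 d3 (abs_nonneg _) (by positivity)
          _ = _ := by ring
      set v := (m r)⁻¹ * |2 * x r + m r * y r| with hv
      have hv0 : 0 ≤ v := mul_nonneg (inv_pos.2 hm).le (abs_nonneg _)
      set w := (m r)⁻¹ * |Real.sqrt 3 / 2 * (s r 1 - s r 2)| with hw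
      have hw0 : 0 ≤ w := mul_nonneg (inv_pos.2 hm).le (abs_nonneg _)
      have k3 : w ^ 2 ≤ 9 * (N * P0) ^ 2 * (E * Real.exp (-2 * (τ r - τ t0))) := by
        have e1 : E * Real.exp (-2 * (τ r - τ t0)) ≥
            Real.exp (-(13 / 10) * (τ r - τ t0)) ^ 2 := by
          rw [hEd, ← Real.exp_add, ← Real.exp_nat_mul]
          exact Real.exp_le_exp.2 (by push_cast; linarith [h.time_le hr.1])
        calc w ^ 2 ≤ (3 * (N * P0) * Real.exp (-(13 / 10) * (τ r - τ t0))) ^ 2 :=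
              pow_le_pow_left₀ hw0 k2 2
          _ = 9 * (N * P0) ^ 2 * Real.exp (-(13 / 10) * (τ r - τ t0)) ^ 2 := by ring
          _ ≤ _ := mul_le_mul_of_nonneg_left e1 (by positivity)
      -- Young's inequality after multiplication by E, using v² ≤ 10B. It is possible because w²
      -- carries a spare factor E; the price is a second E B, which the weight e^{-5E} also absorbs.
      have k4 : v * w ≤ E * B + Q * Real.exp (-2 * (τ r - τ t0)) := by
        have a1 : E * (v * w) ≤ E * (E * B + Q * Real.exp (-2 * (τ r - τ t0))) := by
          have a2 : 0 ≤ (E * v - 5 * w) ^ 2 := sq_nonneg _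
          have a3 : E ^ 2 * v ^ 2 ≤ E ^ 2 * (10 * B) :=
            mul_le_mul_of_nonneg_left d2 (sq_nonneg E)
          rw [hQ]
          nlinarith
        exact le_of_mul_le_mul_left a1 hE0
      have k5 : -(Q * Real.exp (-2 * (τ r - τ t0))) ≤
          weylLeadDeriv (σ r) (x r) (y r) (m r) (s r) + 2 * E * B := by
        have := mul_le_mul_of_nonneg_right k1 hB
        linarith
      have k6 : Real.exp (-(5 * E)) ≤ 1 := Real.exp_le_one_iff.2 (by linarith)
      have k7 := Real.exp_pos (-(5 * E))
      have k8 : 0 ≤ Q * Real.exp (-2 * (τ r - τ t0)) := by positivity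
      have k9 : 0 ≤ Real.exp (-(5 * E)) * (weylLeadDeriv (σ r) (x r) (y r) (m r) (s r) +
          2 * E * B) + 2 * (Q * Real.exp (-2 * (τ r - τ t0))) := by
        have := mul_le_mul_of_nonneg_left k5 k7.le
        nlinarith
      refine (mul_nonneg hH.le k9).trans_eq ?_
      simp only [Pi.neg_apply]
      ring

/-- The square root is estimated directly: a rate for B alone would be halved on taking roots if the
limit were zero. Adding e^{-τ} makes the root differentiable where B vanishes and changes it only by
O(e^{-τ/2}); dividing by 2D then absorbs the matter term. -/
theorem exists_limit_weylLead (h : HasRoughDecay t0 H τ σ x y m s) (ht0 : 0 < t0)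
    (hn : t0 = 2 / 3 * (H t0)⁻¹)
    (hs : ∀ t, t0 ≤ t → ∀ i, s t i ≤ Real.exp (-2 * (τ t - τ t0))) :
    ∃ L c : ℝ, 0 ≤ L ∧ (∀ t, t0 ≤ t →
      |Real.sqrt (weylLead (x t) (y t) (m t) + Real.exp (-1 * (τ t - τ t0))) - L| ≤
        c * Real.exp (-(1 / 2) * (τ t - τ t0))) ∧
      Tendsto (fun t => Real.sqrt (weylLead (x t) (y t) (m t) +
        Real.exp (-1 * (τ t - τ t0)))) atTop (𝓝 L) := by
  have hm0 := h.reduced.m_pos t0 self_mem_Ici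
  have hE : ∀ c : ℝ, ∀ t, t0 ≤ t → HasDerivWithinAt (fun t => Real.exp (-c * (τ t - τ t0)))
      (H t * (-c * Real.exp (-c * (τ t - τ t0)))) (Ici t0) t := fun c t ht =>
    ((((h.reduced.deriv_time t ht).sub_const (τ t0)).const_mul (-c)).exp).congr_deriv (by ring)
  set N := (m t0)⁻¹ with hN
  have hN0 : 0 < N := inv_pos.2 hm0
  set D : ℝ → ℝ := fun t =>
    Real.sqrt (weylLead (x t) (y t) (m t) + Real.exp (-1 * (τ t - τ t0))) with hD
  have hB : ∀ t, t0 ≤ t → 0 ≤ weylLead (x t) (y t) (m t) := fun t ht =>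
    weylLead_nonneg (h.reduced.m_pos t ht).le (h.m_le_one ht)
  have hpos : ∀ t, t0 ≤ t → 0 < weylLead (x t) (y t) (m t) + Real.exp (-1 * (τ t - τ t0)) :=
    fun t ht => add_pos_of_nonneg_of_pos (hB t ht) (Real.exp_pos _)
  have hDsq : ∀ t, t0 ≤ t → D t ^ 2 = weylLead (x t) (y t) (m t) +
      Real.exp (-1 * (τ t - τ t0)) := fun t ht => Real.sq_sqrt (hpos t ht).le
  have hDpos : ∀ t, t0 ≤ t → 0 < D t := fun t ht => Real.sqrt_pos.2 (hpos t ht)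
  have hEsq : ∀ t, Real.exp (-(1 / 2) * (τ t - τ t0)) ^ 2 = Real.exp (-1 * (τ t - τ t0)) :=
    fun t => by rw [← Real.exp_nat_mul]; congr 1; push_cast; ring
  have hDE : ∀ t, t0 ≤ t → Real.exp (-(1 / 2) * (τ t - τ t0)) ≤ D t := fun t ht =>
    Real.le_sqrt_of_sq_le (by rw [hEsq]; linarith [hB t ht])
  have hDmax : ∀ t, t0 ≤ t → D t ≤ 1 + 18 * N ^ 2 := fun t ht => by
    refine Real.sqrt_le_iff.2 ⟨by positivity, ?_⟩
    have hm := h.reduced.m_pos t ht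
    have a1 := h.inv_m_le ht
    have a2 := h.xy_le_sharp ht
    have a3 := (abs_le.1 (abs_oscEnergy_sub_le (x := x t) (y := y t) hm.le)).2
    have a4 := mul_le_mul_of_nonneg_right (h.m_le_one ht)
      (by positivity : 0 ≤ x t ^ 2 + y t ^ 2)
    have a5 := h.exp_neg_le_one ht (c := 1) (by norm_num)
    have a6 : oscEnergy (x t) (y t) (m t) ≤ 2 * Real.exp (-1 * (τ t - τ t0)) := by
      linarith [Real.exp_pos (-1 * (τ t - τ t0))]
    have a7 : (m t)⁻¹ ^ 2 ≤ (3 * N * Real.exp (1 / 2 * (τ t - τ t0))) ^ 2 :=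
      pow_le_pow_left₀ (inv_pos.2 hm).le a1 2
    have a8 : Real.exp (1 / 2 * (τ t - τ t0)) ^ 2 * Real.exp (-1 * (τ t - τ t0)) = 1 := by
      rw [← Real.exp_nat_mul, ← Real.exp_add, Real.exp_eq_one_iff]; push_cast; ring
    have a9 : weylLead (x t) (y t) (m t) ≤ 18 * N ^ 2 := by
      calc weylLead (x t) (y t) (m t) ≤ 2 * Real.exp (-1 * (τ t - τ t0)) *
            (3 * N * Real.exp (1 / 2 * (τ t - τ t0))) ^ 2 :=
            mul_le_mul a6 a7 (sq_nonneg _) (by positivity)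
        _ = 18 * N ^ 2 * (Real.exp (1 / 2 * (τ t - τ t0)) ^ 2 *
            Real.exp (-1 * (τ t - τ t0))) := by ring
        _ = _ := by rw [a8, mul_one]
    nlinarith [sq_nonneg N, sq_nonneg (N ^ 2)]
  -- The coefficient 101 is 8 · 2 + 10 · (1/10) + 12 · 7, from the sharp bounds on q, m and σ. The
  -- factor 1 + 18N² bounds D, and the last two terms cover the matter and the regularisation.
  set c := 101 * (1 + 18 * N ^ 2) + 6 * N + 1 with hc
  have hc0 : 0 < c := by positivity
  have hlim := exists_limit_of_abs_deriv_le (t0 := t0) (u := D)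
    (u' := fun t => H t * ((weylLeadDeriv (σ t) (x t) (y t) (m t) (s t) -
      Real.exp (-1 * (τ t - τ t0))) / (2 * D t)))
    (φ := fun t => 2 * c * Real.exp (-(1 / 2) * (τ t - τ t0)))
    (φ' := fun t => 2 * c * (H t * (-(1 / 2) * Real.exp (-(1 / 2) * (τ t - τ t0)))))
    (fun t ht => ?_) (fun t ht => (hE (1 / 2) t ht).const_mul (2 * c)) (fun t ht => ?_) ?_
  · obtain ⟨L, hL, hle⟩ := hlim
    exact ⟨L, 2 * c, ge_of_tendsto' hL fun t => Real.sqrt_nonneg _, hle, hL⟩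
  · refine (((h.reduced.deriv_weylLead (t := t) ht).add (hE 1 t ht)).sqrt
      (hpos t ht).ne').congr_deriv ?_
    simp only [hD, Pi.add_apply]
    ring
  · have hH := h.reduced.hubble_pos t ht
    have hm := h.reduced.m_pos t ht
    have d1 := abs_weylLeadDeriv_le (σ := σ t) (s := s t) hm.le (h.m_le_one ht) (h.xy_le_one ht)
    have d2 := inv_mul_abs_sq_le (x := x t) (y := y t) hm.le (h.m_le_one ht)
    have d3 := abs_stress_diff_le (p := Real.exp (-2 * (τ t - τ t0)))
      fun i => ⟨(h.stress t ht i).1, hs t ht i⟩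
    have d4 := h.inv_m_le ht
    have hDt := hDpos t ht
    have e1 := hDE t ht
    have e2 := hDmax t ht
    have e3 := hDsq t ht
    have hBt := hB t ht
    set E := Real.exp (-(1 / 2) * (τ t - τ t0)) with hEd
    have hE0 : 0 < E := Real.exp_pos _
    have k1 : 8 * |decel (σ t) (x t) (y t) (s t) - 1 / 2| + 10 * m t + 12 * |σ t| ≤ 101 * E := by
      have a1 := h.abs_decel_le_sharp ht
      have a2 := h.abs_sigma_le_sharp ht
      have a3 := h.m_le_sharp ht
      have a4 := h.exp_neg_le_exp_neg ht (c := 1 / 2) (d := 1) (by norm_num)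
      linarith
    have k2 : (m t)⁻¹ * |Real.sqrt 3 / 2 * (s t 1 - s t 2)| ≤ 3 * N * E := by
      have a1 : Real.exp (1 / 2 * (τ t - τ t0)) * Real.exp (-2 * (τ t - τ t0)) ≤ E := by
        rw [hEd, ← Real.exp_add]
        exact Real.exp_le_exp.2 (by linarith [h.time_le ht])
      calc _ ≤ 3 * N * Real.exp (1 / 2 * (τ t - τ t0)) * Real.exp (-2 * (τ t - τ t0)) :=
            mul_le_mul d4 d3 (abs_nonneg _) (by positivity)
        _ = 3 * N * (Real.exp (1 / 2 * (τ t - τ t0)) * Real.exp (-2 * (τ t - τ t0))) := by ring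
        _ ≤ _ := mul_le_mul_of_nonneg_left a1 (by positivity)
    have k3 : (m t)⁻¹ * |2 * x t + m t * y t| ≤ 4 * D t := by
      refine (abs_le_of_sq_le_sq' ?_ (by positivity)).2
      rw [mul_pow 4 (D t), e3]
      nlinarith [Real.exp_pos (-1 * (τ t - τ t0))]
    have k4 : |weylLeadDeriv (σ t) (x t) (y t) (m t) (s t) - Real.exp (-1 * (τ t - τ t0))| ≤
        c * E * (2 * D t) := by
      have b1 := abs_sub (weylLeadDeriv (σ t) (x t) (y t) (m t) (s t))
        (Real.exp (-1 * (τ t - τ t0)))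
      rw [abs_of_pos (Real.exp_pos (-1 * (τ t - τ t0)))] at b1
      have b2 : (8 * |decel (σ t) (x t) (y t) (s t) - 1 / 2| + 10 * m t + 12 * |σ t|) *
          weylLead (x t) (y t) (m t) ≤ 101 * E * ((1 + 18 * N ^ 2) * D t) := by
        refine mul_le_mul k1 ?_ hBt (by positivity)
        have := mul_le_mul_of_nonneg_right e2 hDt.le
        nlinarith [Real.exp_pos (-1 * (τ t - τ t0))]
      have b3 : (m t)⁻¹ * |2 * x t + m t * y t| *
          ((m t)⁻¹ * |Real.sqrt 3 / 2 * (s t 1 - s t 2)|) ≤ 4 * D t * (3 * N * E) :=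
        mul_le_mul k3 k2 (mul_nonneg (inv_pos.2 hm).le (abs_nonneg _)) (by positivity)
      have b4 : Real.exp (-1 * (τ t - τ t0)) ≤ E * D t := by
        rw [← hEsq, ← hEd, sq]
        exact mul_le_mul_of_nonneg_left e1 hE0.le
      have b5 : 0 ≤ E * D t := by positivity
      have b6 : 0 ≤ E * ((1 + 18 * N ^ 2) * D t) := by positivity
      rw [hc]
      nlinarith
    rw [abs_mul, abs_of_pos hH, abs_div, abs_of_pos (by positivity : 0 < 2 * D t)]
    have k5 := (div_le_iff₀ (by positivity : 0 < 2 * D t)).2 k4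
    have := mul_le_mul_of_nonneg_left k5 hH.le
    linarith
  · have := (h.tendsto_time ht0 hn (c := 1 / 2) (by norm_num)).const_mul (2 * c)
    rwa [mul_zero] at this

theorem abs_weylSq_sub_le (h : HasRoughDecay t0 H τ σ x y m s) {t : ℝ} (ht : t0 ≤ t) :
    |weylSq (σ t) (x t) (y t) (m t) - 4 * weylLead (x t) (y t) (m t)| ≤
      (42 * (m t0)⁻¹ + 270) * Real.exp (-1 * (τ t - τ t0)) := by
  have hm := h.reduced.m_pos t ht
  have hm0 := h.reduced.m_pos t0 self_mem_Ici
  have a1 := h.inv_m_le ht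
  have a2 := h.xy_le_sharp ht
  have a3 := h.abs_sigma_le_sharp ht
  have a4 : |σ t| ≤ 1 / 100 := by
    have := h.sigma t ht
    have := h.exp_neg_le_one ht (c := 4 / 5) (by norm_num)
    linarith
  have a5 := h.exp_neg_le_one ht (c := 1) (by norm_num)
  have a6 := abs_mul_le_half_sq (x t) (y t)
  set E := Real.exp (-1 * (τ t - τ t0)) with hE
  have hE0 : 0 < E := Real.exp_pos _
  have hEh : Real.exp (1 / 2 * (τ t - τ t0)) * E ≤ 1 := by
    rw [hE, ← Real.exp_add]
    exact Real.exp_le_one_iff.2 (by linarith [h.time_le ht])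
  obtain ⟨l4, u4⟩ := abs_le.1 a4
  have hx2 := sq_nonneg (x t)
  have hy2 := sq_nonneg (y t)
  have b1 : |4 * σ t * (x t * y t) * (m t)⁻¹| ≤ 42 * (m t0)⁻¹ * E := by
    rw [abs_mul, abs_mul, abs_mul, abs_of_pos (inv_pos.2 hm),
      abs_of_pos (by norm_num : (0 : ℝ) < 4)]
    calc 4 * |σ t| * |x t * y t| * (m t)⁻¹
        ≤ 4 * (7 * E) * (E / 2) * (3 * (m t0)⁻¹ * Real.exp (1 / 2 * (τ t - τ t0))) := by
          refine mul_le_mul (mul_le_mul (by linarith) (by linarith) (abs_nonneg _)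
            (by positivity)) a1 (inv_pos.2 hm).le (by positivity)
      _ = 42 * (m t0)⁻¹ * E * (Real.exp (1 / 2 * (τ t - τ t0)) * E) := by ring
      _ ≤ 42 * (m t0)⁻¹ * E * 1 := mul_le_mul_of_nonneg_left hEh (by positivity)
      _ = _ := mul_one _
  have b2 : (1 - 2 * σ t) ^ 2 * x t ^ 2 ≤ 4 * E := by
    have : (1 - 2 * σ t) ^ 2 ≤ 4 := by nlinarith
    exact mul_le_mul this (by linarith) hx2 (by norm_num)
  have b3 : 9 * σ t ^ 2 * y t ^ 2 ≤ 1 * E := by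
    have : 9 * σ t ^ 2 ≤ 1 := by nlinarith
    exact mul_le_mul this (by linarith) hy2 (by norm_num)
  have b4 : (σ t * (1 + σ t) + 2 * y t ^ 2 - x t ^ 2) ^ 2 ≤ 256 * E := by
    have c1 : |σ t * (1 + σ t)| ≤ 14 * E := by
      rw [abs_mul]
      have : |1 + σ t| ≤ 2 := abs_le.2 ⟨by linarith, by linarith⟩
      nlinarith [abs_nonneg (σ t), abs_nonneg (1 + σ t)]
    obtain ⟨c2, c3⟩ := abs_le.1 c1
    have c4 : |σ t * (1 + σ t) + 2 * y t ^ 2 - x t ^ 2| ≤ 16 * E :=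
      abs_le.2 ⟨by linarith, by linarith⟩
    have c5 := pow_le_pow_left₀ (abs_nonneg _) c4 2
    rw [sq_abs] at c5
    nlinarith
  have b5 : 9 * x t ^ 2 * y t ^ 2 ≤ 9 * E := by
    have : y t ^ 2 ≤ 1 := by linarith
    nlinarith
  rw [weylSq_sub_eq hm.ne']
  obtain ⟨l1, u1⟩ := abs_le.1 b1
  have p1 : 0 ≤ (1 - 2 * σ t) ^ 2 * x t ^ 2 := by positivity
  have p2 : 0 ≤ 9 * σ t ^ 2 * y t ^ 2 := by positivity
  have p3 : 0 ≤ 9 * x t ^ 2 * y t ^ 2 := by positivity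
  have p4 := sq_nonneg (σ t * (1 + σ t) + 2 * y t ^ 2 - x t ^ 2)
  rw [abs_le]
  constructor <;> linarith

/-- The Weyl parameter converges at the rate `e^{-τ/2}`. -/
theorem exists_limit_sqrt_weylSq (h : HasRoughDecay t0 H τ σ x y m s) (ht0 : 0 < t0)
    (hn : t0 = 2 / 3 * (H t0)⁻¹)
    (hs : ∀ t, t0 ≤ t → ∀ i, s t i ≤ Real.exp (-2 * (τ t - τ t0))) :
    ∃ C c : ℝ, 0 ≤ C ∧ (∀ t, t0 ≤ t → |Real.sqrt (weylSq (σ t) (x t) (y t) (m t)) - C| ≤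
      c * Real.exp (-(1 / 2) * (τ t - τ t0))) ∧
      ∀ b, 0 < b → (∀ t, t0 ≤ t → b ≤ weylLead (x t) (y t) (m t)) → 0 < C := by
  obtain ⟨L, c, hL0, hL, hlim⟩ := h.exists_limit_weylLead ht0 hn hs
  have hm0 := h.reduced.m_pos t0 self_mem_Ici
  -- The extra 4 accounts for the added exponential in D, since 4D² exceeds 4 `weylLead` by 4e^{-τ}.
  set c2 := 42 * (m t0)⁻¹ + 270 + 4 with hc2
  have hc20 : 0 < c2 := by have := inv_pos.2 hm0; positivity
  refine ⟨2 * L, Real.sqrt c2 + 2 * c, by positivity, fun t ht => ?_, fun b hb hbt => ?_⟩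
  · have h1 := hL t ht
    have h2 := h.abs_weylSq_sub_le ht
    have hB := weylLead_nonneg (x := x t) (y := y t) (h.reduced.m_pos t ht).le (h.m_le_one ht)
    have hW0 : 0 ≤ weylSq (σ t) (x t) (y t) (m t) := by rw [weylSq]; positivity
    set B := weylLead (x t) (y t) (m t)
    set W := Real.sqrt (weylSq (σ t) (x t) (y t) (m t)) with hW
    set D := Real.sqrt (B + Real.exp (-1 * (τ t - τ t0))) with hD
    have hWsq : W ^ 2 = weylSq (σ t) (x t) (y t) (m t) := Real.sq_sqrt hW0
    have hDsq : D ^ 2 = B + Real.exp (-1 * (τ t - τ t0)) :=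
      Real.sq_sqrt (add_nonneg hB (Real.exp_pos _).le)
    have hWn : 0 ≤ W := Real.sqrt_nonneg _
    have hDn : 0 ≤ D := Real.sqrt_nonneg _
    have hEp := Real.exp_pos (-1 * (τ t - τ t0))
    have h3 : |W ^ 2 - (2 * D) ^ 2| ≤ c2 * Real.exp (-1 * (τ t - τ t0)) := by
      rw [hWsq, mul_pow, hDsq, hc2]
      obtain ⟨l, u⟩ := abs_le.1 h2
      rw [abs_le]
      constructor <;> nlinarith
    -- For nonnegative numbers the squared difference is at most the difference of squares, so an
    -- error e^{-τ} in 𝒲² costs e^{-τ/2} in 𝒲 even when the limit is zero.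
    have h4 : |W - 2 * D| ^ 2 ≤ |W ^ 2 - (2 * D) ^ 2| := by
      rw [sq_sub_sq, abs_mul, sq, mul_comm, abs_of_nonneg (by positivity : 0 ≤ W + 2 * D)]
      refine mul_le_mul_of_nonneg_right ?_ (abs_nonneg _)
      exact abs_le.2 ⟨by linarith, by linarith⟩
    have h5 : |W - 2 * D| ≤ Real.sqrt c2 * Real.exp (-(1 / 2) * (τ t - τ t0)) := by
      refine (abs_le_of_sq_le_sq' ?_ (by positivity)).2
      rw [mul_pow, Real.sq_sqrt hc20.le, ← Real.exp_nat_mul,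
        show ((2 : ℕ) : ℝ) * (-(1 / 2) * (τ t - τ t0)) = -1 * (τ t - τ t0) by push_cast; ring]
      exact h4.trans h3
    have h6 := abs_add_le (W - 2 * D) (2 * (D - L))
    rw [abs_mul, abs_two, show W - 2 * D + 2 * (D - L) = W - 2 * L by ring] at h6
    linarith
  · have hbL : Real.sqrt b ≤ L := by
      refine ge_of_tendsto hlim ((eventually_ge_atTop t0).mono fun t ht => ?_)
      exact Real.sqrt_le_sqrt (by linarith [hbt t ht, Real.exp_pos (-1 * (τ t - τ t0))])
    have := Real.sqrt_pos.2 hb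
    linarith

end HasRoughDecay

section

/-! ### Future-global bounds for solutions with small data -/

variable {t0 P0 : ℝ} {g k : ℝ → Matrix (Fin 3) (Fin 3) ℝ} {f : ℝ → (Fin 3 → ℝ) → ℝ} {τ : ℝ → ℝ}

theorem hasRoughDecay_of_small_data (h : IsSolution structVII0 t0 g k f)
    (hr : IsReflectionSymmetric t0 g k f)
    (hs : ∀ t, t0 ≤ t → IsSmallReduced t0 t P0 (fun t => hubble (g t) (k t)) τ
      (fun t => sigmaPlus (g t) (k t)) (fun t => sigmaMinus (g t) (k t))
      (fun t => nMinus (g t) (k t)) (fun t => varM (g t) (k t))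
      (fun t => normStress (g t) (k t) (f t)))
    (hτ : ∀ t, t0 ≤ t → HasDerivWithinAt τ (hubble (g t) (k t)) (Ici t0) t)
    (hσ0 : |sigmaPlus (g t0) (k t0)| ≤ 1 / 10000) (hx0 : varX (g t0) (k t0) ≤ 1 / 10000)
    (hm0 : varM (g t0) (k t0) ≤ 1 / 10000) :
    HasRoughDecay t0 (fun t => hubble (g t) (k t)) τ
      (fun t => sigmaPlus (g t) (k t)) (fun t => sigmaMinus (g t) (k t))
      (fun t => nMinus (g t) (k t)) (fun t => varM (g t) (k t))
      (fun t => normStress (g t) (k t) (f t)) := by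
  have hx0' : sigmaMinus (g t0) (k t0) ^ 2 + nMinus (g t0) (k t0) ^ 2 ≤ (1 / 10000) ^ 2 :=
    (Real.sqrt_le_left (by norm_num)).1 hx0
  refine ⟨isReduced h hr Subset.rfl hτ fun t ht => (hs t ht).reduced.hubble_pos t ⟨ht, le_rfl⟩,
    fun t ht i => ⟨(hs t ht).stress_nonneg t ⟨ht, le_rfl⟩ i, ?_⟩, fun t ht => ?_, fun t ht => ?_,
    fun t ht => ?_⟩
  · refine ((hs t ht).stress_le t ⟨ht, le_rfl⟩ i).trans
      (mul_le_mul_of_nonneg_right ?_ (Real.exp_pos _).le)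
    linarith [(hs t ht).momentum_le]
  · refine ((hs t ht).sigma_decay (ε := 1 / 10000) (by norm_num) le_rfl (hs t ht).momentum_le hx0'
      hσ0).trans (mul_le_mul_of_nonneg_right (by norm_num) (Real.exp_pos _).le)
  · refine (hs t ht).xy_decay.trans (mul_le_mul_of_nonneg_right ?_ (Real.exp_pos _).le)
    have h1 := (hs t ht).momentum_le
    have h2 := (hs t ht).momentum_nonneg
    nlinarith
  · refine (hs t ht).m_decay.trans (mul_le_mul_of_nonneg_right ?_ (Real.exp_pos _).le)
    linarith

/-- Two passes: a rough rate first, after which the shear term is a forcing that decays faster than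
e^{-2τ} and leaves the rate 2 intact. -/
theorem momentumSq_le_exp_neg_two (h : IsSolution structVII0 t0 g k f)
    (hr : IsReflectionSymmetric t0 g k f)
    (hd : HasRoughDecay t0 (fun t => hubble (g t) (k t)) τ
      (fun t => sigmaPlus (g t) (k t)) (fun t => sigmaMinus (g t) (k t))
      (fun t => nMinus (g t) (k t)) (fun t => varM (g t) (k t))
      (fun t => normStress (g t) (k t) (f t)))
    (hP : ∀ p, f t0 p ≠ 0 → momentumSq (g t0) p ≤ 1 / 10000)
    {t : ℝ} (ht : t0 ≤ t) {p : Fin 3 → ℝ} (hp : f t p ≠ 0) :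
    momentumSq (g t) p ≤ Real.exp (-2 * (τ t - τ t0)) := by
  have hH : ∀ r ∈ Icc t0 t, 0 < hubble (g r) (k r) := fun r hr => hd.reduced.hubble_pos r hr.1
  have hτ : ∀ r ∈ Icc t0 t, HasDerivWithinAt τ (hubble (g r) (k r)) (Icc t0 t) r := fun r hr =>
    (hd.reduced.deriv_time r hr.1).mono Icc_subset_Ici_self
  obtain ⟨V, V', hVt, ⟨q, hq, hV0⟩, hV⟩ := exists_characteristic_deriv h hr ht hH hp
  have hq' := hV0 ▸ hP q hq
  have hσ : ∀ r ∈ Icc t0 t, |sigmaPlus (g r) (k r)| ≤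
      1 / 100 * Real.exp (-(2 / 5) * (τ r - τ t0)) := fun r hr =>
    (hd.sigma r hr.1).trans (mul_le_mul_of_nonneg_left
      (Real.exp_le_exp.2 (by nlinarith [hd.time_le hr.1])) (by norm_num))
  have hx : ∀ r ∈ Icc t0 t, |sigmaMinus (g r) (k r)| ≤
      1 / 10 * Real.exp (-(2 / 5) * (τ r - τ t0)) := fun r hr => by
    refine abs_le_of_sq_le_sq ?_ (by positivity)
    have h1 := hd.xy r hr.1
    have e : (1 / 10 * Real.exp (-(2 / 5) * (τ r - τ t0))) ^ 2 =
        1 / 100 * Real.exp (-(4 / 5) * (τ r - τ t0)) := by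
      rw [mul_pow, ← Real.exp_nat_mul]
      ring_nf
    rw [e]
    beta_reduce at h1
    linarith [sq_nonneg (nMinus (g r) (k r))]
  have hexp : ∀ r ∈ Icc t0 t, Real.exp (-(2 / 5) * (τ r - τ t0)) ≤ 1 := fun r hr =>
    Real.exp_le_one_iff.2 (by nlinarith [hd.time_le hr.1])
  -- The rate is 2 - 4(1/100 + 1/10) = 39/25.
  have hcoef : ∀ r ∈ Icc t0 t, V' r ≤ -(39 / 25) * V r := fun r hr => by
    have h1 := (hV r hr).2.2
    have h2 := hσ r hr
    have h3 := hx r hr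
    have h4 := hexp r hr
    nlinarith [(hV r hr).1]
  have hrough : ∀ r ∈ Icc t0 t, V r ≤
      1 / 10000 * Real.exp (-(39 / 25) * (τ r - τ t0)) := fun r hr => by
    have hsub : Icc t0 r ⊆ Icc t0 t := Icc_subset_Icc_right hr.2
    have h1 := decay_of_deriv_le hr.1 (a := 39 / 25) (b := 0) (c := 0) (by norm_num)
      (fun u hu => (hτ u (hsub hu)).mono hsub) (fun u hu => (hV u (hsub hu)).2.1.mono hsub)
      (fun u hu => hH u (hsub hu)) (fun u hu => by simpa using hcoef u (hsub hu))
    have h2 : V r ≤ V t0 * Real.exp (-(39 / 25) * (τ r - τ t0)) := by simpa using h1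
    exact h2.trans (mul_le_mul_of_nonneg_right hq' (Real.exp_pos _).le)
  -- The exponent 103/50 = 39/25 + 1/2 exceeds 2, and 1/300 dominates 32/10000.
  have h1 := decay_of_deriv_le ht (a := 2) (b := 1 / 300) (c := 103 / 50) (by norm_num) hτ
    (fun r hr => (hV r hr).2.1) hH fun r hr => ?_
  · rw [← hVt]
    refine h1.trans ?_
    have h2 := Real.exp_pos (-2 * (τ t - τ t0))
    have h3 := Real.exp_pos (-(103 / 50) * (τ t - τ t0))
    norm_num at h2 h3 ⊢
    nlinarith
  · have h2 := hd.abs_sigma_le_sharp hr.1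
    have h3 : |sigmaMinus (g r) (k r)| ≤ Real.exp (-(1 / 2) * (τ r - τ t0)) := by
      refine abs_le_of_sq_le_sq ?_ (Real.exp_pos _).le
      have h4 := hd.xy_le_sharp hr.1
      have e : Real.exp (-(1 / 2) * (τ r - τ t0)) ^ 2 = Real.exp (-1 * (τ r - τ t0)) := by
        rw [← Real.exp_nat_mul]
        ring_nf
      rw [e]
      beta_reduce at h4
      linarith [sq_nonneg (nMinus (g r) (k r))]
    have h4 : Real.exp (-1 * (τ r - τ t0)) ≤ Real.exp (-(1 / 2) * (τ r - τ t0)) :=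
      hd.exp_neg_le_exp_neg hr.1 (by norm_num)
    have e : Real.exp (-(103 / 50) * (τ r - τ t0)) =
        Real.exp (-(1 / 2) * (τ r - τ t0)) * Real.exp (-(39 / 25) * (τ r - τ t0)) := by
      rw [← Real.exp_add]
      ring_nf
    have h5 : 4 * (|sigmaPlus (g r) (k r)| + |sigmaMinus (g r) (k r)|) * V r ≤
        4 * (8 * Real.exp (-(1 / 2) * (τ r - τ t0))) *
          (1 / 10000 * Real.exp (-(39 / 25) * (τ r - τ t0))) := by
      refine mul_le_mul ?_ (hrough r hr) (hV r hr).1 (by positivity)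
      beta_reduce at h2
      linarith
    have h6 := Real.exp_pos (-(103 / 50) * (τ r - τ t0))
    refine (hV r hr).2.2.trans ?_
    rw [e] at h6 ⊢
    linarith

theorem stressTrace_div_rho_bounds (h : IsSolution structVII0 t0 g k f)
    (hr : IsReflectionSymmetric t0 g k f) {t P : ℝ} (ht : t0 ≤ t) (hρ : 0 < rho (g t) (f t))
    (hP : ∀ p, f t p ≠ 0 → momentumSq (g t) p ≤ P) :
    |stressTrace (g t) (f t) / rho (g t) (f t)| ≤ 3 * P := by
  have hg := h.metric_pos ht
  have e := eq_diagonal_of_isDiag (hr.metric_diag t ht)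
  have h1 := stress_diagonal_nonneg hg (h.distribution_nonneg t ht)
  have h2 := stress_diagonal_le (P := P) hg (h.distribution_nonneg t ht)
    (continuous_distribution h ht) (by rw [← e]; exact hP)
  have h3 := stressTrace_diagonal (fun i => g t i i) hg (f t)
  rw [← e] at h1 h2 h3
  have h4 : ∀ i, 0 ≤ stress (g t) (f t) i i / g t i i := fun i => div_nonneg (h1 i) (hg i).le
  have h5 : ∀ i, stress (g t) (f t) i i / g t i i ≤ P * rho (g t) (f t) := fun i => by
    rw [div_le_iff₀ (hg i)]
    linarith [h2 i]
  rw [h3, Fin.sum_univ_three, abs_div, abs_of_pos hρ, div_le_iff₀ hρ,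
    abs_of_nonneg (by linarith [h4 0, h4 1, h4 2])]
  linarith [h5 0, h5 1, h5 2]

theorem rho_pos_of_small (h : IsSolution structVII0 t0 g k f) (hr : IsReflectionSymmetric t0 g k f)
    {t : ℝ} (ht : t0 ≤ t) (hH : 0 < hubble (g t) (k t)) (hσ : |sigmaPlus (g t) (k t)| ≤ 1 / 100)
    (hx : sigmaMinus (g t) (k t) ^ 2 + nMinus (g t) (k t) ^ 2 ≤ 1 / 100) :
    0 < rho (g t) (f t) := by
  rw [rho_eq h hr ht hH.ne']
  refine mul_pos (by positivity) ?_
  nlinarith [abs_nonneg (sigmaPlus (g t) (k t)), sq_abs (sigmaPlus (g t) (k t))]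

theorem exists_limit_metric (h : IsSolution structVII0 t0 g k f)
    (hr : IsReflectionSymmetric t0 g k f) (ht0 : 0 < t0) {K : ℝ}
    (hK : ∀ i, ∀ t, t0 ≤ t → |k t i i / g t i i - 2 / 3 * t⁻¹| ≤ K * t ^ (-(4 / 3) : ℝ)) :
    ∃ G G' : Matrix (Fin 3) (Fin 3) ℝ, ∀ a b,
      (fun t => t ^ (-(4 / 3) : ℝ) * g t a b - G a b)
          =O[atTop] (fun t : ℝ => t ^ (-(1 / 3) : ℝ)) ∧
      (fun t => t ^ (4 / 3 : ℝ) * (g t)⁻¹ a b - G' a b)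
          =O[atTop] (fun t : ℝ => t ^ (-(1 / 3) : ℝ)) := by
  have hlim := fun i => exists_limit_of_expansion ht0 (fun t ht => h.metric_pos ht i)
    (fun t ht => (h.metric_evolution t ht i i).congr_deriv (by
      have := (h.metric_pos ht i).ne'
      rw [mul_assoc, div_mul_cancel₀ _ this])) (hK i)
  choose L hL using hlim
  have hinv : ∀ t, t0 ≤ t → (g t)⁻¹ = Matrix.diagonal fun i => (g t i i)⁻¹ := fun t ht => by
    conv_lhs => rw [eq_diagonal_of_isDiag (hr.metric_diag t ht)]
    exact inv_diagonal_fin3 _ fun i => (h.metric_pos ht i).ne'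
  refine ⟨Matrix.diagonal fun i => Real.exp (L i), Matrix.diagonal fun i => Real.exp (-L i),
    fun a b => ?_⟩
  by_cases hab : a = b
  · subst hab
    refine ⟨by simpa using (hL a).1, ((hL a).2).congr' ?_ EventuallyEq.rfl⟩
    filter_upwards [eventually_ge_atTop t0] with t ht
    simp [hinv t ht]
  · refine ⟨(Asymptotics.isBigO_zero _ _).congr' ?_ EventuallyEq.rfl,
      (Asymptotics.isBigO_zero _ _).congr' ?_ EventuallyEq.rfl⟩
    · filter_upwards [eventually_ge_atTop t0] with t ht
      simp [hab, hr.metric_diag t ht hab]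
    · filter_upwards [eventually_ge_atTop t0] with t ht
      simp [hinv t ht, hab]

/-- The origin of τ is arbitrary, so the shift by `τ t0` goes into the constant. -/
theorem isBigO_exp_of_le {u τ : ℝ → ℝ} {t0 a c : ℝ}
    (hu : ∀ t, t0 ≤ t → |u t| ≤ c * Real.exp (-a * (τ t - τ t0))) :
    u =O[atTop] (fun t => Real.exp (-a * τ t)) := by
  refine Asymptotics.IsBigO.of_bound (c * Real.exp (a * τ t0)) ?_
  filter_upwards [eventually_ge_atTop t0] with t ht
  rw [Real.norm_eq_abs, Real.norm_eq_abs, Real.abs_exp, mul_assoc, ← Real.exp_add]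
  refine (hu t ht).trans (le_of_eq ?_)
  ring_nf

end

end BianchiVlasov

/-! ### The main theorem. -/

theorem mainTheorem1 :
    ∃ ε : ℝ, 0 < ε ∧
      ∀ (t0 : ℝ) (g k : ℝ → Matrix (Fin 3) (Fin 3) ℝ) (f : ℝ → (Fin 3 → ℝ) → ℝ) (τ : ℝ → ℝ),
        IsSolution structVII0 t0 g k f →
        IsReflectionSymmetric t0 g k f →
        -- the dimensionless time: dτ/dt = H
        (∀ t, t0 ≤ t → HasDerivWithinAt τ (hubble (g t) (k t)) (Ici t0) t) →
        -- normalisation of the time coordinate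
        0 < t0 → t0 = (2 / 3) * (hubble (g t0) (k t0))⁻¹ →
        -- small data
        momentumSup (g t0) (f t0) < ENNReal.ofReal ε →
        |sigmaPlus (g t0) (k t0)| < ε →
        varX (g t0) (k t0) < ε →
        varM (g t0) (k t0) < ε →
        -- the quotients below are meaningful
        (∀ t, t0 ≤ t → 0 < hubble (g t) (k t) ∧ 0 < rho (g t) (f t)) ∧
        -- the metric and its inverse
        (∃ G G' : Matrix (Fin 3) (Fin 3) ℝ, ∀ a b,
          (fun t => t ^ (-(4 / 3) : ℝ) * g t a b - G a b)
              =O[atTop] (fun t : ℝ => t ^ (-(1 / 3) : ℝ)) ∧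
          (fun t => t ^ (4 / 3 : ℝ) * (g t)⁻¹ a b - G' a b)
              =O[atTop] (fun t : ℝ => t ^ (-(1 / 3) : ℝ))) ∧
        -- Σ_+, X, M, S/ρ
        (fun t => sigmaPlus (g t) (k t)) =O[atTop] (fun t => Real.exp (-τ t)) ∧
        (fun t => varX (g t) (k t)) =O[atTop] (fun t => Real.exp (-(1 / 2) * τ t)) ∧
        (fun t => varM (g t) (k t)) =O[atTop] (fun t => Real.exp (-(1 / 2) * τ t)) ∧
        (fun t => stressTrace (g t) (f t) / rho (g t) (f t))
            =O[atTop] (fun t => Real.exp (-2 * τ t)) ∧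
        -- H = (2/3) t^{-1} (1 + O(t^{-2/3}))
        (fun t => (3 / 2) * t * hubble (g t) (k t) - 1)
            =O[atTop] (fun t : ℝ => t ^ (-(2 / 3) : ℝ)) ∧
        -- the Weyl parameter
        (∃ C : ℝ, 0 ≤ C ∧
          (fun t => weylParam (g t) (k t) - C) =O[atTop] (fun t => Real.exp (-(1 / 2) * τ t)) ∧
          (0 < varX (g t0) (k t0) →
            momentumSup (g t0) (f t0) ≤ ENNReal.ofReal (ε * varX (g t0) (k t0)) →
            0 < C)) := by
  refine ⟨1 / 10000, by norm_num, fun t0 g k f τ h hr hτ ht0 hn hP hσ0 hx0 hm0 => ?_⟩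
  have hH0 : 0 < hubble (g t0) (k t0) := by
    have : 0 < (2 / 3) * (hubble (g t0) (k t0))⁻¹ := hn ▸ ht0
    exact inv_pos.1 (by linarith)
  have hPtop : momentumSup (g t0) (f t0) ≠ ⊤ := (hP.trans ENNReal.ofReal_lt_top).ne
  set P0 := (momentumSup (g t0) (f t0)).toReal with hP0
  have hP0n : 0 ≤ P0 := ENNReal.toReal_nonneg
  have hP1 : P0 ≤ 1 / 10000 := ENNReal.toReal_le_of_le_ofReal (by norm_num) hP.le
  have hPs : ∀ p, f t0 p ≠ 0 → momentumSq (g t0) p ≤ P0 := fun p hp =>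
    momentumSq_le_toReal_momentumSup hPtop hp
  have hs := isSmallReduced_of_small_data h hr hτ hP0n hP1 hPs hH0 hσ0.le hx0.le hm0.le
  have hd := hasRoughDecay_of_small_data h hr hs hτ hσ0.le hx0.le hm0.le
  have hmom : ∀ t, t0 ≤ t → ∀ p, f t p ≠ 0 →
      momentumSq (g t) p ≤ Real.exp (-2 * (τ t - τ t0)) := fun t ht p hp =>
    momentumSq_le_exp_neg_two h hr hd (fun p hp => (hPs p hp).trans hP1) ht hp
  have hH : ∀ t, t0 ≤ t → 0 < hubble (g t) (k t) := hd.reduced.hubble_pos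
  have hρ : ∀ t, t0 ≤ t → 0 < rho (g t) (f t) := fun t ht =>
    rho_pos_of_small h hr ht (hH t ht)
      ((hs t ht).sigma_le t ⟨ht, le_rfl⟩)
      (((hs t ht).xy_le t ⟨ht, le_rfl⟩).trans (by norm_num))
  refine ⟨fun t ht => ⟨hH t ht, hρ t ht⟩, ?_, ?_, ?_, ?_, ?_, ?_, ?_⟩
  · have hK := fun i => hd.exists_abs_expansion_sub_le ht0 hn
      (θ := fun t => k t i i / g t i i) fun t ht => abs_expansion_sub_le h hr ht (hH t ht) i
    choose K hK0 hK using hK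
    -- Summing the three constants gives one that serves all components.
    refine exists_limit_metric h hr ht0 (K := ∑ i, K i) fun i t ht => (hK i t ht).trans ?_
    exact mul_le_mul_of_nonneg_right
      (Finset.single_le_sum (fun j _ => hK0 j) (Finset.mem_univ i))
      (Real.rpow_nonneg (ht0.trans_le ht).le _)
  · have := isBigO_exp_of_le (t0 := t0) (u := fun t => sigmaPlus (g t) (k t))
      (a := 1) (c := 7) fun t ht => hd.abs_sigma_le_sharp ht
    simpa using this
  · refine isBigO_exp_of_le (t0 := t0) (c := 1) fun t ht => ?_
    rw [varX, abs_of_nonneg (Real.sqrt_nonneg _), one_mul]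
    refine Real.sqrt_le_iff.2 ⟨(Real.exp_pos _).le, (hd.xy_le_sharp ht).trans (le_of_eq ?_)⟩
    rw [← Real.exp_nat_mul]
    ring_nf
  · refine isBigO_exp_of_le (t0 := t0) (c := 1 / 10) fun t ht => ?_
    rw [abs_of_pos (hd.reduced.m_pos t ht)]
    exact hd.m_le_sharp ht
  · exact isBigO_exp_of_le (t0 := t0) (c := 3) fun t ht =>
      stressTrace_div_rho_bounds h hr ht (hρ t ht) (hmom t ht)
  · refine Asymptotics.IsBigO.of_bound (6 * (9 / 2 * t0) ^ (2 / 3 : ℝ)) ?_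
    filter_upwards [eventually_ge_atTop t0] with t ht
    rw [Real.norm_eq_abs, Real.norm_of_nonneg (Real.rpow_nonneg (ht0.trans_le ht).le _)]
    exact hd.abs_hubble_mul_sub_le ht0 hn ht
  · obtain ⟨C, c, hC0, hC, hCpos⟩ := hd.exists_limit_sqrt_weylSq ht0 hn fun t ht i =>
      (normStress_bounds h hr ht (hH t ht) (Real.exp_pos _).le (hmom t ht) i).2
    refine ⟨C, hC0, isBigO_exp_of_le (t0 := t0) (c := c) fun t ht => ?_, fun hX hPX => ?_⟩
    · rw [weylParam_eq]
      exact hC t ht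
    · have hX2 : varX (g t0) (k t0) ^ 2 =
          sigmaMinus (g t0) (k t0) ^ 2 + nMinus (g t0) (k t0) ^ 2 := Real.sq_sqrt (by positivity)
      have hPX' : P0 ≤ 1 / 10000 * varX (g t0) (k t0) :=
        ENNReal.toReal_le_of_le_ofReal (by positivity) hPX
      -- The ratio P ≤ X/10000 gives P0² ≤ 10^{-8} X², well within the margin 10^{-5} required.
      obtain ⟨b, hb, hb'⟩ := hd.weylLead_pos_bound
        (fun t ht i => (hs t ht).stress_le t ⟨ht, le_rfl⟩ i)
        (by
          rw [← hX2]
          have := pow_le_pow_left₀ hP0n hPX' 2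
          nlinarith [sq_nonneg (varX (g t0) (k t0))])
        (by
          rw [← hX2]
          positivity)
      exact hCpos b hb hb'
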